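/- **Conventions.** A signed graph $\Sigma=(V,E,\sigma)$ is a finite graph (loops and multiple edges allowed) with a sign $\sigma(e)\in\{+,-\}$ on every edge; $E^+,E^-$ are the sets of positive and negative edges. A proper coloration is a map $\kappa:V\to\mathbb Z$ with $\kappa(a)\ne\sigma(e)\kappa(b)$ for every edge $e$ with endpoints $a,b$. The color set of size $2k$ is $\{\pm1,\dots,\pm k\}$, that of size $2k+1$ is $\{0,\pm1,\dots,\pm k\}$. The chromatic number $\chi(\Sigma)$ is the least size of a color set that admits a proper coloration; a minimal coloration is a proper one with colors in the color set of size $\chi(\Sigma)$; its deficiency is the number of unused colors of that set; $M(\Sigma)$ is the maximum deficiency of a minimal coloration. $\Sigma$ is 3-chromatic if $\chi(\Sigma)=3$. Running times count basic operations of a random access machine that stores numbers, arrays of numbers and arrays of lists of numbers. Each of the following costs one: writing a constant or a copy of a number, adding one, reading or writing an array entry, adding an entry at or removing an entry from the front of a list, emptying a list, a test for equality of two numbers or for emptiness of a list, and a round of a loop. **The algorithm MaxDef.** The input is a signed graph $\Sigma$, given by its vertex list and two arrays of adjacency lists, for the positive and for the negative edges. Start with $S=B=\emptyset$. 1. Delete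 all vertices not incident to a positive edge. 2. By depth-first search, check that every component $H_i$ of the positive subgraph is bipartite; if one is not, return 0. Otherwise collapse the two sides of each $H_i$ to vertices $a_i$ and $b_i$, without multiple edges of the same sign and without negative edges $a_ib_i$. The current graph $\Sigma_1$ now has the positive edges $a_ib_i$, and all its other edges are negative. Write $\bar a_i=b_i$, $\bar b_i=a_i$, and $N_-(x)$ for the set of negative neighbours of $x$ in $\Sigma_1$. To *choose* a vertex $x$ means to replace $S$ by $S\cup\{x\}$, $B$ by $B\cup N_-(x)$, and $\Sigma_1$ by $\Sigma_1\setminus\{x,\bar x\}$. 3. If $x,\bar x\in B$ for some vertex $x$ of $\Sigma_1$, return 0. 4. If $x\in B$ for some vertex $x$ of $\Sigma_1$, choose $\bar x$, then remove $x$ from $B$, and go to 3. 5. If $x$ and $\bar x$ both have loops for some $x$, return 0. 6. If some $x$ has a loop, choose $\bar x$ and go to 3. 7. If some $x$ is adjacent to both $z$ and $\bar z$ for some $z\notin\{x,\bar x\}$, choose $\bar x$ and go to 3. 8. If, for some $x$ and some $z\notin\{x,\bar x\}$, $x$ is adjacent to $z$ and $\bar x$ to $\bar z$, identify $x$ with $\bar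 z$ and $\bar x$ with $z$ (no multiple edges), delete the negative edge $x\bar x$ if there is one, and go to 3. 9. If some $x$ has degree one, choose $x$ and go to 3. 10. If $\Sigma_1$ is empty, return 1, together with the set of all original vertices that were collapsed or identified into elements of $S$. 11. Build the forcing graph: the digraph on the vertices of $\Sigma_1$ with an arc from $x$ to $y$ whenever $x\bar y$ is a negative edge. 12. Find a directed cycle $C$ of the forcing graph by depth-first search, and let $\bar C=\{\bar x: x\in C\}$. If $C\cap\bar C\neq\emptyset$, return 0. Otherwise identify $C$ to one vertex $x$ and $\bar C$ to one vertex $\bar x$ (no multiple edges of the same sign), delete the negative edge $x\bar x$ if there is one, and go to 3. **Theorem.** (a) There is a constant $C$ such that, for every 3-chromatic signed graph $\Sigma$ without multiple edges of the same sign, MaxDef halts on $\Sigma$, given by its adjacency lists, after at most $C\,|V|^5$ steps. (b) There is a polynomial $p$ such that, for every 3-chromatic signed graph $\Sigma$ without multiple edges of the same sign, given by a vertex list and two lists of positive and negative edges, building the adjacency lists and running MaxDef halts after at most $p(|V|+|E|)$ steps. (c) The decision problems "is $M(\Sigma)=1$?" and "is $M(\Sigma)=0$?" for 3-chromatic signed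 graphs $\Sigma$, given by a vertex list and two edge lists, are in P: for each of them there is an algorithm that answers correctly on every 3-chromatic signed graph, in time polynomial in the length of the input. -/

import Mathlib

/-! ## Signed graphs, colorations and deficiency -/

/-- A signed graph on the vertex set `V` with edge set `E`.  Loops and multiple edges are allowed;
`ends e` is the unordered pair of endpoints of `e`, and `sign e` is `1` or `-1`. -/
structure SignedGraph (V E : Type) where
  ends : E → Sym2 V
  sign : E → ℤˣ

namespace SignedGraph

variable {V E : Type}

/-- No two distinct edges have the same endpoints and the same sign. -/
def NoMultipleSameSign (G : SignedGraph V E) : Prop :=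
  ∀ e f : E, G.ends e = G.ends f → G.sign e = G.sign f → e = f

/-- `a` and `b` are joined by an edge of sign `ε`. -/
def Adj (G : SignedGraph V E) (ε : ℤˣ) (a b : V) : Prop :=
  ∃ e, G.ends e = s(a, b) ∧ G.sign e = ε

/-- `κ` is a proper coloration: `κ a ≠ σ(e) κ b` for every edge `e` with endpoints `a`, `b`. -/
def IsProper (G : SignedGraph V E) (κ : V → ℤ) : Prop :=
  ∀ (e : E) (a b : V), G.ends e = s(a, b) → κ a ≠ (G.sign e : ℤ) * κ b

/-- The color set of size `m`: `{±1, …, ±k}` if `m = 2k`, and `{0, ±1, …, ±k}` if `m = 2k + 1`. -/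
noncomputable def colorSet (m : ℕ) : Finset ℤ :=
  if Even m then (Finset.Icc (-((m / 2 : ℕ) : ℤ)) ((m / 2 : ℕ) : ℤ)).erase 0
  else Finset.Icc (-((m / 2 : ℕ) : ℤ)) ((m / 2 : ℕ) : ℤ)

/-- The least size of a color set with which the graph can be properly colored. -/
noncomputable def chromaticNumber (G : SignedGraph V E) : ℕ :=
  sInf {m | ∃ κ : V → ℤ, G.IsProper κ ∧ ∀ v, κ v ∈ colorSet m}

/-- A minimal coloration: proper, with colors in the color set of size `χ`. -/
def IsMinimal (G : SignedGraph V E) (κ : V → ℤ) : Prop :=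
  G.IsProper κ ∧ ∀ v, κ v ∈ colorSet G.chromaticNumber

open Classical in
/-- The deficiency of a (minimal) coloration: the number of unused colors of its color set. -/
noncomputable def deficiency (G : SignedGraph V E) (κ : V → ℤ) : ℕ :=
  ((colorSet G.chromaticNumber).filter fun c => ∀ v, κ v ≠ c).card

/-- The maximum deficiency `M`. -/
noncomputable def maxDeficiency (G : SignedGraph V E) : ℕ :=
  sSup {d | ∃ κ : V → ℤ, G.IsMinimal κ ∧ G.deficiency κ = d}

/-- `A` is an array of adjacency lists for the edges of sign `ε`; meant for graphs without multiple
edges of the same sign, where every neighbour appears once (a vertex with a loop is its own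
neighbour). -/
def IsAdjacencyArray (G : SignedGraph V E) (ε : ℤˣ) (A : V → List V) : Prop :=
  ∀ v, (A v).Nodup ∧ ∀ w, w ∈ A v ↔ G.Adj ε v w

/-- `L` lists the edges of sign `ε`, every edge exactly once, each as a pair of its endpoints. -/
def IsEdgeList (G : SignedGraph V E) (ε : ℤˣ) (L : List (V × V)) : Prop :=
  ∃ es : List E, es.Nodup ∧ (∀ e, e ∈ es ↔ G.sign e = ε) ∧
    L.map (fun p => s(p.1, p.2)) = es.map G.ends

end SignedGraph

/-- `vs` lists all vertices, every vertex exactly once. -/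
def IsVertexList {V : Type} (vs : List V) : Prop :=
  vs.Nodup ∧ ∀ v, v ∈ vs

/-! ## The machine model: a random access machine with lists, every basic operation costs one -/

/-- A memory state: numeric registers, arrays of numbers (`num a i` is entry `i` of array `a`), and
arrays of lists of numbers (`lst a i` is list `i` of array `a`). -/
structure Store where
  reg : ℕ → ℕ
  num : ℕ → ℕ → ℕ
  lst : ℕ → ℕ → List ℕ

namespace Store

def setReg (s : Store) (x n : ℕ) : Store :=
  { s with reg := Function.update s.reg x n }

def setNum (s : Store) (a i n : ℕ) : Store :=
  { s with num := Function.update s.num a (Function.update (s.num a) i n) }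

def setLst (s : Store) (a i : ℕ) (l : List ℕ) : Store :=
  { s with lst := Function.update s.lst a (Function.update (s.lst a) i l) }

end Store

/-- Programs.  In the explanations below `x`, `y`, `i` are registers and `a` is an array; arrays are
indexed by the contents of registers. -/
inductive Cmd : Type
  /-- do nothing -/
  | skip : Cmd
  /-- `x := n` for a number `n` written in the program -/
  | const (x n : ℕ) : Cmd
  /-- `x := y` -/
  | copy (x y : ℕ) : Cmd
  /-- `x := x + 1` -/
  | succ (x : ℕ) : Cmd
  /-- `x := num a [i]` -/
  | load (x a i : ℕ) : Cmd
  /-- `num a [i] := x` -/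
  | store (a i x : ℕ) : Cmd
  /-- put `x` in front of the list `lst a [i]` -/
  | push (a i x : ℕ) : Cmd
  /-- remove the first entry of `lst a [i]` and put it into `x`; no effect on an empty list -/
  | pop (x a i : ℕ) : Cmd
  /-- make `lst a [i]` empty -/
  | clear (a i : ℕ) : Cmd
  /-- run `c`, then `d` -/
  | seq (c d : Cmd) : Cmd
  /-- if `x = y` then `c` else `d` -/
  | ifEq (x y : ℕ) (c d : Cmd) : Cmd
  /-- if `lst a [i]` is empty then `c` else `d` -/
  | ifNil (a i : ℕ) (c d : Cmd) : Cmd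
  /-- run `c` once for every entry `x` of a list written in the program -/
  | iter (x : ℕ) (l : List ℕ) (c : Cmd) : Cmd
  /-- run `c` once for every entry `x` that `lst a [i]` has when the loop starts, in order -/
  | forEach (x a i : ℕ) (c : Cmd) : Cmd
  /-- run `c` as long as `x ≠ 0` -/
  | whileNe (x : ℕ) (c : Cmd) : Cmd

/-- `Exec c s s' t`: started in state `s`, the program `c` halts in state `s'` after exactly `t`
basic operations.  Every assignment, list operation, test, and round of a loop is counted. -/
inductive Exec : Cmd → Store → Store → ℕ → Prop
  | skip (s) : Exec .skip s s 1
  | const (s x n) : Exec (.const x n) s (s.setReg x n) 1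
  | copy (s x y) : Exec (.copy x y) s (s.setReg x (s.reg y)) 1
  | succ (s x) : Exec (.succ x) s (s.setReg x (s.reg x + 1)) 1
  | load (s x a i) : Exec (.load x a i) s (s.setReg x (s.num a (s.reg i))) 1
  | store (s a i x) : Exec (.store a i x) s (s.setNum a (s.reg i) (s.reg x)) 1
  | push (s a i x) :
      Exec (.push a i x) s (s.setLst a (s.reg i) (s.reg x :: s.lst a (s.reg i))) 1
  | pop_nil (s x a i) (h : s.lst a (s.reg i) = []) : Exec (.pop x a i) s s 1
  | pop_cons (s x a i n l) (h : s.lst a (s.reg i) = n :: l) :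
      Exec (.pop x a i) s ((s.setLst a (s.reg i) l).setReg x n) 1
  | clear (s a i) : Exec (.clear a i) s (s.setLst a (s.reg i) []) 1
  | seq {s s₁ s₂ c d t₁ t₂} (h₁ : Exec c s s₁ t₁) (h₂ : Exec d s₁ s₂ t₂) :
      Exec (.seq c d) s s₂ (t₁ + t₂)
  | ifEq_true {s s₁ x y c d t} (h : s.reg x = s.reg y) (h₁ : Exec c s s₁ t) :
      Exec (.ifEq x y c d) s s₁ (t + 1)
  | ifEq_false {s s₁ x y c d t} (h : s.reg x ≠ s.reg y) (h₁ : Exec d s s₁ t) :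
      Exec (.ifEq x y c d) s s₁ (t + 1)
  | ifNil_true {s s₁ a i c d t} (h : s.lst a (s.reg i) = []) (h₁ : Exec c s s₁ t) :
      Exec (.ifNil a i c d) s s₁ (t + 1)
  | ifNil_false {s s₁ a i c d t} (h : s.lst a (s.reg i) ≠ []) (h₁ : Exec d s s₁ t) :
      Exec (.ifNil a i c d) s s₁ (t + 1)
  | iter_nil (s x c) : Exec (.iter x [] c) s s 1
  | iter_cons {s s₁ s₂ x n l c t₁ t₂} (h₁ : Exec c (s.setReg x n) s₁ t₁)
      (h₂ : Exec (.iter x l c) s₁ s₂ t₂) : Exec (.iter x (n :: l) c) s s₂ (t₁ + t₂ + 1)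
  | forEach {s s₁ x a i c t} (h₁ : Exec (.iter x (s.lst a (s.reg i)) c) s s₁ t) :
      Exec (.forEach x a i c) s s₁ (t + 1)
  | while_done {s x c} (h : s.reg x = 0) : Exec (.whileNe x c) s s 1
  | while_step {s s₁ s₂ x c t₁ t₂} (h : s.reg x ≠ 0) (h₁ : Exec c s s₁ t₁)
      (h₂ : Exec (.whileNe x c) s₁ s₂ t₂) : Exec (.whileNe x c) s s₂ (t₁ + t₂ + 1)

/-- A program started in a given state has at most one final state and one running time. -/
theorem Exec.deterministic {c : Cmd} {s s₁ s₂ : Store} {t₁ t₂ : ℕ}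
    (h₁ : Exec c s s₁ t₁) (h₂ : Exec c s s₂ t₂) : s₁ = s₂ ∧ t₁ = t₂ := by
  induction h₁ generalizing s₂ t₂ with
  | seq _ _ ih₁ ih₂ =>
    cases h₂ with
    | seq k₁ k₂ =>
      obtain ⟨rfl, rfl⟩ := ih₁ k₁
      obtain ⟨rfl, rfl⟩ := ih₂ k₂
      exact ⟨rfl, rfl⟩
  | iter_cons _ _ ih₁ ih₂ =>
    cases h₂ with
    | iter_cons k₁ k₂ =>
      obtain ⟨rfl, rfl⟩ := ih₁ k₁
      obtain ⟨rfl, rfl⟩ := ih₂ k₂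
      exact ⟨rfl, rfl⟩
  | forEach _ ih =>
    cases h₂ with
    | forEach k =>
      obtain ⟨rfl, rfl⟩ := ih k
      exact ⟨rfl, rfl⟩
  | while_step h _ _ ih₁ ih₂ =>
    cases h₂ with
    | while_done h' => exact absurd h' h
    | while_step _ k₁ k₂ =>
      obtain ⟨rfl, rfl⟩ := ih₁ k₁
      obtain ⟨rfl, rfl⟩ := ih₂ k₂
      exact ⟨rfl, rfl⟩
  | ifEq_true h _ ih =>
    cases h₂ with
    | ifEq_true _ k => obtain ⟨rfl, rfl⟩ := ih k; exact ⟨rfl, rfl⟩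
    | ifEq_false h' _ => exact absurd h h'
  | ifEq_false h _ ih =>
    cases h₂ with
    | ifEq_true h' _ => exact absurd h' h
    | ifEq_false _ k => obtain ⟨rfl, rfl⟩ := ih k; exact ⟨rfl, rfl⟩
  | ifNil_true h _ ih =>
    cases h₂ with
    | ifNil_true _ k => obtain ⟨rfl, rfl⟩ := ih k; exact ⟨rfl, rfl⟩
    | ifNil_false h' _ => exact absurd h h'
  | ifNil_false h _ ih =>
    cases h₂ with
    | ifNil_true h' _ => exact absurd h' h
    | ifNil_false _ k => obtain ⟨rfl, rfl⟩ := ih k; exact ⟨rfl, rfl⟩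
  | pop_nil s x a i h =>
    cases h₂ with
    | pop_nil => exact ⟨rfl, rfl⟩
    | pop_cons _ _ _ _ _ _ h' => simp [h] at h'
  | pop_cons s x a i n l h =>
    cases h₂ with
    | pop_nil _ _ _ _ h' => simp [h] at h'
    | pop_cons _ _ _ _ _ _ h' =>
      rw [h] at h'
      cases h'
      exact ⟨rfl, rfl⟩
  | while_done h =>
    cases h₂ with
    | while_done _ => exact ⟨rfl, rfl⟩
    | while_step h' _ _ => exact absurd h h'
  | _ => cases h₂; exact ⟨rfl, rfl⟩

/-- Run a list of programs one after the other. -/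
def Cmd.block : List Cmd → Cmd
  | [] => .skip
  | [c] => c
  | c :: cs => .seq c (block cs)

/-! ## Polynomial time -/

/-- The initial state on an input that consists of finitely many lists of numbers: list number `j`
of the input is list `j` of array `0`; everything else is zero or empty. -/
def Store.ofInput (w : List (List ℕ)) : Store where
  reg := fun _ => 0
  num := fun _ _ => 0
  lst := fun a j => if a = 0 then w.getD j [] else []

/-- The register that holds the answer when a program halts. -/
abbrev answerReg : ℕ := 1

/-- The length of an input, with numbers written in binary and one separator per entry and per
list. -/
def inputSize (w : List (List ℕ)) : ℕ :=
  (w.map fun l => 1 + (l.map fun n => 1 + Nat.size n).sum).sum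

/-- The promise problem with the given yes-instances and no-instances is in the class P: some
program, on every instance, halts within a number of steps that is polynomial in the input length,
with answer `1` on yes-instances and `0` on no-instances.  (A step writes a fixed number, copies a
number or increases it by one, and changes a list by one entry or empties it, so these programs and
Turing machines simulate each other with polynomial overhead.) -/
def InP (yes no : Set (List (List ℕ))) : Prop :=
  ∃ (c : Cmd) (p : Polynomial ℕ), ∀ w ∈ yes ∪ no, ∃ s t,
    Exec c (Store.ofInput w) s t ∧ t ≤ p.eval (inputSize w) ∧
      (w ∈ yes → s.reg answerReg = 1) ∧ (w ∈ no → s.reg answerReg = 0)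

/-! ## Input formats for signed graphs on the vertex set `{0, …, n - 1}` -/

/-- A vertex list and two edge lists (an edge contributes its two endpoints, one after the other). -/
def graphInput {n : ℕ} (vs : List (Fin n)) (pos neg : List (Fin n × Fin n)) : List (List ℕ) :=
  [vs.map Fin.val, pos.flatMap fun p => [p.1.val, p.2.val], neg.flatMap fun p => [p.1.val, p.2.val]]

/-- The input `w` consists of the vertex list, the list of positive edges and the list of negative
edges of `G`. -/
def Encodes {n : ℕ} {E : Type} (w : List (List ℕ)) (G : SignedGraph (Fin n) E) : Prop :=
  ∃ vs pos neg, IsVertexList vs ∧ G.IsEdgeList 1 pos ∧ G.IsEdgeList (-1) neg ∧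
    w = graphInput vs pos neg

/-- The inputs that describe 3-chromatic signed graphs whose maximum deficiency satisfies `Q`. -/
def threeChromaticInputs (Q : ℕ → Prop) : Set (List (List ℕ)) :=
  {w | ∃ (n : ℕ) (E : Type) (G : SignedGraph (Fin n) E),
    Encodes w G ∧ G.chromaticNumber = 3 ∧ Q G.maxDeficiency}

/-! ## The algorithm MaxDef -/

namespace MaxDef

open Cmd

/- Registers.  Register `zero` is never written to. -/
abbrev zero : ℕ := 0
abbrev ans : ℕ := answerReg
abbrev active : ℕ := 2
abbrev found : ℕ := 3
abbrev flag : ℕ := 4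
abbrev x : ℕ := 5
abbrev xb : ℕ := 6
abbrev y : ℕ := 7
abbrev yb : ℕ := 8
abbrev z : ℕ := 9
abbrev zb : ℕ := 10
abbrev v : ℕ := 11
abbrev vb : ℕ := 12
abbrev w : ℕ := 13
abbrev wb : ℕ := 14
abbrev u : ℕ := 15
abbrev tmp : ℕ := 16
abbrev hit : ℕ := 17
abbrev cur : ℕ := 18
abbrev nxt : ℕ := 19
abbrev more : ℕ := 20
abbrev bad : ℕ := 21
abbrev aName : ℕ := 22
abbrev bName : ℕ := 23
abbrev fresh : ℕ := 24
abbrev opp : ℕ := 25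
abbrev one : ℕ := 26
abbrev idx : ℕ := 27

/- Arrays of numbers: `bar` holds the partner of each vertex of the flattened graph, `name` the
vertex of the flattened graph to which an original vertex is collapsed, `seen` and `mark` the
vertices visited by the two searches. -/
abbrev bar : ℕ := 0
abbrev name : ℕ := 1
abbrev seen : ℕ := 2
abbrev mark : ℕ := 3

/- Arrays of lists.  Arrays `posA` and `negA` hold the adjacency lists of the given graph, `negG`
the negative adjacency lists of the current graph, `forc` those of the forcing graph and `recov` the
recovery information.  The others hold a single list, list `0`; `input` holds the vertex list
there, and, if the graph is given by edge lists, those in lists `1` and `2`. -/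
abbrev input : ℕ := 0
abbrev posA : ℕ := 1
abbrev negA : ℕ := 2
abbrev vPlus : ℕ := 3
abbrev stack : ℕ := 4
abbrev live : ℕ := 5
abbrev negG : ℕ := 6
abbrev setS : ℕ := 7
abbrev setB : ℕ := 8
abbrev recov : ℕ := 9
abbrev buf : ℕ := 10
abbrev forc : ℕ := 11
abbrev path : ℕ := 12
abbrev cyc : ℕ := 13
abbrev cycBar : ℕ := 14
abbrev cover : ℕ := 15

/-- `r := 1` if `e` is in `lst a [i]`, otherwise `r := 0`. -/
def mem (r e a i : ℕ) : Cmd :=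
  block [const r 0, forEach tmp a i (ifEq tmp e (const r 1) skip)]

/-- Add `e` to `lst a [i]` unless it is already there. -/
def add (e a i : ℕ) : Cmd :=
  block [mem hit e a i, ifEq hit zero (push a i e) skip]

/-- Delete every occurrence of `e` in `lst a [i]`. -/
def delete (e a i : ℕ) : Cmd :=
  block [clear buf zero,
    forEach tmp a i (ifEq tmp e skip (push buf zero tmp)),
    clear a i,
    forEach tmp buf zero (push a i tmp)]

/-- Look for a vertex `x` of the current graph such that `cond`, run with `v = x`, leaves `flag`
nonzero; then `found = 1`.  If there is none, `found = 0`. -/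
def find (cond : Cmd) : Cmd :=
  block [const found 0,
    forEach v live zero
      (ifEq found zero
        (block [cond, ifEq flag zero skip (block [copy x v, const found 1])])
        skip)]

/-- If `cond` holds for some vertex `x`, run `act`, otherwise continue with `next`. -/
def lookFor (cond act next : Cmd) : Cmd :=
  block [find cond, ifEq found zero next act]

/-- End the algorithm with the given answer. -/
def finish (n : ℕ) : Cmd :=
  block [const ans n, const active 0]

/-- Put `y` into `S` and its negative neighbours into `B`, and delete `y` and its partner `yb` from
the current graph. -/
def choose : Cmd :=
  block [push setS zero y,
    forEach u negG y (add u setB zero),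
    forEach u live zero (block [delete y negG u, delete yb negG u]),
    clear negG y, clear negG yb,
    delete y live zero, delete yb live zero]

/-- Identify the vertex `d` of the current graph to the vertex `k`, without creating multiple edges,
and update the recovery information. -/
def identify (k d : ℕ) : Cmd :=
  block [forEach w negG d (add w negG k),
    clear negG d,
    delete d live zero,
    forEach u live zero
      (block [mem flag d negG u,
        ifEq flag zero skip (block [delete d negG u, add k negG u])]),
    forEach w recov d (push recov k w),
    clear recov d]

/-- Delete the negative edge between `k` and `l`, if there is one. -/
def deleteEdge (k l : ℕ) : Cmd :=
  block [delete l negG k, delete k negG l]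

/-- Step 1: delete the vertices that are not incident to a positive edge. -/
def step1 : Cmd :=
  forEach v input zero
    (ifNil posA v
      (block [clear negA v, forEach u input zero (delete v negA u)])
      (push vPlus zero v))

/-- Step 2, first part: depth-first search of the positive components.  A component gets two new
vertices `aName`, `bName` (`0, 1`, then `2, 3`, and so on), its two sides are recorded in `name` and
in the recovery array; `bad` becomes `1` if some component is not bipartite. -/
def step2Search : Cmd :=
  block [const bad 0, const fresh 0, const one 1,
    forEach v vPlus zero
      (block [load hit seen v,
        ifEq hit zero
          (block [copy aName fresh, succ fresh, copy bName fresh, succ fresh,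
            store bar aName bName, store bar bName aName,
            push live zero aName, push live zero bName,
            store seen v one, store name v aName, push recov aName v, push stack zero v,
            const more 1,
            whileNe more
              (block [pop cur stack zero,
                load x name cur, load opp bar x,
                forEach w posA cur
                  (block [load hit seen w,
                    ifEq hit zero
                      (block [store seen w one, store name w opp, push recov opp w,
                        push stack zero w])
                      (block [load y name w, ifEq y x (const bad 1) skip])]),
                ifNil stack zero (const more 0) skip])])
          skip])]

/-- Step 2, second part: collapse the sides of all components, without creating multiple edges and
without the negative edges between the two sides of one component. -/
def step2Collapse : Cmd :=
  forEach v vPlus zero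
    (block [load x name v, load xb bar x,
      forEach w negA v
        (block [load y name w, ifEq y xb skip (add y negG x)])])

/-- Step 3: if some `x` and its partner are both in `B`, the answer is 0. -/
def step3 (next : Cmd) : Cmd :=
  lookFor
    (block [mem flag v setB zero,
      ifEq flag zero skip (block [load vb bar v, mem flag vb setB zero])])
    (finish 0) next

/-- Step 4: if some `x` is in `B`, its partner is chosen and `x` is deleted from `B`. -/
def step4 (next : Cmd) : Cmd :=
  lookFor (mem flag v setB zero)
    (block [load y bar x, copy yb x, choose, delete x setB zero]) next

/-- Step 5: if some `x` and its partner both have loops, the answer is 0. -/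
def step5 (next : Cmd) : Cmd :=
  lookFor
    (block [mem flag v negG v,
      ifEq flag zero skip (block [load vb bar v, mem flag vb negG vb])])
    (finish 0) next

/-- Step 6: if some `x` has a loop, its partner is chosen. -/
def step6 (next : Cmd) : Cmd :=
  lookFor (mem flag v negG v)
    (block [load y bar x, copy yb x, choose]) next

/-- Step 7: if some `x` is adjacent to both vertices of a matched pair, its partner is chosen. -/
def step7 (next : Cmd) : Cmd :=
  lookFor
    (block [const flag 0,
      forEach w negG v
        (block [load wb bar w, mem hit wb negG v, ifEq hit zero skip (const flag 1)])])
    (block [load y bar x, copy yb x, choose]) next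

/-- Step 8: if some `x` is adjacent to `z`, and the partner of `x` to the partner of `z`, where `z`
is in another matched pair, then `x` is identified with the partner of `z` and conversely. -/
def step8 (next : Cmd) : Cmd :=
  lookFor
    (block [const flag 0, load vb bar v,
      forEach w negG v
        (ifEq w v skip (ifEq w vb skip
          (block [load wb bar w, mem hit wb negG vb,
            ifEq hit zero skip (block [copy z w, const flag 1])])))])
    (block [load xb bar x, load zb bar z, identify x zb, identify xb z, deleteEdge x xb]) next

/-- Step 9: a vertex of degree one (which has no negative edge) is chosen. -/
def step9 (next : Cmd) : Cmd :=
  lookFor (ifNil negG v (const flag 1) (const flag 0))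
    (block [copy y x, load yb bar x, choose]) next

/-- Step 10: if the current graph is empty, the answer is 1 and the cover is recovered from `S`. -/
def step10 (next : Cmd) : Cmd :=
  ifNil live zero
    (block [finish 1, forEach v setS zero (forEach w recov v (push cover zero w))])
    next

/-- Step 11: build the forcing graph. -/
def step11 : Cmd :=
  forEach v live zero
    (block [clear forc v, forEach w negG v (block [load wb bar w, push forc v wb])])

/-- Step 12, first part: a depth-first search in the forcing graph up to the first vertex that it
meets twice (every vertex has an outgoing edge, so it never backtracks) gives a cycle through
`cur`; the cycle and its image under `bar` are stored. -/
def findCycle : Cmd :=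
  block [clear path zero, clear cyc zero, clear cycBar zero, const one 1,
    forEach v live zero (block [store mark v zero, copy cur v]),
    const more 1,
    whileNe more
      (block [store mark cur one, push path zero cur,
        copy nxt cur,
        forEach w forc cur (copy nxt w),
        copy cur nxt,
        load hit mark cur,
        ifEq hit zero skip (const more 0)]),
    const flag 0,
    forEach v path zero
      (ifEq flag zero
        (block [push cyc zero v, load vb bar v, push cycBar zero vb,
          ifEq v cur (const flag 1) skip])
        skip)]

/-- Step 12: if the two cycles are not disjoint the answer is 0, otherwise each is identified to one
vertex. -/
def step12 : Cmd :=
  block [findCycle,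
    const found 0,
    forEach v cyc zero (block [mem flag v cycBar zero, ifEq flag zero skip (const found 1)]),
    ifEq found zero
      (block [copy x cur, load xb bar x,
        forEach v cyc zero (ifEq v x skip (identify x v)),
        forEach v cycBar zero (ifEq v xb skip (identify xb v)),
        deleteEdge x xb])
      (finish 0)]

/-- One pass through Steps 3 to 12, up to the return to Step 3 or the end of the algorithm. -/
def pass : Cmd :=
  step3 (step4 (step5 (step6 (step7 (step8 (step9 (step10 (seq step11 step12))))))))

/-- The algorithm MaxDef. -/
def maxDef : Cmd :=
  block [step1, step2Search,
    ifEq bad zero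
      (block [step2Collapse, const active 1, whileNe active pass])
      (const ans 0)]

/-- Build one array of adjacency lists from the edge list in `input [idx]`. -/
def readEdges (a : ℕ) : Cmd :=
  block [const more 1,
    whileNe more
      (ifNil input idx (const more 0)
        (block [pop x input idx, pop y input idx, push a x y,
          ifEq x y skip (push a y x)]))]

/-- MaxDef for a graph that is given by a vertex list and two edge lists. -/
def maxDefOfLists : Cmd :=
  block [const idx 1, readEdges posA, const idx 2, readEdges negA, maxDef]

/-- The initial state of MaxDef on a graph that is given by a vertex list and two arrays of
adjacency lists. -/
def adjacencyInput {n : ℕ} (vs : List (Fin n)) (pos neg : Fin n → List (Fin n)) : Store where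
  reg := fun _ => 0
  num := fun _ _ => 0
  lst := fun a j =>
    if a = input then (if j = 0 then vs.map Fin.val else [])
    else if h : j < n then
      (if a = posA then (pos ⟨j, h⟩).map Fin.val
      else if a = negA then (neg ⟨j, h⟩).map Fin.val
      else [])
    else []

end MaxDef

/-! Parts (a) and (b) concern halting and time only, so the answers of MaxDef play no role in them.
It suffices to know that every loop makes few rounds: `wp L c Q s` certifies this with the bound `L`
for each loop, `exec_of_wp` turns the certificate into the time bound `c.bound L`, and by
`exists_bound_le` that is at most a constant times `(L + 1) ^ d`, where `d` is the nesting depth of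
the loops. For `maxDef` this depth is at most 5, so (a) follows once `L` can be taken linear in the
number `n` of vertices.

Most bounds on rounds are immediate: the flattened graph has names below `2 * n`, its lists have no
repetitions, and the recovery lists have at most `n` entries altogether. In the depth-first search
every vertex enters the stack at most once, so stack plus unseen vertices decreases. In the main
loop every pass either ends the algorithm or removes a live vertex.

The last claim is delicate only for Step 12. When Step 9 finds nothing, every vertex has an out-arc
in the forcing graph, so a walk goes on until it repeats a vertex. An arc from `x` to itself would
be a negative edge between partners; the invariant excludes those, so the cycle has at least two
vertices and its identification shrinks the graph. Identifications can create such an edge only at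
the merged pair, where it is deleted again. For (b), reading the edge lists adds loops whose rounds
are bounded by the number of edges.

Part (c) is proved with a shorter program. In a 3-chromatic signed graph a minimal coloration uses
the color 0 (otherwise two colors would do) and a nonzero color (otherwise one would do). So it
misses at most one color, and if it misses one, the vertices colored 0 form a set containing exactly
one end of every positive and at most one end of every negative edge. Conversely, color such a
stable cover 0 and the rest 1. Hence `M` is 1 or 0 according to whether a stable cover exists
(`maxDeficiency_eq`). This is an instance of 2-satisfiability, solvable unless some literal and its
negation imply each other (`exists_closed_of_forall_not_reflTransGen`), and the program finds all
consequences of a literal by propagation (`wp_test`). -/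

/-! ## A weakest precondition calculus with automatic time bounds -/

namespace Cmd

/-- A bound for the running time when every loop over a list and every `while` loop makes at most
`L` rounds. -/
def bound (L : ℕ) : Cmd → ℕ
  | seq c d => c.bound L + d.bound L
  | ifEq _ _ c d => c.bound L + d.bound L + 1
  | ifNil _ _ c d => c.bound L + d.bound L + 1
  | iter _ l c => l.length * (c.bound L + 1) + 1
  | forEach _ _ _ c => L * (c.bound L + 1) + 2
  | whileNe _ c => L * (c.bound L + 1) + 1
  | _ => 1

/-- The nesting depth of the loops of a program. -/
def depth : Cmd → ℕ
  | seq c d => max c.depth d.depth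
  | ifEq _ _ c d => max c.depth d.depth
  | ifNil _ _ c d => max c.depth d.depth
  | iter _ _ c => c.depth
  | forEach _ _ _ c => c.depth + 1
  | whileNe _ c => c.depth + 1
  | _ => 0

/-- Each `forEach` or `whileNe` multiplies the bound by a factor of order `L`, while an `iter` over
a list fixed in the program costs only a constant factor; so the degree is the nesting depth. The
base `L + 1` keeps all powers at least 1, so that constants can be absorbed even for `L = 0`. -/
theorem exists_bound_le (c : Cmd) : ∃ K, ∀ L, c.bound L ≤ K * (L + 1) ^ c.depth := by
  have base : ∃ K, ∀ L, 1 ≤ K * (L + 1) ^ 0 := ⟨1, fun L => by simp⟩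
  have both : ∀ c d : Cmd, (∃ K, ∀ L, c.bound L ≤ K * (L + 1) ^ c.depth) →
      (∃ K, ∀ L, d.bound L ≤ K * (L + 1) ^ d.depth) →
      ∃ K, ∀ L, c.bound L + d.bound L + 1 ≤ K * (L + 1) ^ max c.depth d.depth := by
    rintro c d ⟨K, hK⟩ ⟨K', hK'⟩
    refine ⟨K + K' + 1, fun L => ?_⟩
    have h₁ : (L + 1) ^ c.depth ≤ (L + 1) ^ max c.depth d.depth :=
      Nat.pow_le_pow_right (by omega) (le_max_left _ _)
    have h₂ : (L + 1) ^ d.depth ≤ (L + 1) ^ max c.depth d.depth :=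
      Nat.pow_le_pow_right (by omega) (le_max_right _ _)
    have h₃ : 1 ≤ (L + 1) ^ max c.depth d.depth := Nat.one_le_pow _ _ (by omega)
    nlinarith [hK L, hK' L, Nat.mul_le_mul_left K h₁, Nat.mul_le_mul_left K' h₂]
  have loop : ∀ c : Cmd, (∃ K, ∀ L, c.bound L ≤ K * (L + 1) ^ c.depth) →
      ∃ K, ∀ L, L * (c.bound L + 1) + 2 ≤ K * (L + 1) ^ (c.depth + 1) := by
    rintro c ⟨K, hK⟩
    refine ⟨K + 3, fun L => ?_⟩
    have h₃ : 1 ≤ (L + 1) ^ c.depth := Nat.one_le_pow _ _ (by omega)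
    have h₄ : L * (c.bound L + 1) ≤ (L + 1) * (K * (L + 1) ^ c.depth + (L + 1) ^ c.depth) :=
      Nat.mul_le_mul (by omega) (by have := hK L; omega)
    have h₅ : 1 ≤ (L + 1) ^ (c.depth + 1) := Nat.one_le_pow _ _ (by omega)
    calc L * (c.bound L + 1) + 2
        ≤ (L + 1) * (K * (L + 1) ^ c.depth + (L + 1) ^ c.depth) + 2 * (L + 1) ^ (c.depth + 1) := by
          omega
      _ = (K + 3) * (L + 1) ^ (c.depth + 1) := by ring
  induction c with
  | seq c d hc hd => exact (both c d hc hd).imp fun K h L => (Nat.le_succ _).trans (h L)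
  | ifEq _ _ c d hc hd => exact both c d hc hd
  | ifNil _ _ c d hc hd => exact both c d hc hd
  | iter _ l c hc =>
    obtain ⟨K, hK⟩ := hc
    refine ⟨l.length * (K + 1) + 1, fun L => ?_⟩
    have h₃ : 1 ≤ (L + 1) ^ c.depth := Nat.one_le_pow _ _ (by omega)
    have h₄ : l.length * (c.bound L + 1) ≤
        l.length * (K * (L + 1) ^ c.depth + (L + 1) ^ c.depth) :=
      Nat.mul_le_mul le_rfl (by have := hK L; omega)
    calc l.length * (c.bound L + 1) + 1
        ≤ l.length * (K * (L + 1) ^ c.depth + (L + 1) ^ c.depth) + (L + 1) ^ c.depth := by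
          omega
      _ = (l.length * (K + 1) + 1) * (L + 1) ^ c.depth := by ring
  | forEach _ _ _ c hc => exact loop c hc
  | whileNe _ c hc => exact (loop c hc).imp fun K h L => (Nat.le_succ _).trans (h L)
  | _ => exact base

/-- The registers, arrays of numbers and arrays of lists that a program may change. -/
def writesReg (r : ℕ) : Cmd → Bool
  | const x _ => r == x
  | copy x _ => r == x
  | succ x => r == x
  | load x _ _ => r == x
  | pop x _ _ => r == x
  | seq c d => c.writesReg r || d.writesReg r
  | ifEq _ _ c d => c.writesReg r || d.writesReg r
  | ifNil _ _ c d => c.writesReg r || d.writesReg r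
  | iter x _ c => r == x || c.writesReg r
  | forEach x _ _ c => r == x || c.writesReg r
  | whileNe _ c => c.writesReg r
  | _ => false

/-- The arrays of numbers a command may change. -/
def writesNum (b : ℕ) : Cmd → Bool
  | store a _ _ => b == a
  | seq c d => c.writesNum b || d.writesNum b
  | ifEq _ _ c d => c.writesNum b || d.writesNum b
  | ifNil _ _ c d => c.writesNum b || d.writesNum b
  | iter _ _ c => c.writesNum b
  | forEach _ _ _ c => c.writesNum b
  | whileNe _ c => c.writesNum b
  | _ => false

/-- The arrays of lists a command may change. -/
def writesLst (b : ℕ) : Cmd → Bool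
  | push a _ _ => b == a
  | pop _ a _ => b == a
  | clear a _ => b == a
  | seq c d => c.writesLst b || d.writesLst b
  | ifEq _ _ c d => c.writesLst b || d.writesLst b
  | ifNil _ _ c d => c.writesLst b || d.writesLst b
  | iter _ _ c => c.writesLst b
  | forEach _ _ _ c => c.writesLst b
  | whileNe _ c => c.writesLst b
  | _ => false

/-- `s'` differs from `s` only in what `c` may change. -/
structure Frame (c : Cmd) (s s' : Store) : Prop where
  reg : ∀ r, c.writesReg r = false → s'.reg r = s.reg r
  num : ∀ a, c.writesNum a = false → s'.num a = s.num a
  lst : ∀ a, c.writesLst a = false → s'.lst a = s.lst a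

theorem Frame.refl (c : Cmd) (s : Store) : Frame c s s :=
  ⟨fun _ _ => rfl, fun _ _ => rfl, fun _ _ => rfl⟩

theorem Frame.trans {c : Cmd} {s₁ s₂ s₃ : Store} (h : Frame c s₁ s₂) (h' : Frame c s₂ s₃) :
    Frame c s₁ s₃ :=
  ⟨fun r hr => (h'.reg r hr).trans (h.reg r hr), fun r hr => (h'.num r hr).trans (h.num r hr),
    fun r hr => (h'.lst r hr).trans (h.lst r hr)⟩

theorem Frame.mono {c d : Cmd} {s s' : Store} (h : Frame c s s')
    (hr : ∀ r, d.writesReg r = false → c.writesReg r = false)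
    (hn : ∀ r, d.writesNum r = false → c.writesNum r = false)
    (hl : ∀ r, d.writesLst r = false → c.writesLst r = false) : Frame d s s' :=
  ⟨fun r h' => h.reg r (hr r h'), fun r h' => h.num r (hn r h'), fun r h' => h.lst r (hl r h')⟩

theorem Frame.setReg {c : Cmd} {s : Store} {x n : ℕ} (h : c.writesReg x = true) :
    Frame c s (s.setReg x n) := by
  refine ⟨fun r hr => ?_, fun _ _ => rfl, fun _ _ => rfl⟩
  have : r ≠ x := by rintro rfl; simp [h] at hr
  simp [Store.setReg, this]

theorem Frame.setNum {c : Cmd} {s : Store} {a i n : ℕ} (h : c.writesNum a = true) :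
    Frame c s (s.setNum a i n) := by
  refine ⟨fun _ _ => rfl, fun r hr => ?_, fun _ _ => rfl⟩
  have : r ≠ a := by rintro rfl; simp [h] at hr
  simp [Store.setNum, this]

theorem Frame.setLst {c : Cmd} {s : Store} {a i : ℕ} {l : List ℕ} (h : c.writesLst a = true) :
    Frame c s (s.setLst a i l) := by
  refine ⟨fun _ _ => rfl, fun _ _ => rfl, fun r hr => ?_⟩
  have : r ≠ a := by rintro rfl; simp [h] at hr
  simp [Store.setLst, this]

/-- A sufficient condition for `c`, started in `s`, to halt in a state with property `Q`, while
every loop over a list and every `while` loop makes at most `L` rounds. -/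
def wp (L : ℕ) : Cmd → (Store → Prop) → Store → Prop
  | skip, Q => Q
  | const x n, Q => fun s => Q (s.setReg x n)
  | copy x y, Q => fun s => Q (s.setReg x (s.reg y))
  | succ x, Q => fun s => Q (s.setReg x (s.reg x + 1))
  | load x a i, Q => fun s => Q (s.setReg x (s.num a (s.reg i)))
  | store a i x, Q => fun s => Q (s.setNum a (s.reg i) (s.reg x))
  | push a i x, Q => fun s => Q (s.setLst a (s.reg i) (s.reg x :: s.lst a (s.reg i)))
  | pop x a i, Q => fun s => (s.lst a (s.reg i) = [] → Q s) ∧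
      ∀ n l, s.lst a (s.reg i) = n :: l → Q ((s.setLst a (s.reg i) l).setReg x n)
  | clear a i, Q => fun s => Q (s.setLst a (s.reg i) [])
  | seq c d, Q => wp L c (wp L d Q)
  | ifEq x y c d, Q => fun s => (s.reg x = s.reg y → wp L c Q s) ∧ (s.reg x ≠ s.reg y → wp L d Q s)
  | ifNil a i c d, Q => fun s =>
      (s.lst a (s.reg i) = [] → wp L c Q s) ∧ (s.lst a (s.reg i) ≠ [] → wp L d Q s)
  | iter x l c, Q => l.foldr (fun n K s => wp L c K (s.setReg x n)) Q
  | forEach x a i c, Q => fun s => (s.lst a (s.reg i)).length ≤ L ∧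
      (s.lst a (s.reg i)).foldr (fun n K s => wp L c K (s.setReg x n)) Q s
  | whileNe x c, Q =>
      (fun K s => (s.reg x = 0 → Q s) ∧ (s.reg x ≠ 0 → wp L c K s))^[L] fun s => s.reg x = 0 ∧ Q s

theorem iter_of_foldr {L : ℕ} {c : Cmd} {x : ℕ} {Q : Store → Prop}
    (ih : ∀ (Q : Store → Prop) s, wp L c Q s → ∃ s' t, Exec c s s' t ∧ t ≤ c.bound L ∧ Q s') :
    ∀ (l : List ℕ) (s : Store), l.foldr (fun n K s => wp L c K (s.setReg x n)) Q s →
      ∃ s' t, Exec (.iter x l c) s s' t ∧ t ≤ l.length * (c.bound L + 1) + 1 ∧ Q s'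
  | [], s, h => ⟨s, 1, .iter_nil _ _ _, by simp, h⟩
  | _ :: l, _, h => by
    obtain ⟨s₁, t₁, e₁, b₁, h₁⟩ := ih _ _ h
    obtain ⟨s₂, t₂, e₂, b₂, h₂⟩ := iter_of_foldr ih l s₁ h₁
    exact ⟨s₂, _, .iter_cons e₁ e₂, by simp only [List.length_cons]; nlinarith, h₂⟩

/-- Soundness of the calculus. Since `wp` already limits the rounds of every loop, the time bound
follows by induction on the program, and no steps need to be counted afterwards. -/
theorem exec_of_wp {L : ℕ} {c : Cmd} {Q : Store → Prop} {s : Store} (h : wp L c Q s) :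
    ∃ s' t, Exec c s s' t ∧ t ≤ c.bound L ∧ Q s' := by
  induction c generalizing Q s with
  | skip => exact ⟨_, _, .skip _, le_rfl, h⟩
  | const => exact ⟨_, _, .const _ _ _, le_rfl, h⟩
  | copy => exact ⟨_, _, .copy _ _ _, le_rfl, h⟩
  | succ => exact ⟨_, _, .succ _ _, le_rfl, h⟩
  | load => exact ⟨_, _, .load _ _ _ _, le_rfl, h⟩
  | store => exact ⟨_, _, .store _ _ _ _, le_rfl, h⟩
  | push => exact ⟨_, _, .push _ _ _ _, le_rfl, h⟩
  | clear => exact ⟨_, _, .clear _ _ _, le_rfl, h⟩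
  | pop x a i =>
    rcases hl : s.lst a (s.reg i) with _ | ⟨n, l⟩
    · exact ⟨_, _, .pop_nil _ _ _ _ hl, le_rfl, h.1 hl⟩
    · exact ⟨_, _, .pop_cons _ _ _ _ _ _ hl, le_rfl, h.2 n l hl⟩
  | seq c d hc hd =>
    obtain ⟨s₁, t₁, e₁, b₁, h₁⟩ := hc h
    obtain ⟨s₂, t₂, e₂, b₂, h₂⟩ := hd h₁
    exact ⟨s₂, _, .seq e₁ e₂, by simp only [bound]; omega, h₂⟩
  | ifEq x y c d hc hd =>
    by_cases hxy : s.reg x = s.reg y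
    · obtain ⟨s₁, t₁, e₁, b₁, h₁⟩ := hc (h.1 hxy)
      exact ⟨s₁, _, .ifEq_true hxy e₁, by simp only [bound]; omega, h₁⟩
    · obtain ⟨s₁, t₁, e₁, b₁, h₁⟩ := hd (h.2 hxy)
      exact ⟨s₁, _, .ifEq_false hxy e₁, by simp only [bound]; omega, h₁⟩
  | ifNil a i c d hc hd =>
    by_cases hl : s.lst a (s.reg i) = []
    · obtain ⟨s₁, t₁, e₁, b₁, h₁⟩ := hc (h.1 hl)
      exact ⟨s₁, _, .ifNil_true hl e₁, by simp only [bound]; omega, h₁⟩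
    · obtain ⟨s₁, t₁, e₁, b₁, h₁⟩ := hd (h.2 hl)
      exact ⟨s₁, _, .ifNil_false hl e₁, by simp only [bound]; omega, h₁⟩
  | iter x l c hc => exact iter_of_foldr (fun _ _ => hc) l s h
  | forEach x a i c hc =>
    obtain ⟨s₁, t₁, e₁, b₁, h₁⟩ := iter_of_foldr (fun _ _ => hc) _ s h.2
    refine ⟨s₁, _, .forEach e₁, ?_, h₁⟩
    have := Nat.mul_le_mul_right (c.bound L + 1) h.1
    simp only [bound]
    omega
  | whileNe x c hc =>
    simp only [wp, bound] at h ⊢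
    generalize hB : c.bound L + 1 = B
    revert h
    generalize hM : L = M
    rw [hM] at hc hB
    -- The number `k` of rounds left varies in the induction, while the bound `M` for the loops
    -- inside the body stays fixed.
    have : ∀ k s, ((fun (K : Store → Prop) s =>
        (s.reg x = 0 → Q s) ∧ (s.reg x ≠ 0 → wp M c K s))^[k] fun s => s.reg x = 0 ∧ Q s) s →
        ∃ s' t, Exec (.whileNe x c) s s' t ∧ t ≤ k * B + 1 ∧ Q s' := by
      intro k
      induction k with
      | zero => exact fun s h => ⟨s, _, .while_done h.1, by simp, h.2⟩
      | succ k ih =>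
        intro s h
        rw [Function.iterate_succ_apply'] at h
        by_cases hx : s.reg x = 0
        · exact ⟨s, _, .while_done hx, by simp, h.1 hx⟩
        · obtain ⟨s₁, t₁, e₁, b₁, h₁⟩ := hc (h.2 hx)
          obtain ⟨s₂, t₂, e₂, b₂, h₂⟩ := ih s₁ h₁
          exact ⟨s₂, _, .while_step hx e₁ e₂, by rw [Nat.succ_mul]; omega, h₂⟩
    exact this M s

/-- Shared by `iter` and `forEach`: `d` stands for the whole loop, whose frame contains the loop
register besides the frame of the body. -/
theorem foldr_conseq {L : ℕ} {c d : Cmd} {x : ℕ} {P Q : Store → Prop}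
    (ih : ∀ (P Q : Store → Prop) s, wp L c P s → (∀ s', Frame c s s' → P s' → Q s') → wp L c Q s)
    (hx : d.writesReg x = true) (hd : ∀ s s', Frame c s s' → Frame d s s') :
    ∀ (l : List ℕ) (s : Store), l.foldr (fun n K s => wp L c K (s.setReg x n)) P s →
      (∀ s', Frame d s s' → P s' → Q s') → l.foldr (fun n K s => wp L c K (s.setReg x n)) Q s
  | [], s, h, hQ => hQ s (.refl _ _) h
  | _ :: l, _, h, hQ =>
    ih _ _ _ h fun s₁ f h₁ => foldr_conseq ih hx hd l s₁ h₁ fun s₂ f₂ =>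
      hQ s₂ (((Frame.setReg hx).trans (hd _ _ f)).trans f₂)

/-- The rule of consequence, together with the fact that a program changes nothing outside of its
frame. -/
theorem wp_conseq {L : ℕ} {c : Cmd} {P Q : Store → Prop} {s : Store} (h : wp L c P s)
    (hQ : ∀ s', Frame c s s' → P s' → Q s') : wp L c Q s := by
  induction c generalizing P Q s with
  | skip => exact hQ _ (.refl _ _) h
  | const => exact hQ _ (.setReg (by simp [writesReg])) h
  | copy => exact hQ _ (.setReg (by simp [writesReg])) h
  | succ => exact hQ _ (.setReg (by simp [writesReg])) h
  | load => exact hQ _ (.setReg (by simp [writesReg])) h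
  | store => exact hQ _ (.setNum (by simp [writesNum])) h
  | push => exact hQ _ (.setLst (by simp [writesLst])) h
  | clear => exact hQ _ (.setLst (by simp [writesLst])) h
  | pop x a i =>
    exact ⟨fun hl => hQ _ (.refl _ _) (h.1 hl), fun n l hl => hQ _
      ((Frame.setLst (by simp [writesLst])).trans (.setReg (by simp [writesReg]))) (h.2 n l hl)⟩
  | seq c d hc hd =>
    refine hc h fun s₁ f₁ h₁ => hd h₁ fun s₂ f₂ h₂ => hQ s₂ ?_ h₂
    refine (f₁.mono ?_ ?_ ?_).trans (f₂.mono ?_ ?_ ?_) <;>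
      simp +contextual [writesReg, writesNum, writesLst]
  | ifEq x y c d hc hd =>
    refine ⟨fun hl => hc (h.1 hl) fun s₁ f₁ => hQ s₁ ?_,
      fun hl => hd (h.2 hl) fun s₁ f₁ => hQ s₁ ?_⟩ <;>
    refine f₁.mono ?_ ?_ ?_ <;> simp +contextual [writesReg, writesNum, writesLst]
  | ifNil a i c d hc hd =>
    refine ⟨fun hl => hc (h.1 hl) fun s₁ f₁ => hQ s₁ ?_,
      fun hl => hd (h.2 hl) fun s₁ f₁ => hQ s₁ ?_⟩ <;>
    refine f₁.mono ?_ ?_ ?_ <;> simp +contextual [writesReg, writesNum, writesLst]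
  | iter x l c hc =>
    exact foldr_conseq (fun _ _ _ => hc) (by simp [writesReg]) (fun _ _ f => f.mono
      (by simp +contextual [writesReg]) (by simp [writesNum]) (by simp [writesLst])) l s h hQ
  | forEach x a i c hc =>
    exact ⟨h.1, foldr_conseq (fun _ _ _ => hc) (by simp [writesReg]) (fun _ _ f => f.mono
      (by simp +contextual [writesReg]) (by simp [writesNum]) (by simp [writesLst])) _ s h.2 hQ⟩
  | whileNe x c hc =>
    simp only [wp] at h ⊢
    generalize hM : L = M
    rw [hM] at hc
    suffices ∀ k s, (∀ s', Frame (whileNe x c) s s' → P s' → Q s') →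
        ((fun (K : Store → Prop) s => (s.reg x = 0 → P s) ∧ (s.reg x ≠ 0 → wp M c K s))^[k]
          fun s => s.reg x = 0 ∧ P s) s →
        ((fun (K : Store → Prop) s => (s.reg x = 0 → Q s) ∧ (s.reg x ≠ 0 → wp M c K s))^[k]
          fun s => s.reg x = 0 ∧ Q s) s from this M s hQ (hM ▸ h)
    intro k
    induction k with
    | zero => exact fun s hQ h => ⟨h.1, hQ s (.refl _ _) h.2⟩
    | succ k ih =>
      intro s hQ h
      rw [Function.iterate_succ_apply'] at h ⊢
      exact ⟨fun hx => hQ s (.refl _ _) (h.1 hx), fun hx => hc (h.2 hx) fun s₁ f₁ h₁ =>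
        ih s₁ (fun s₂ f₂ => hQ s₂ ((Frame.mono (d := whileNe x c) f₁ (fun _ h => h) (fun _ h => h)
          fun _ h => h).trans
            f₂)) h₁⟩

theorem wp_mono {L : ℕ} {c : Cmd} {P Q : Store → Prop} {s : Store} (h : wp L c P s)
    (hQ : ∀ s', P s' → Q s') : wp L c Q s :=
  wp_conseq h fun s' _ => hQ s'

/-- The rule for loops over a list; the invariant `I` depends on the entries that are left. -/
theorem wp_forEach {L x a i : ℕ} {c : Cmd} {Q : Store → Prop} {s : Store} (l : List ℕ)
    (I : List ℕ → Store → Prop) (hl : s.lst a (s.reg i) = l) (hL : l.length ≤ L) (h₀ : I l s)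
    (step : ∀ n l' s', Frame (forEach x a i c) s s' → n :: l' <:+ l → I (n :: l') s' →
      wp L c (I l') (s'.setReg x n))
    (hQ : ∀ s', Frame (forEach x a i c) s s' → I [] s' → Q s') : wp L (forEach x a i c) Q s := by
  refine ⟨hl ▸ hL, ?_⟩
  rw [hl]
  suffices ∀ l' s', l' <:+ l → Frame (forEach x a i c) s s' → I l' s' →
      l'.foldr (fun n K s => wp L c K (s.setReg x n)) Q s' from
    this l s List.suffix_rfl (.refl _ _) h₀
  intro l'
  induction l' with
  | nil => exact fun s' _ f h => hQ s' f h
  | cons n l' ih =>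
    intro s' hs f h
    refine wp_conseq (step n l' s' f hs h) fun s₁ f₁ => ih s₁ ((List.suffix_cons n l').trans hs) ?_
    refine (f.trans (.setReg (by simp [writesReg]))).trans (f₁.mono ?_ ?_ ?_) <;>
      simp +contextual [writesReg, writesNum, writesLst]

/-- The rule for `while` loops; `m` bounds the number of rounds that are left. -/
theorem wp_whileNe {L x : ℕ} {c : Cmd} {Q : Store → Prop} {s : Store}
    (I : ℕ → Store → Prop) (h₀ : I L s) (hpos : ∀ s', I 0 s' → s'.reg x = 0)
    (step : ∀ m s', Frame (whileNe x c) s s' → s'.reg x ≠ 0 → I (m + 1) s' → wp L c (I m) s')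
    (hQ : ∀ m s', Frame (whileNe x c) s s' → s'.reg x = 0 → I m s' → Q s') :
    wp L (whileNe x c) Q s := by
  simp only [wp]
  generalize hM : L = M
  rw [hM] at step h₀
  suffices ∀ k s', Frame (whileNe x c) s s' → I k s' →
      ((fun (K : Store → Prop) s => (s.reg x = 0 → Q s) ∧ (s.reg x ≠ 0 → wp M c K s))^[k]
        fun s => s.reg x = 0 ∧ Q s) s' from this M s (.refl _ _) h₀
  intro k
  induction k with
  | zero => exact fun s' f h => ⟨hpos s' h, hQ 0 s' f (hpos s' h) h⟩
  | succ k ih =>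
    intro s' f h
    rw [Function.iterate_succ_apply']
    exact ⟨fun hx => hQ _ s' f hx h, fun hx => wp_conseq (step k s' f hx h) fun s₁ f₁ =>
      ih s₁ (f.trans (f₁.mono (fun _ h => h) (fun _ h => h) fun _ h => h))⟩

section Equations

variable {L x y a i n : ℕ} {c d : Cmd} {cs : List Cmd} {Q : Store → Prop} {s : Store}

@[simp] theorem wp_skip : wp L skip Q s ↔ Q s := Iff.rfl
@[simp] theorem wp_const : wp L (const x n) Q s ↔ Q (s.setReg x n) := Iff.rfl
@[simp] theorem wp_copy : wp L (copy x y) Q s ↔ Q (s.setReg x (s.reg y)) := Iff.rfl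
@[simp] theorem wp_succ : wp L (succ x) Q s ↔ Q (s.setReg x (s.reg x + 1)) := Iff.rfl
@[simp] theorem wp_load : wp L (load x a i) Q s ↔ Q (s.setReg x (s.num a (s.reg i))) := Iff.rfl
@[simp] theorem wp_store : wp L (store a i x) Q s ↔ Q (s.setNum a (s.reg i) (s.reg x)) := Iff.rfl
@[simp] theorem wp_push : wp L (push a i x) Q s ↔
    Q (s.setLst a (s.reg i) (s.reg x :: s.lst a (s.reg i))) := Iff.rfl
@[simp] theorem wp_pop : wp L (pop x a i) Q s ↔ (s.lst a (s.reg i) = [] → Q s) ∧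
    ∀ n l, s.lst a (s.reg i) = n :: l → Q ((s.setLst a (s.reg i) l).setReg x n) := Iff.rfl
@[simp] theorem wp_clear : wp L (clear a i) Q s ↔ Q (s.setLst a (s.reg i) []) := Iff.rfl
@[simp] theorem wp_seq : wp L (seq c d) Q s ↔ wp L c (wp L d Q) s := Iff.rfl
@[simp] theorem wp_ifEq : wp L (ifEq x y c d) Q s ↔
    (s.reg x = s.reg y → wp L c Q s) ∧ (s.reg x ≠ s.reg y → wp L d Q s) := Iff.rfl
@[simp] theorem wp_ifNil : wp L (ifNil a i c d) Q s ↔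
    (s.lst a (s.reg i) = [] → wp L c Q s) ∧ (s.lst a (s.reg i) ≠ [] → wp L d Q s) := Iff.rfl
@[simp] theorem wp_block_singleton : wp L (block [c]) Q s ↔ wp L c Q s := Iff.rfl
@[simp] theorem wp_block_cons : wp L (block (c :: d :: cs)) Q s ↔
    wp L c (wp L (block (d :: cs)) Q) s :=
  Iff.rfl

end Equations

attribute [irreducible] wp

end Cmd

/-! ### Reading a store after an update. -/

namespace Store

variable (s : Store) (x y a b i j n : ℕ) (l : List ℕ)

@[simp] theorem reg_setReg : (s.setReg x n).reg y = if y = x then n else s.reg y := by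
  simp [setReg, Function.update_apply]
@[simp] theorem num_setReg : (s.setReg x n).num = s.num := rfl
@[simp] theorem lst_setReg : (s.setReg x n).lst = s.lst := rfl
@[simp] theorem reg_setNum : (s.setNum a i n).reg = s.reg := rfl
@[simp] theorem num_setNum : (s.setNum a i n).num b = if b = a then Function.update (s.num a) i n
    else s.num b := by
  simp [setNum, Function.update_apply]
@[simp] theorem lst_setNum : (s.setNum a i n).lst = s.lst := rfl
@[simp] theorem reg_setLst : (s.setLst a i l).reg = s.reg := rfl
@[simp] theorem num_setLst : (s.setLst a i l).num = s.num := rfl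
@[simp] theorem lst_setLst : (s.setLst a i l).lst b = if b = a then Function.update (s.lst a) i l
    else s.lst b := by
  simp [setLst, Function.update_apply]

end Store

namespace MaxDef

open Cmd

/-! ### Membership, insertion and deletion in a stored list. -/

section Basic

variable {L r e a i : ℕ} {Q : Store → Prop} {s : Store}

/-- The final state is described exactly, up to the irrelevant value `k` left in `tmp`, so that
later proofs can compute with it by `simp`. -/
theorem wp_mem (hr : r ≠ tmp) (he : e ≠ tmp) (her : e ≠ r) (hir : i ≠ r)
    (hL : (s.lst a (s.reg i)).length ≤ L)
    (hQ : ∀ k, Q ((s.setReg tmp k).setReg r (if s.reg e ∈ s.lst a (s.reg i) then 1 else 0))) :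
    wp L (mem r e a i) Q s := by
  simp only [mem, wp_block_cons, wp_block_singleton, wp_const]
  -- Either `e` has been met and the flag stays 1, or the flag is 0 and membership in the whole list
  -- amounts to membership in the entries `l` that are left.
  refine wp_forEach (s.lst a (s.reg i)) (fun l s' => s'.num = s.num ∧ s'.lst = s.lst ∧
    (∀ q, q ≠ tmp → q ≠ r → s'.reg q = s.reg q) ∧
    ((s'.reg r = 1 ∧ s.reg e ∈ s.lst a (s.reg i)) ∨
      (s'.reg r = 0 ∧ (s.reg e ∈ s.lst a (s.reg i) ↔ s.reg e ∈ l)))) ?_ hL ?_ ?_ ?_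
  · simp [hir]
  · refine ⟨rfl, rfl, fun q _ h => by simp [h], Or.inr (by simp)⟩
  · rintro n l s' - hsuf ⟨h₁, h₂, h₃, h₄⟩
    have hn : n ∈ s.lst a (s.reg i) := hsuf.subset (by simp)
    have := h₃ e he her
    simp only [wp_ifEq, wp_const, wp_skip, Store.reg_setReg, Store.num_setReg, Store.lst_setReg,
      if_true, he, if_false, hr, this]
    refine ⟨fun h => ⟨h₁, h₂, fun q hq hq' => by simp [hq, hq', h₃], Or.inl ⟨trivial, h ▸ hn⟩⟩,
      fun h => ⟨h₁, h₂, fun q hq hq' => by simp [hq, hq', h₃], ?_⟩⟩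
    simpa [Ne.symm h] using h₄
  · rintro s' - ⟨h₁, h₂, h₃, h₄⟩
    convert hQ (s'.reg tmp)
    cases s'
    cases s
    simp only [Store.setReg] at *
    subst h₁ h₂
    congr 1
    funext q
    by_cases hq : q = r
    · subst hq
      rcases h₄ with h₄ | h₄ <;> simp [h₄]
    · by_cases hq' : q = tmp
      · subst hq'; simp [hq]
      · simp [hq, hq', h₃]

theorem wp_add (he : e ≠ tmp) (heh : e ≠ hit) (hit' : i ≠ tmp) (hih : i ≠ hit)
    (hz : s.reg zero = 0) (hL : (s.lst a (s.reg i)).length ≤ L)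
    (hQ : ∀ k h, Q (((s.setReg tmp k).setReg hit h).setLst a (s.reg i)
      ((s.lst a (s.reg i)).insert (s.reg e)))) :
    wp L (add e a i) Q s := by
  simp only [add, wp_block_cons]
  refine wp_mem (by decide) he heh hih hL fun k => ?_
  have h := hQ k
  by_cases hm : s.reg e ∈ s.lst a (s.reg i)
  · have h := h 1
    rw [List.insert_of_mem hm] at h
    simp only [wp_block_singleton, wp_ifEq, wp_push, wp_skip]
    simp only [hm, if_true]
    constructor
    · intro h0
      simp [hz] at h0
    · intro _
      convert h using 1
      simp [Store.setLst, Store.setReg]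
  · have h := h 0
    rw [List.insert_of_not_mem hm] at h
    simp only [wp_block_singleton, wp_ifEq, wp_push, wp_skip]
    simp only [hm, if_false]
    constructor
    · intro h0
      simpa [he, heh, hit', hih] using h
    · intro h0
      simp [hz] at h0

/-- Copying to the buffer reverses the list and copying back reverses it again, so the result is
literally a `List.filter`, in the old order. -/
theorem wp_delete (ha : a ≠ buf) (he : e ≠ tmp) (hi : i ≠ tmp) (hz : s.reg zero = 0)
    (hL : (s.lst a (s.reg i)).length ≤ L)
    (hQ : ∀ k l, Q (((s.setReg tmp k).setLst buf 0 l).setLst a (s.reg i)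
      ((s.lst a (s.reg i)).filter (· ≠ s.reg e)))) :
    wp L (delete e a i) Q s := by
  simp only [delete, wp_block_cons, wp_clear]
  refine wp_forEach (s.lst a (s.reg i)) (fun l s' => ∃ l', (l'.reverse ++ l).filter (· ≠ s.reg e) =
      (s.lst a (s.reg i)).filter (· ≠ s.reg e) ∧ (∀ x ∈ l', x ≠ s.reg e) ∧
      l'.length + l.length ≤ (s.lst a (s.reg i)).length ∧
      s' = ((s.setLst buf 0 l').setReg tmp (s'.reg tmp))) ?_ hL ?_ ?_ ?_
  · simp [ha]
  · exact ⟨[], by simp, by simp, by simp, by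
      rw [hz]
      simp [Store.setLst, Store.setReg]⟩
  · rintro n l s' - - ⟨l', h₁, h₂, h₃, h₄⟩
    rw [h₄]
    simp only [wp_ifEq, wp_push, wp_skip]
    constructor
    · intro h
      refine ⟨l', ?_, h₂, ?_, ?_⟩
      · rw [← h₁]
        have : n = s.reg e := by simpa [he] using h
        simp [this]
      · simp only [List.length_cons] at h₃
        omega
      · simp [Store.setLst, Store.setReg]
    · intro h
      have hn : n ≠ s.reg e := by simpa [he] using h
      refine ⟨n :: l', ?_, ?_, ?_, ?_⟩
      · rw [← h₁]
        simp
      · simpa [hn] using h₂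
      · simp only [List.length_cons] at h₃ ⊢
        omega
      · simp [Store.setLst, Store.setReg, hz]
  · rintro s' - ⟨l', h₁, h₂, h₃, h₄⟩
    have h₅ : l'.reverse = (s.lst a (s.reg i)).filter (· ≠ s.reg e) := by
      rw [← h₁, List.append_nil, List.filter_eq_self.2]
      simpa using h₂
    rw [h₄]
    clear h₄
    generalize s'.reg tmp = k
    simp only [wp_block_cons, wp_block_singleton, wp_clear]
    -- The buffer is read with the last kept entry first, and entries are pushed to the front. So at
    -- any time a final segment of the filtered list is restored, and the first `l.length` entries
    -- are missing.
    refine wp_forEach l' (fun l s' => s' = ((s.setReg tmp (s'.reg tmp)).setLst buf 0 l').setLst a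
      (s.reg i) (((s.lst a (s.reg i)).filter (· ≠ s.reg e)).drop l.length)) ?_ ?_ ?_ ?_ ?_
    · simp [hz, Ne.symm ha]
    · simp only [List.length_nil] at h₃
      omega
    · rw [← h₅, ← List.length_reverse, List.drop_length]
      simp [Store.setLst, Store.setReg, hi]
    · rintro n l s'' - hsuf h
      rw [h, wp_push]
      obtain ⟨p, hp⟩ := hsuf
      have : l'.reverse = l.reverse ++ n :: p.reverse := by rw [← hp]; simp
      have hd : (l.reverse ++ n :: p.reverse).drop (l.length + 1) = p.reverse := by
        rw [List.drop_append]
        simp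
      rw [← h₅, this]
      simp [Store.setLst, Store.setReg, hi, hd]
    · rintro s'' - h
      rw [h]
      simpa using hQ _ _

end Basic


/-! ### Searching the current graph. -/

/-- The source of nearly all bounds on rounds: vertex lists of the current graph have no repetitions
and contain names below `N`. -/
theorem length_le_of_nodup_of_lt {l : List ℕ} {N : ℕ} (h : l.Nodup) (h' : ∀ v ∈ l, v < N) :
    l.length ≤ N := by
  simpa using (h.subperm (l₂ := List.range N) fun v hv => by simpa using h' v hv).length_le

/-- Correctness of `find`: `cond` either fails, which implies `N v`, or holds and produces a witness
`R v z`. -/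
theorem wp_find {L : ℕ} {s : Store} {cond : Cmd} (N : ℕ → Prop) (R : ℕ → ℕ → Prop)
    (hz : s.reg zero = 0) (hL : (s.lst live 0).length ≤ L)
    (h₀ : cond.writesReg zero = false) (h₁ : cond.writesReg found = false)
    (h₃ : cond.writesReg v = false)
    (hl : ∀ a, cond.writesLst a = false) (hn : ∀ a, cond.writesNum a = false)
    (hc : ∀ e ∈ s.lst live 0, ∀ s' : Store, s'.lst = s.lst → s'.num = s.num → s'.reg zero = 0 →
      s'.reg v = e →
      wp L cond (fun s'' => (s''.reg flag = 0 ∧ N e) ∨ (s''.reg flag ≠ 0 ∧ R e (s''.reg z))) s') :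
    wp L (find cond) (fun s' => (s'.reg found = 0 ∧ ∀ e ∈ s.lst live 0, N e) ∨
      (s'.reg found ≠ 0 ∧ s'.reg x ∈ s.lst live 0 ∧ R (s'.reg x) (s'.reg z))) s := by
  simp only [find, wp_block_cons, wp_block_singleton, wp_const]
  refine wp_forEach (s.lst live 0) (fun l s' => s'.reg zero = 0 ∧
    ((s'.reg found = 0 ∧ ∀ e ∈ s.lst live 0, e ∉ l → N e) ∨
      (s'.reg found ≠ 0 ∧ s'.reg x ∈ s.lst live 0 ∧ R (s'.reg x) (s'.reg z)))) ?_ hL ?_ ?_ ?_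
  · simp [hz]
  · simp +contextual [hz]
  · rintro n l s' f hsuf ⟨hz', h⟩
    have hn' : n ∈ s.lst live 0 := hsuf.subset (by simp)
    have fl : s'.lst = s.lst := by
      funext a
      refine f.lst a ?_
      simp [block, writesLst, hl]
    have fn : s'.num = s.num := by
      funext a
      refine f.num a ?_
      simp [block, writesNum, hn]
    simp only [wp_ifEq, wp_block_cons, wp_skip]
    refine ⟨fun hf => ?_, fun hf => ?_⟩
    · have hf' : s'.reg found = 0 := by simpa [hz'] using hf
      have h := (h.resolve_right (by simp [hf'])).2
      refine wp_conseq (hc n hn' _ (by simp [fl]) (by simp [fn]) (by simp [hz']) (by simp)) ?_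
      intro s₁ f₁ hs₁
      have e₀ : s₁.reg zero = 0 := by simp [f₁.reg zero h₀, hz']
      have e₁ : s₁.reg found = 0 := by simp [f₁.reg found h₁, hf']
      have e₃ : s₁.reg v = n := by simp [f₁.reg v h₃]
      simp only [wp_block_singleton, wp_ifEq, wp_block_cons, wp_skip, wp_const, wp_copy]
      rw [e₀]
      refine ⟨fun hfl => ⟨rfl, Or.inl ⟨e₁, fun e he hel => ?_⟩⟩, fun hfl => ?_⟩
      · by_cases hen : e = n
        · subst hen
          exact (hs₁.resolve_right (by simp [hfl])).2
        · exact h e he (by simp [hen, hel])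
      · refine ⟨by simp [e₀], Or.inr ?_⟩
        have := (hs₁.resolve_left (by simp [hfl])).2
        simp [e₃, hn', this]
    · have hf' : s'.reg found ≠ 0 := by simpa [hz'] using hf
      have h := h.resolve_left (by simp [hf'])
      refine ⟨by simp [hz'], Or.inr ?_⟩
      simpa using h
  · rintro s' - ⟨-, h⟩
    simpa using h

/-- `N` is what `next` may assume about all live vertices, and `R` what `act` may assume about the
vertex found and the witness in `z`. Termination needs a proper `N` only in Step 9 and a proper `R`
only in Step 8. -/
theorem wp_lookFor {L : ℕ} {s : Store} {cond act next : Cmd} {Q : Store → Prop} (N : ℕ → Prop)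
    (R : ℕ → ℕ → Prop) (hz : s.reg zero = 0) (hL : (s.lst live 0).length ≤ L)
    (h₀ : cond.writesReg zero = false) (h₁ : cond.writesReg found = false)
    (h₃ : cond.writesReg v = false)
    (hl : ∀ a, cond.writesLst a = false) (hn : ∀ a, cond.writesNum a = false)
    (hc : ∀ e ∈ s.lst live 0, ∀ s' : Store, s'.lst = s.lst → s'.num = s.num → s'.reg zero = 0 →
      s'.reg v = e →
      wp L cond (fun s'' => (s''.reg flag = 0 ∧ N e) ∨ (s''.reg flag ≠ 0 ∧ R e (s''.reg z))) s')
    (hnext : (∀ e ∈ s.lst live 0, N e) → ∀ s' : Store, s'.lst = s.lst → s'.num = s.num →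
      s'.reg zero = 0 → wp L next Q s')
    (hact : ∀ s' : Store, s'.lst = s.lst → s'.num = s.num → s'.reg zero = 0 →
      s'.reg x ∈ s.lst live 0 → R (s'.reg x) (s'.reg z) → wp L act Q s') :
    wp L (lookFor cond act next) Q s := by
  simp only [lookFor, wp_block_cons]
  refine wp_conseq (wp_find N R hz hL h₀ h₁ h₃ hl hn hc) fun s' f h => ?_
  have fl : s'.lst = s.lst := by
    funext a
    refine f.lst a ?_
    simp [find, block, writesLst, hl]
  have fn : s'.num = s.num := by
    funext a
    refine f.num a ?_
    simp [find, block, writesNum, hn]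
  have fz : s'.reg zero = 0 := by
    rw [f.reg zero, hz]
    simp [find, block, writesReg, h₀]
  simp only [wp_block_singleton, wp_ifEq, fz]
  exact ⟨fun h' => hnext (h.resolve_right (by simp [h'])).2 s' fl fn fz, fun h' =>
    have := (h.resolve_left (by simp [h'])).2
    hact s' fl fn fz this.1 this.2⟩

/-! ### The loop invariant and the operations that preserve it. -/

/-- The part of the invariant of MaxDef that does not speak about partners. -/
structure WellFormed (N n : ℕ) (s : Store) : Prop where
  zero : s.reg zero = 0
  live_nodup : (s.lst live 0).Nodup
  live_lt : ∀ v ∈ s.lst live 0, v < N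
  neg_nodup : ∀ v ∈ s.lst live 0, (s.lst negG v).Nodup
  neg_live : ∀ v ∈ s.lst live 0, ∀ e ∈ s.lst negG v, e ∈ s.lst live 0
  recov_sum : ∑ i ∈ Finset.range N, (s.lst recov i).length ≤ n
  setB_nodup : (s.lst setB 0).Nodup
  setB_lt : ∀ v ∈ s.lst setB 0, v < N
  setS_card : (s.lst setS 0).length + (s.lst live 0).length ≤ N
  setS_lt : ∀ v ∈ s.lst setS 0, v < N

namespace WellFormed

variable {N n : ℕ} {s s' : Store}

theorem congr (h : WellFormed N n s) (hz : s'.reg MaxDef.zero = 0) (h₁ : s'.lst live = s.lst live)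
    (h₂ : s'.lst negG = s.lst negG) (h₃ : s'.lst recov = s.lst recov)
    (h₄ : s'.lst setB = s.lst setB) (h₅ : s'.lst setS = s.lst setS) : WellFormed N n s' :=
  ⟨hz, h₁ ▸ h.live_nodup, h₁ ▸ h.live_lt, h₁ ▸ h₂ ▸ h.neg_nodup, h₁ ▸ h₂ ▸ h.neg_live,
    h₃ ▸ h.recov_sum, h₄ ▸ h.setB_nodup, h₄ ▸ h.setB_lt, h₁ ▸ h₅ ▸ h.setS_card, h₅ ▸ h.setS_lt⟩

theorem live_length (h : WellFormed N n s) : (s.lst live 0).length ≤ N :=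
  length_le_of_nodup_of_lt h.live_nodup h.live_lt

theorem setB_length (h : WellFormed N n s) : (s.lst setB 0).length ≤ N :=
  length_le_of_nodup_of_lt h.setB_nodup h.setB_lt

theorem neg_length (h : WellFormed N n s) {v : ℕ} (hv : v ∈ s.lst live 0) :
    (s.lst negG v).length ≤ N :=
  length_le_of_nodup_of_lt (h.neg_nodup v hv) fun e he => h.live_lt e (h.neg_live v hv e he)

theorem recov_length (h : WellFormed N n s) {v : ℕ} (hv : v < N) : (s.lst recov v).length ≤ n :=
  (Finset.single_le_sum (f := fun i => (s.lst recov i).length) (fun _ _ => Nat.zero_le _)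
    (Finset.mem_range.2 hv)).trans h.recov_sum

end WellFormed

/-- The live vertices are matched in pairs, and partners are not joined by negative edges. -/
structure Matched (s : Store) : Prop where
  mem : ∀ v ∈ s.lst live 0, s.num bar v ∈ s.lst live 0
  ne : ∀ v ∈ s.lst live 0, s.num bar v ≠ v
  bar_bar : ∀ v ∈ s.lst live 0, s.num bar (s.num bar v) = v

/-- Partners are not joined by negative edges. -/
def NoMatchedEdge (s : Store) : Prop :=
  ∀ v ∈ s.lst live 0, s.num bar v ∉ s.lst negG v

/-- The invariant of the main loop of MaxDef. -/
structure Invariant (N n : ℕ) (s : Store) : Prop extends WellFormed N n s, Matched s where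
  noMatchedEdge : NoMatchedEdge s

theorem Matched.congr {s s' : Store} (h : Matched s) (h₁ : s'.lst live 0 = s.lst live 0)
    (h₂ : s'.num bar = s.num bar) : Matched s' :=
  ⟨h₁ ▸ h₂ ▸ h.mem, h₁ ▸ h₂ ▸ h.ne, h₁ ▸ h₂ ▸ h.bar_bar⟩

theorem Invariant.congr {N n : ℕ} {s s' : Store} (h : Invariant N n s) (hl : s'.lst = s.lst)
    (hn : s'.num = s.num) (hz : s'.reg MaxDef.zero = 0) : Invariant N n s' :=
  { toWellFormed := h.toWellFormed.congr hz (by rw [hl]) (by rw [hl]) (by rw [hl]) (by rw [hl])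
      (by rw [hl])
    toMatched := h.toMatched.congr (by rw [hl]) (by rw [hn])
    noMatchedEdge := by
      have := h.noMatchedEdge
      unfold NoMatchedEdge at this ⊢
      rwa [hl, hn] }

/-- After choosing `y` with partner `yb`. -/
theorem wp_choose {L N n : ℕ} {s : Store} (h : Invariant N n s) (hN : N ≤ L)
    (hy : s.reg y ∈ s.lst live 0) (hyb : s.reg yb = s.num bar (s.reg y)) :
    wp L choose (fun s' => Invariant N n s' ∧
      (s'.lst live 0).length < (s.lst live 0).length) s := by
  have hz := h.zero
  have hne : s.reg y ≠ s.reg yb := hyb ▸ (h.ne _ hy).symm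
  simp only [choose, wp_block_cons, wp_push]
  refine wp_forEach (s.lst negG (s.reg y)) (fun l s' => (s'.lst setB 0).Nodup ∧
    ∀ v ∈ s'.lst setB 0, v < N) (by simp) ((h.neg_length hy).trans hN) ?_ ?_ ?_
  · simpa using ⟨h.setB_nodup, h.setB_lt⟩
  · rintro e l s' f hsuf ⟨h₁, h₂⟩
    have he : e < N := h.live_lt _ (h.neg_live _ hy _ (hsuf.subset (by simp)))
    have hz' : s'.reg zero = 0 := by simpa [hz] using f.reg zero rfl
    refine wp_add (by decide) (by decide) (by decide) (by decide) (by simpa using hz') ?_ ?_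
    · simpa [hz'] using (length_le_of_nodup_of_lt h₁ h₂).trans hN
    · intro k j
      simp only [Store.lst_setLst, Store.lst_setReg, Store.reg_setReg, if_true]
      simp only [hz', show (zero = u) = False by simp, if_false, Function.update_self]
      refine ⟨h₁.insert, fun v hv => ?_⟩
      rcases List.mem_insert_iff.1 hv with rfl | hv
      · exact he
      · exact h₂ v hv
  rintro s₁ f₁ ⟨hB₁, hB₂⟩
  have z₁ : s₁.reg zero = 0 := by simpa [hz] using f₁.reg zero rfl
  have y₁ : s₁.reg y = s.reg y := by simpa using f₁.reg y rfl
  have yb₁ : s₁.reg yb = s.reg yb := by simpa using f₁.reg yb rfl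
  have n₁ : s₁.num = s.num := funext fun a => f₁.num a rfl
  have l₁ : s₁.lst live = s.lst live := by simpa using f₁.lst live rfl
  have g₁ : s₁.lst negG = s.lst negG := by simpa using f₁.lst negG rfl
  have r₁ : s₁.lst recov = s.lst recov := by simpa using f₁.lst recov rfl
  have S₁ : s₁.lst setS 0 = s.reg y :: s.lst setS 0 := by
    simpa [hz] using congrFun (f₁.lst setS rfl) 0
  clear f₁
  rw [wp_block_cons]
  refine wp_forEach (s.lst live 0) (fun l s' => ∀ u ∈ s.lst live 0, (s'.lst negG u).Nodup ∧
    ∀ e ∈ s'.lst negG u, e ∈ s.lst negG u ∧ (u ∉ l → e ≠ s.reg y ∧ e ≠ s.reg yb)) ?_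
    (h.live_length.trans hN) ?_ ?_ ?_
  · rw [z₁, l₁]
  · intro u hu
    rw [g₁]
    exact ⟨h.neg_nodup u hu, fun e he => ⟨he, fun h => absurd hu h⟩⟩
  · intro w l s' f hsuf h'
    have hw : w ∈ s.lst live 0 := hsuf.subset (by simp)
    have hz' : s'.reg zero = 0 := (f.reg zero rfl).trans z₁
    have hy' : s'.reg y = s.reg y := (f.reg y rfl).trans y₁
    have hyb' : s'.reg yb = s.reg yb := (f.reg yb rfl).trans yb₁
    have hlen : (s'.lst negG w).length ≤ L :=
      (length_le_of_nodup_of_lt (h' w hw).1 fun e he =>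
        h.live_lt e (h.neg_live w hw e ((h' w hw).2 e he).1)).trans hN
    simp only [wp_block_cons]
    refine wp_delete (by decide) (by decide) (by decide) (by simp [hz']) (by simpa) ?_
    intro k j
    refine wp_delete (by decide) (by decide) (by decide) (by simp [hz'])
      (by simpa using (List.length_filter_le _ _).trans hlen) ?_
    intro k' j'
    simp only [Store.lst_setLst, Store.lst_setReg, Store.reg_setReg, Store.reg_setLst]
    intro v hv
    by_cases hvw : v = w
    · subst hvw
      simp [hy', hyb']
      exact ⟨(h' v hv).1.filter _, fun e he h₁ h₂ => ⟨((h' v hv).2 e he).1,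
        fun _ => ⟨h₂, h₁⟩⟩⟩
    · simp [hvw]
      refine ⟨(h' v hv).1, fun e he => ⟨((h' v hv).2 e he).1, fun hvl => ?_⟩⟩
      exact ((h' v hv).2 e he).2 (by simp [hvw, hvl])
  intro s₂ f₂ h₂
  have z₂ : s₂.reg zero = 0 := (f₂.reg zero rfl).trans z₁
  have y₂ : s₂.reg y = s.reg y := (f₂.reg y rfl).trans y₁
  have yb₂ : s₂.reg yb = s.reg yb := (f₂.reg yb rfl).trans yb₁
  have n₂ : s₂.num = s.num := (funext fun a => f₂.num a rfl).trans n₁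
  have l₂ : s₂.lst live = s.lst live := (f₂.lst live rfl).trans l₁
  have r₂ : s₂.lst recov = s.lst recov := (f₂.lst recov rfl).trans r₁
  have S₂ : s₂.lst setS 0 = s.reg y :: s.lst setS 0 := by rw [f₂.lst setS rfl, S₁]
  have B₂ : s₂.lst setB = s₁.lst setB := f₂.lst setB rfl
  rw [← B₂] at hB₁ hB₂
  clear f₂
  simp only [wp_block_cons, wp_clear]
  refine wp_delete (by decide) (by decide) (by decide) (by simp [z₂])
      (by simpa [z₂, l₂] using h.live_length.trans hN) fun k j => ?_
  simp only [wp_block_singleton]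
  refine wp_delete (by decide) (by decide) (by decide) (by simp [z₂])
      (by simpa [z₂, l₂] using (List.length_filter_le _ _).trans (h.live_length.trans hN))
      fun k' j' => ?_
  have hlt : (((s.lst live 0).filter (· ≠ s.reg y)).filter (· ≠ s.reg yb)).length <
      (s.lst live 0).length := by
    refine (List.length_filter_le _ _).trans_lt ?_
    exact List.length_filter_lt_length_iff_exists.2 ⟨_, hy, by simp⟩
  generalize hs : Store.setLst _ _ _ _ = s₃
  have l₃ : s₃.lst live 0 = ((s.lst live 0).filter (· ≠ s.reg y)).filter (· ≠ s.reg yb) := by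
    subst hs
    simp [z₂, y₂, yb₂, l₂]
  have z₃ : s₃.reg zero = 0 := by subst hs; simp [z₂]
  have n₃ : s₃.num = s.num := by subst hs; simp [n₂]
  have g₃ : ∀ v, v ≠ s.reg y → v ≠ s.reg yb → s₃.lst negG v = s₂.lst negG v := by
    intro v h₁ h₂
    subst hs
    simp [y₂, yb₂, h₁, h₂]
  have r₃ : s₃.lst recov = s.lst recov := by subst hs; simp [r₂]
  have B₃ : s₃.lst setB = s₂.lst setB := by subst hs; simp
  have S₃ : s₃.lst setS 0 = s.reg y :: s.lst setS 0 := by subst hs; simp [S₂]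
  clear hs
  have hlive : ∀ v, v ∈ s₃.lst live 0 ↔ v ∈ s.lst live 0 ∧ v ≠ s.reg y ∧ v ≠ s.reg yb := by
    intro v
    rw [l₃]
    simp [and_comm]
  rw [← l₃] at hlt
  refine ⟨⟨⟨z₃, ?_, ?_, ?_, ?_, ?_, ?_, ?_, ?_, ?_⟩, ⟨?_, ?_, ?_⟩, ?_⟩, hlt⟩
  · rw [l₃]
    exact (h.live_nodup.filter _).filter _
  · exact fun v hv => h.live_lt v ((hlive v).1 hv).1
  · intro v hv
    obtain ⟨hv, h₁, h₂'⟩ := (hlive v).1 hv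
    rw [g₃ v h₁ h₂']
    exact (h₂ v hv).1
  · intro v hv e he
    obtain ⟨hv, h₁, h₂'⟩ := (hlive v).1 hv
    rw [g₃ v h₁ h₂'] at he
    obtain ⟨h₃, h₄⟩ := (h₂ v hv).2 e he
    exact (hlive e).2 ⟨h.neg_live v hv e h₃, h₄ (by simp)⟩
  · rw [r₃]
    exact h.recov_sum
  · rwa [B₃]
  · rwa [B₃]
  · have := h.setS_card
    rw [S₃, List.length_cons]
    omega
  · rw [S₃]
    intro v hv
    rcases List.mem_cons.1 hv with rfl | hv
    · exact h.live_lt _ hy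
    · exact h.setS_lt v hv
  · intro v hv
    obtain ⟨hv, h₁, h₂'⟩ := (hlive v).1 hv
    rw [n₃, hlive]
    -- Since `bar` is an involution that exchanges the two deleted vertices, the partner of any
    -- other vertex is neither of them.
    refine ⟨h.mem v hv, fun h₃ => h₂' ?_, fun h₃ => h₁ ?_⟩
    · rw [hyb, ← h₃, h.bar_bar v hv]
    · rw [← h.bar_bar v hv, h₃, hyb, h.bar_bar _ hy]
  · intro v hv
    rw [n₃]
    exact h.ne v ((hlive v).1 hv).1
  · intro v hv
    rw [n₃]
    exact h.bar_bar v ((hlive v).1 hv).1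
  · intro v hv
    obtain ⟨hv, h₁, h₂'⟩ := (hlive v).1 hv
    rw [n₃, g₃ v h₁ h₂']
    exact fun h₃ => h.noMatchedEdge v hv ((h₂ v hv).2 _ h₃).1


/-- After identifying the vertex in register `d` to the one in register `k`. -/
theorem wp_identify {L N n k d : ℕ} {s : Store} (h : WellFormed N n s) (hN : N ≤ L) (hn : n ≤ L)
    (hk : k ∉ [zero, tmp, hit, w, u, flag]) (hd : d ∉ [zero, tmp, hit, w, u, flag])
    (hkl : s.reg k ∈ s.lst live 0) (hdl : s.reg d ∈ s.lst live 0) (hkd : s.reg k ≠ s.reg d) :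
    wp L (identify k d) (fun s' => WellFormed N n s' ∧
      s'.lst live 0 = (s.lst live 0).filter (· ≠ s.reg d) ∧
      ∀ v ∈ s'.lst live 0, v ≠ s.reg k → ∀ e ∈ s'.lst negG v, e ∈ s.lst negG v ∨ e = s.reg k) s := by
  simp only [List.mem_cons, List.not_mem_nil, or_false, not_or] at hk hd
  obtain ⟨hk₀, hk₁, hk₂, hk₃, hk₄, hk₅⟩ := hk
  obtain ⟨hd₀, hd₁, hd₂, hd₃, hd₄, hd₅⟩ := hd
  have hz := h.zero
  simp only [identify, wp_block_cons]
  -- the neighbours of `d` become neighbours of `k`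
  refine wp_forEach (s.lst negG (s.reg d)) (fun l s' => (s'.lst negG (s.reg k)).Nodup ∧
    (∀ e ∈ s'.lst negG (s.reg k), e ∈ s.lst live 0) ∧
    ∀ v, v ≠ s.reg k → s'.lst negG v = s.lst negG v) rfl ((h.neg_length hdl).trans hN) ?_ ?_ ?_
  · exact ⟨h.neg_nodup _ hkl, h.neg_live _ hkl, fun _ _ => rfl⟩
  · rintro e l s' f hsuf ⟨h₁, h₂, h₃⟩
    have he : e ∈ s.lst live 0 := h.neg_live _ hdl _ (hsuf.subset (by simp))
    have hz' : s'.reg zero = 0 := (f.reg zero rfl).trans hz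
    have hk' : s'.reg k = s.reg k := f.reg k (by simp [writesReg, block, add, mem, hk₁, hk₂, hk₃])
    refine wp_add (by decide) (by decide) hk₁ hk₂ (by simp [hz']) ?_ ?_
    · simpa [hk₃, hk'] using (length_le_of_nodup_of_lt h₁ fun v hv => h.live_lt v (h₂ v hv)).trans hN
    · intro a j
      simp only [Store.lst_setLst, Store.lst_setReg, Store.reg_setReg, if_true]
      simp only [hk₃, if_false, hk', Function.update_self]
      refine ⟨h₁.insert, fun v hv => ?_, fun v hv => ?_⟩
      · rcases List.mem_insert_iff.1 hv with rfl | hv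
        · exact he
        · exact h₂ v hv
      · simp [hv, h₃]
  rintro s₁ f₁ ⟨kn₁, kl₁, g₁⟩
  have z₁ : s₁.reg zero = 0 := (f₁.reg zero rfl).trans hz
  have k₁ : s₁.reg k = s.reg k := f₁.reg k (by simp [writesReg, block, add, mem, hk₁, hk₂, hk₃])
  have d₁ : s₁.reg d = s.reg d := f₁.reg d (by simp [writesReg, block, add, mem, hd₁, hd₂, hd₃])
  have l₁ : s₁.lst live = s.lst live := f₁.lst live rfl
  have r₁ : s₁.lst recov = s.lst recov := f₁.lst recov rfl
  have B₁ : s₁.lst setB = s.lst setB := f₁.lst setB rfl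
  have S₁ : s₁.lst setS = s.lst setS := f₁.lst setS rfl
  clear f₁
  simp only [wp_block_cons, wp_clear]
  -- the vertex `d` is deleted
  refine wp_delete (by decide) hd₁ (by decide) (by simp [z₁])
      (by simpa [z₁, l₁] using h.live_length.trans hN) fun a j => ?_
  generalize hs : Store.setLst _ _ _ _ = s₂
  have l₂ : s₂.lst live 0 = (s.lst live 0).filter (· ≠ s.reg d) := by
    subst hs
    simp [z₁, d₁, l₁]
  have z₂ : s₂.reg zero = 0 := by subst hs; simp [z₁]
  have k₂ : s₂.reg k = s.reg k := by subst hs; simp [hk₁, k₁]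
  have d₂ : s₂.reg d = s.reg d := by subst hs; simp [hd₁, d₁]
  have g₂ : ∀ v, v ≠ s.reg d → s₂.lst negG v = s₁.lst negG v := by
    intro v h₂
    subst hs
    simp [d₁, h₂]
  have r₂ : s₂.lst recov = s.lst recov := by subst hs; simp [r₁]
  have B₂ : s₂.lst setB = s.lst setB := by subst hs; simp [B₁]
  have S₂ : s₂.lst setS = s.lst setS := by subst hs; simp [S₁]
  clear hs
  have hlive : ∀ v, v ∈ s₂.lst live 0 ↔ v ∈ s.lst live 0 ∧ v ≠ s.reg d := by
    intro v
    rw [l₂]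
    simp
  have hnd : (s₂.lst live 0).Nodup := l₂ ▸ h.live_nodup.filter _
  have hll : (s₂.lst live 0).length < (s.lst live 0).length := by
    rw [l₂]
    exact List.length_filter_lt_length_iff_exists.2 ⟨_, hdl, by simp⟩
  have hk₂l : s.reg k ∈ s₂.lst live 0 := (hlive _).2 ⟨hkl, hkd⟩
  rw [wp_block_cons]
  -- the neighbours of `d` are joined to `k`
  refine wp_forEach (s₂.lst live 0) (fun l s' => ∀ v ∈ s₂.lst live 0, (s'.lst negG v).Nodup ∧
    ∀ e ∈ s'.lst negG v, e ∈ s.lst live 0 ∧ (v ∉ l → e ≠ s.reg d) ∧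
      (v ≠ s.reg k → e ∈ s.lst negG v ∨ e = s.reg k)) (by rw [z₂])
    (hll.le.trans (h.live_length.trans hN)) ?_ ?_ ?_
  · intro v hv
    obtain ⟨hv', hvd⟩ := (hlive v).1 hv
    rw [g₂ v hvd]
    by_cases hvk : v = s.reg k
    · rw [hvk]
      exact ⟨kn₁, fun e he => ⟨kl₁ e he, fun h => absurd (hvk ▸ hv) h, fun h => absurd rfl h⟩⟩
    · rw [g₁ v hvk]
      exact ⟨h.neg_nodup v hv', fun e he => ⟨h.neg_live v hv' e he, fun h => absurd hv h,
        fun _ => Or.inl he⟩⟩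
  · intro v l s' f hsuf h'
    have hv : v ∈ s₂.lst live 0 := hsuf.subset (by simp)
    have hz' : s'.reg zero = 0 := (f.reg zero rfl).trans z₂
    have hk' : s'.reg k = s.reg k := (f.reg k
      (by simp [writesReg, block, add, mem, delete, hk₁, hk₂, hk₄, hk₅])).trans k₂
    have hd' : s'.reg d = s.reg d := (f.reg d
      (by simp [writesReg, block, add, mem, delete, hd₁, hd₂, hd₄, hd₅])).trans d₂
    have hlen : (s'.lst negG v).length ≤ L :=
      (length_le_of_nodup_of_lt (h' v hv).1 fun e he => h.live_lt e ((h' v hv).2 e he).1).trans hN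
    rw [wp_block_cons]
    refine wp_mem (by decide) hd₁ hd₅ (by decide) (by simpa using hlen) fun a => ?_
    simp only [wp_block_singleton, wp_ifEq, wp_skip]
    simp only [Store.reg_setReg, Store.lst_setReg, hd₄, if_false, if_true, hd']
    constructor
    · intro h₀
      have hnm : s.reg d ∉ s'.lst negG v := by
        intro hm
        simp [hm, hz'] at h₀
      intro v' hv'
      refine ⟨(h' v' hv').1, fun e he => ?_⟩
      obtain ⟨h₁, h₂, h₃⟩ := (h' v' hv').2 e he
      refine ⟨h₁, fun hvl => ?_, h₃⟩
      by_cases hvv : v' = v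
      · subst hvv
        rintro rfl
        exact hnm he
      · exact h₂ (by simp [hvv, hvl])
    · intro _
      rw [wp_block_cons]
      refine wp_delete (by decide) hd₁ (by decide) (by simp [hz']) (by simpa using hlen)
        fun a₁ j₁ => ?_
      rw [wp_block_singleton]
      refine wp_add hk₁ hk₂ (by decide) (by decide) (by simp [hz'])
        (by simpa using (List.length_filter_le _ _).trans hlen) fun a₂ j₂ => ?_
      intro v' hv'
      by_cases hvv : v' = v
      · subst hvv
        obtain ⟨h₀, h₃⟩ := h' v' hv'
        simp only [Store.reg_setReg, Store.lst_setReg, Store.lst_setLst, Store.reg_setLst]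
        simp only [hk₁, hk₄, hk₅, hd₁, hd₄, hd₅, hk', hd', if_false]
        simp only [show (u = tmp) = False by simp,
          show (u = flag) = False by simp, if_false, if_true, Function.update_self]
        refine ⟨(h₀.filter _).insert, fun e he => ?_⟩
        rcases List.mem_insert_iff.1 he with rfl | he
        · exact ⟨hkl, fun _ => hkd, fun _ => Or.inr rfl⟩
        · simp only [List.mem_filter, decide_eq_true_eq] at he
          exact ⟨(h₃ e he.1).1, fun _ => he.2, (h₃ e he.1).2.2⟩
      · obtain ⟨h₀, h₃⟩ := h' v' hv'
        simp [hvv]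
        refine ⟨h₀, fun e he => ⟨(h₃ e he).1, fun hvl => (h₃ e he).2.1 (by simp [hvv, hvl]),
          (h₃ e he).2.2⟩⟩
  intro s₃ f₃ h₃
  have z₃ : s₃.reg zero = 0 := (f₃.reg zero rfl).trans z₂
  have k₃ : s₃.reg k = s.reg k := (f₃.reg k
    (by simp [writesReg, block, add, mem, delete, hk₁, hk₂, hk₄, hk₅])).trans k₂
  have d₃ : s₃.reg d = s.reg d := (f₃.reg d
    (by simp [writesReg, block, add, mem, delete, hd₁, hd₂, hd₄, hd₅])).trans d₂
  have l₃ : s₃.lst live = s₂.lst live := f₃.lst live rfl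
  have r₃ : s₃.lst recov = s.lst recov := (f₃.lst recov rfl).trans r₂
  have B₃ : s₃.lst setB = s.lst setB := (f₃.lst setB rfl).trans B₂
  have S₃ : s₃.lst setS = s.lst setS := (f₃.lst setS rfl).trans S₂
  clear f₃
  rw [wp_block_cons]
  -- the recovery information is moved
  refine wp_forEach (s.lst recov (s.reg d)) (fun l s' =>
      (s'.lst recov (s.reg k)).length + l.length =
        (s.lst recov (s.reg k)).length + (s.lst recov (s.reg d)).length ∧
      ∀ v, v ≠ s.reg k → s'.lst recov v = s.lst recov v) (by rw [d₃, r₃])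
    ((h.recov_length (h.live_lt _ hdl)).trans hn) ?_ ?_ ?_
  · rw [r₃]
    exact ⟨rfl, fun _ _ => rfl⟩
  · rintro e l s' f hsuf ⟨h₁, h₂⟩
    have hk' : s'.reg k = s.reg k := (f.reg k (by simp [writesReg, hk₃])).trans k₃
    rw [wp_push]
    simp only [Store.reg_setReg, Store.lst_setReg, Store.lst_setLst, hk₃, if_false, if_true, hk']
    refine ⟨?_, fun v hv => by simp [hv, h₂]⟩
    simp only [List.length_cons, Function.update_self] at h₁ ⊢
    omega
  rintro s₄ f₄ ⟨h₄, h₅⟩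
  have d₄ : s₄.reg d = s.reg d := (f₄.reg d (by simp [writesReg, hd₃])).trans d₃
  have l₄ : s₄.lst live = s₂.lst live := (f₄.lst live rfl).trans l₃
  have g₄ : s₄.lst negG = s₃.lst negG := f₄.lst negG rfl
  simp only [wp_block_singleton, wp_clear]
  generalize hs : Store.setLst _ _ _ _ = s₅
  have z₅ : s₅.reg zero = 0 := by subst hs; simpa using (f₄.reg zero rfl).trans z₃
  have l₅ : s₅.lst live = s₂.lst live := by subst hs; simp [l₄]
  have g₅ : s₅.lst negG = s₃.lst negG := by subst hs; simp [g₄]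
  have r₅ : s₅.lst recov = Function.update (s₄.lst recov) (s.reg d) [] := by subst hs; simp [d₄]
  have B₅ : s₅.lst setB = s.lst setB := by subst hs; simpa using (f₄.lst setB rfl).trans B₃
  have S₅ : s₅.lst setS = s.lst setS := by subst hs; simpa using (f₄.lst setS rfl).trans S₃
  refine ⟨⟨z₅, ?_, ?_, ?_, ?_, ?_, ?_, ?_, ?_, ?_⟩, ?_, ?_⟩
  · rwa [l₅]
  · rw [l₅]
    exact fun v hv => h.live_lt v ((hlive v).1 hv).1
  · rw [l₅, g₅]
    exact fun v hv => (h₃ v hv).1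
  · rw [l₅, g₅]
    intro v hv e he
    obtain ⟨h₁, h₂, -⟩ := (h₃ v hv).2 e he
    exact (hlive e).2 ⟨h₁, h₂ (by simp)⟩
  -- The entries of `d` have moved to the list of `k` and the list of `d` is now empty, so the total
  -- is unchanged.
  · refine le_trans (le_of_eq ?_) h.recov_sum
    have hkN := Finset.mem_range.2 (h.live_lt _ hkl)
    have hdN : s.reg d ∈ (Finset.range N).erase (s.reg k) :=
      Finset.mem_erase.2 ⟨hkd.symm, Finset.mem_range.2 (h.live_lt _ hdl)⟩
    rw [← Finset.add_sum_erase _ _ hkN, ← Finset.add_sum_erase _ _ hdN,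
      ← Finset.add_sum_erase _ _ hkN, ← Finset.add_sum_erase _ _ hdN, ← add_assoc, ← add_assoc]
    congr 1
    · simp only [List.length_nil] at h₄
      simp [r₅, hkd]
      omega
    · refine Finset.sum_congr rfl fun i hi => ?_
      simp only [Finset.mem_erase] at hi
      simp [r₅, hi.1, h₅ i hi.2.1]
  · rw [B₅]
    exact h.setB_nodup
  · rw [B₅]
    exact h.setB_lt
  · rw [l₅, S₅]
    have := h.setS_card
    omega
  · rw [S₅]
    exact h.setS_lt
  · rw [l₅, l₂]
  · rw [l₅, g₅]
    exact fun v hv hvk e he => ((h₃ v hv).2 e he).2.2 hvk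

/-- After deleting the edge between two vertices. -/
theorem wp_deleteEdge {L N n k l : ℕ} {s : Store} (h : WellFormed N n s) (hN : N ≤ L)
    (hk : k ≠ tmp) (hl : l ≠ tmp) (hne : s.reg k ≠ s.reg l)
    (hkl : s.reg k ∈ s.lst live 0) (hll : s.reg l ∈ s.lst live 0) :
    wp L (deleteEdge k l) (fun s' => WellFormed N n s' ∧
      (∀ v, ∀ e ∈ s'.lst negG v, e ∈ s.lst negG v) ∧
      s.reg l ∉ s'.lst negG (s.reg k) ∧ s.reg k ∉ s'.lst negG (s.reg l)) s := by
  rw [deleteEdge, wp_block_cons]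
  refine wp_delete (by decide) hl hk (by simp [h.zero]) ((h.neg_length hkl).trans hN) fun a j => ?_
  rw [wp_block_singleton]
  refine wp_delete (by decide) hk hl (by simp [h.zero]) ?_ fun a' j' => ?_
  · simpa [hk, hl, hne.symm] using (h.neg_length hll).trans hN
  generalize hs : Store.setLst _ _ _ _ = s₁
  have g₁ : ∀ v, s₁.lst negG v = if v = s.reg l then (s.lst negG v).filter (· ≠ s.reg k) else
      if v = s.reg k then (s.lst negG v).filter (· ≠ s.reg l) else s.lst negG v := by
    intro v
    subst hs
    by_cases hvl : v = s.reg l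
    · simp [hk, hl, hne.symm, hvl]
    · by_cases hvk : v = s.reg k
      · simp [hk, hl, hne, hvk]
      · simp [hk, hl, hvl, hvk]
  have hsub : ∀ v, (s₁.lst negG v).Sublist (s.lst negG v) := by
    intro v
    rw [g₁]
    split_ifs
    exacts [List.filter_sublist, List.filter_sublist, List.Sublist.refl _]
  have l₁ : s₁.lst live = s.lst live := by subst hs; simp
  have r₁ : s₁.lst recov = s.lst recov := by subst hs; simp
  have B₁ : s₁.lst setB = s.lst setB := by subst hs; simp
  have S₁ : s₁.lst setS = s.lst setS := by subst hs; simp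
  have z₁ : s₁.reg zero = 0 := by subst hs; simp [h.zero]
  refine ⟨⟨z₁, l₁ ▸ h.live_nodup, l₁ ▸ h.live_lt, fun v hv => ?_, fun v hv e he => ?_,
    r₁ ▸ h.recov_sum, B₁ ▸ h.setB_nodup, B₁ ▸ h.setB_lt, l₁ ▸ S₁ ▸ h.setS_card,
    S₁ ▸ h.setS_lt⟩, fun v e he => (hsub v).subset he, ?_, ?_⟩
  · exact (h.neg_nodup v (l₁ ▸ hv)).sublist (hsub v)
  · rw [l₁] at hv ⊢
    exact h.neg_live v hv e ((hsub v).subset he)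
  · simp [g₁, hne]
  · simp [g₁]


/-- What one pass of the main loop achieves: the algorithm ends, or the graph gets smaller. -/
def Progress (N n : ℕ) (s s' : Store) : Prop :=
  s'.reg active ≠ 0 → Invariant N n s' ∧ (s'.lst live 0).length < (s.lst live 0).length

/-! ### Steps 3 to 7, 9 and 10. -/

section Steps

variable {L N n : ℕ} {s s₀ : Store} {next : Cmd}

/-- If the test succeeds, `active` becomes 0 and `Progress` holds vacuously. What the test says
about the graph is irrelevant here, hence the trivial `N` and `R`. -/
theorem wp_step3 (h : Invariant N n s) (hN : N ≤ L)
    (hnext : ∀ s' : Store, s'.lst = s.lst → s'.num = s.num → s'.reg zero = 0 →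
      wp L next (Progress N n s) s') : wp L (step3 next) (Progress N n s) s := by
  refine wp_lookFor (fun _ => True) (fun _ _ => True) h.zero (h.live_length.trans hN) rfl rfl rfl
    (fun a => by simp [writesLst, block, mem]) (fun a => by simp [writesNum, block, mem]) ?_
    (fun _ => hnext) ?_
  · intro e _ s' hl _ hz _
    have hB : (s'.lst setB 0).length ≤ L := hl ▸ h.setB_length.trans hN
    rw [wp_block_cons]
    refine wp_mem (by decide) (by decide) (by decide) (by decide) (by rwa [hz]) fun k => ?_
    rw [wp_block_singleton, wp_ifEq, wp_skip, wp_block_cons, wp_load, wp_block_singleton]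
    refine ⟨fun _ => by simpa using em' _, fun _ => ?_⟩
    refine wp_mem (by decide) (by decide) (by decide) (by decide) (by simpa [hz]) fun k => ?_
    simpa using em' _
  · intro s' _ _ _ _ _
    simp only [finish, wp_block_cons, wp_block_singleton, wp_const]
    simp [Progress]

/-- The chosen vertex is the partner of `x`, whose own partner is `x` again by `bar_bar`. The
continuation `c` serves Step 4, which still has to update `B`; Steps 6 and 7 use the primed version.
-/
theorem wp_chooseBar (h : Invariant N n s) (hN : N ≤ L) (hx : s.reg x ∈ s.lst live 0) {c : Cmd}
    {Q : Store → Prop}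
    (hc : ∀ s', s'.reg x = s.reg x → Invariant N n s' →
      (s'.lst live 0).length < (s.lst live 0).length → wp L c Q s') :
    wp L (block [load y bar x, copy yb x, choose, c]) Q s := by
  simp only [wp_block_cons, wp_load, wp_copy]
  refine wp_conseq (wp_choose (N := N) (n := n) ?_ hN ?_ ?_) ?_
  · exact h.congr rfl rfl h.zero
  · simpa using h.mem _ hx
  · simpa using (h.bar_bar _ hx).symm
  · rintro s' f ⟨h₁, h₂⟩
    rw [wp_block_singleton]
    exact hc s' (f.reg x rfl) h₁ h₂

theorem wp_chooseBar' (h : Invariant N n s) (hN : N ≤ L) (hs : (s.lst live) = s₀.lst live)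
    (hx : s.reg x ∈ s.lst live 0) :
    wp L (block [load y bar x, copy yb x, choose]) (Progress N n s₀) s := by
  simp only [wp_block_cons, wp_block_singleton, wp_load, wp_copy]
  refine wp_conseq (wp_choose (N := N) (n := n) ?_ hN ?_ ?_) ?_
  · exact h.congr rfl rfl h.zero
  · simpa using h.mem _ hx
  · simpa using (h.bar_bar _ hx).symm
  · rintro s' f ⟨h₁, h₂⟩ -
    exact ⟨h₁, hs ▸ h₂⟩

theorem wp_step4 (h : Invariant N n s) (hN : N ≤ L)
    (hnext : ∀ s' : Store, s'.lst = s.lst → s'.num = s.num → s'.reg zero = 0 →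
      wp L next (Progress N n s) s') : wp L (step4 next) (Progress N n s) s := by
  refine wp_lookFor (fun _ => True) (fun _ _ => True) h.zero (h.live_length.trans hN) rfl rfl rfl
    (fun a => by simp [writesLst, block, mem]) (fun a => by simp [writesNum, block, mem]) ?_
    (fun _ => hnext) ?_
  · intro e _ s' hl _ hz _
    have hB : (s'.lst setB 0).length ≤ L := hl ▸ h.setB_length.trans hN
    refine wp_mem (by decide) (by decide) (by decide) (by decide) (by rwa [hz]) fun k => ?_
    simpa using em' _
  · intro s' hl hn hz hx _
    refine wp_chooseBar (h.congr hl hn hz) hN (by rwa [hl]) fun s₁ _ h₁ hlt => ?_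
    rw [hl] at hlt
    have hz₁ := h₁.zero
    refine wp_delete (by decide) (by decide) (by decide) (by simp [hz₁])
      (by rw [hz₁]; exact h₁.setB_length.trans hN) fun k l _ => ?_
    generalize hs : Store.setLst _ _ _ _ = s₂
    have l₂ : s₂.lst live = s₁.lst live := by subst hs; simp
    have g₂ : s₂.lst negG = s₁.lst negG := by subst hs; simp
    have r₂ : s₂.lst recov = s₁.lst recov := by subst hs; simp
    have S₂ : s₂.lst setS = s₁.lst setS := by subst hs; simp
    have n₂ : s₂.num = s₁.num := by subst hs; simp
    have B₂ : s₂.lst setB 0 = (s₁.lst setB 0).filter (· ≠ s₁.reg x) := by subst hs; simp [hz₁]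
    have z₂ : s₂.reg zero = 0 := by subst hs; simp [hz₁]
    refine ⟨⟨⟨z₂, l₂ ▸ h₁.live_nodup, l₂ ▸ h₁.live_lt, l₂ ▸ g₂ ▸ h₁.neg_nodup,
      l₂ ▸ g₂ ▸ h₁.neg_live, r₂ ▸ h₁.recov_sum, B₂ ▸ h₁.setB_nodup.filter _, fun v hv => ?_,
      l₂ ▸ S₂ ▸ h₁.setS_card, S₂ ▸ h₁.setS_lt⟩, h₁.toMatched.congr (by rw [l₂]) (by rw [n₂]),
      ?_⟩, l₂ ▸ hlt⟩
    · rw [B₂] at hv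
      exact h₁.setB_lt v (List.mem_of_mem_filter hv)
    · have := h₁.noMatchedEdge
      unfold NoMatchedEdge at this ⊢
      rwa [l₂, g₂, n₂]

theorem wp_step5 (h : Invariant N n s) (hN : N ≤ L)
    (hnext : ∀ s' : Store, s'.lst = s.lst → s'.num = s.num → s'.reg zero = 0 →
      wp L next (Progress N n s) s') : wp L (step5 next) (Progress N n s) s := by
  refine wp_lookFor (fun _ => True) (fun _ _ => True) h.zero (h.live_length.trans hN) rfl rfl rfl
    (fun a => by simp [writesLst, block, mem]) (fun a => by simp [writesNum, block, mem]) ?_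
    (fun _ => hnext) ?_
  · intro e he s' hl hn hz hv
    rw [wp_block_cons]
    refine wp_mem (by decide) (by decide) (by decide) (by decide)
      (by rw [hv, hl]; exact (h.neg_length he).trans hN) fun k => ?_
    rw [wp_block_singleton, wp_ifEq, wp_skip, wp_block_cons, wp_load, wp_block_singleton]
    refine ⟨fun _ => by simpa using em' _, fun _ => ?_⟩
    refine wp_mem (by decide) (by decide) (by decide) (by decide)
      (by simpa [hv, hl, hn] using (h.neg_length (h.mem e he)).trans hN) fun k => ?_
    simpa using em' _
  · intro s' _ _ _ _ _
    simp only [finish, wp_block_cons, wp_block_singleton, wp_const]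
    simp [Progress]

theorem wp_step6 (h : Invariant N n s) (hN : N ≤ L)
    (hnext : ∀ s' : Store, s'.lst = s.lst → s'.num = s.num → s'.reg zero = 0 →
      wp L next (Progress N n s) s') : wp L (step6 next) (Progress N n s) s := by
  refine wp_lookFor (fun _ => True) (fun _ _ => True) h.zero (h.live_length.trans hN) rfl rfl rfl
    (fun a => by simp [writesLst, block, mem]) (fun a => by simp [writesNum, block, mem]) ?_
    (fun _ => hnext) ?_
  · intro e he s' hl hn hz hv
    refine wp_mem (by decide) (by decide) (by decide) (by decide)
      (by rw [hv, hl]; exact (h.neg_length he).trans hN) fun k => ?_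
    simpa using em' _
  · intro s' hl hn hz hx _
    exact wp_chooseBar' (h.congr hl hn hz) hN (by rw [hl]) (by rwa [hl])

theorem wp_step7 (h : Invariant N n s) (hN : N ≤ L)
    (hnext : ∀ s' : Store, s'.lst = s.lst → s'.num = s.num → s'.reg zero = 0 →
      wp L next (Progress N n s) s') : wp L (step7 next) (Progress N n s) s := by
  refine wp_lookFor (fun _ => True) (fun _ _ => True) h.zero (h.live_length.trans hN) rfl rfl rfl
    (fun a => by simp [writesLst, block, mem]) (fun a => by simp [writesNum, block, mem]) ?_
    (fun _ => hnext) ?_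
  · intro e he s' hl hn hz hv
    have hlen := (h.neg_length he).trans hN
    rw [wp_block_cons, wp_const, wp_block_singleton]
    refine wp_forEach (s.lst negG e) (fun _ _ => True) (by simp [hl, hv]) hlen trivial ?_ ?_
    · intro w l s₁ f hsuf _
      have hl₁ : s₁.lst = s'.lst := funext fun a => (f.lst a (by simp [writesLst, block, mem]))
      have hv₁ : s₁.reg v = e := by simpa [hv] using f.reg v rfl
      rw [wp_block_cons, wp_load, wp_block_cons]
      refine wp_mem (by decide) (by decide) (by decide) (by decide)
        (by simpa [hl₁, hl, hv₁] using hlen) fun k => ?_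
      rw [wp_block_singleton, wp_ifEq, wp_skip, wp_const]
      exact ⟨fun _ => trivial, fun _ => trivial⟩
    · intro s₁ _ _
      simpa using em _
  · intro s' hl hn hz hx _
    exact wp_chooseBar' (h.congr hl hn hz) hN (by rw [hl]) (by rwa [hl])

/-- The failing branch matters: it tells Step 11 that no negative adjacency list is empty, so that
no vertex of the forcing graph is a dead end. -/
theorem wp_step9 (h : Invariant N n s) (hN : N ≤ L)
    (hnext : (∀ e ∈ s.lst live 0, s.lst negG e ≠ []) → ∀ s' : Store, s'.lst = s.lst →
      s'.num = s.num → s'.reg zero = 0 → wp L next (Progress N n s) s') :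
    wp L (step9 next) (Progress N n s) s := by
  refine wp_lookFor (fun e => s.lst negG e ≠ []) (fun _ _ => True) h.zero (h.live_length.trans hN)
    rfl rfl rfl
    (fun a => by simp [writesLst]) (fun a => by simp [writesNum]) ?_ hnext ?_
  · intro e he s' hl hn hz hv
    rw [wp_ifNil, wp_const, wp_const, hl, hv]
    exact ⟨fun _ => by simp, fun h => by simpa using h⟩
  · intro s' hl hn hz hx _
    simp only [wp_block_cons, wp_block_singleton, wp_load, wp_copy]
    refine wp_conseq (wp_choose (N := N) (n := n) ?_ hN ?_ ?_) ?_
    · exact h.congr hl hn hz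
    · simpa [hl] using hx
    · simp
    · rintro s' f ⟨h₁, h₂⟩ -
      exact ⟨h₁, by simpa [hl] using h₂⟩

/-- The clauses `setS_card`, `setS_lt` and `recov_sum` of the invariant are there to bound the two
loops that output the cover. -/
theorem wp_step10 (h : Invariant N n s) (hN : N ≤ L) (hn : n ≤ L)
    (hnext : s.lst live 0 ≠ [] → wp L next (Progress N n s) s) :
    wp L (step10 next) (Progress N n s) s := by
  have hz := h.zero
  rw [step10, wp_ifNil, hz]
  refine ⟨fun _ => ?_, hnext⟩
  simp only [finish, wp_block_cons, wp_block_singleton, wp_const]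
  refine wp_forEach (s.lst setS 0) (fun _ _ => True) (by simp [hz])
    (((Nat.le_add_right _ _).trans h.setS_card).trans hN) trivial ?_ ?_
  · intro v l s₁ f hsuf _
    refine wp_forEach (s.lst recov v) (fun _ _ => True) ?_
      ((h.recov_length (h.setS_lt v (hsuf.subset (by simp)))).trans hn) trivial ?_ ?_
    · simp [f.lst recov rfl]
    · intro w l' s₂ f₂ _ _
      rw [wp_push]
      trivial
    · exact fun _ _ _ => trivial
  · intro s₁ f _ hact
    exact absurd (f.reg active rfl) (by simpa using hact)

end Steps


/-- The state `s` comes from a state `s₀` satisfying the invariant by identifications to the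
vertices `X` and `bar X`. -/
structure Identified (N n X : ℕ) (s₀ s : Store) : Prop extends WellFormed N n s where
  num_eq : s.num = s₀.num
  live_subset : ∀ v ∈ s.lst live 0, v ∈ s₀.lst live 0
  noEdge : ∀ v ∈ s.lst live 0, v ≠ X → v ≠ s₀.num bar X → s₀.num bar v ∉ s.lst negG v

/-! ### Identifications: Step 8, and the forcing graph of Step 11. -/

section Steps

variable {L N n X : ℕ} {s s₀ : Store} {next : Cmd}

theorem Invariant.identified (h : Invariant N n s₀) (hl : s.lst = s₀.lst) (hn : s.num = s₀.num)
    (hz : s.reg zero = 0) (X : ℕ) : Identified N n X s₀ s :=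
  { toWellFormed := (h.congr hl hn hz).toWellFormed
    num_eq := hn
    live_subset := fun v hv => hl ▸ hv
    noEdge := fun v hv _ _ => by rw [hl] at hv ⊢; exact h.noMatchedEdge v hv }

/-- The only new neighbour that a vertex `v ≠ k` can acquire is `k`, which is `X` or its partner. If
`k` is also the partner of `v`, then `v` itself is `X` or its partner. So edges between partners can
arise only at the pair of `X`, and several identifications can be made before that edge is deleted.
-/
theorem wp_identify_identified {k d : ℕ} (h₀ : Invariant N n s₀) (hX : X ∈ s₀.lst live 0)
    (h : Identified N n X s₀ s) (hN : N ≤ L) (hn : n ≤ L)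
    (hk : k ∉ [zero, tmp, hit, w, u, flag]) (hd : d ∉ [zero, tmp, hit, w, u, flag])
    (hkX : s.reg k = X ∨ s.reg k = s₀.num bar X)
    (hkl : s.reg k ∈ s.lst live 0) (hdl : s.reg d ∈ s.lst live 0) (hkd : s.reg k ≠ s.reg d) :
    wp L (identify k d) (fun s' => Identified N n X s₀ s' ∧
      ∀ v, v ∈ s'.lst live 0 ↔ v ∈ s.lst live 0 ∧ v ≠ s.reg d) s := by
  refine wp_conseq (wp_identify h.toWellFormed hN hn hk hd hkl hdl hkd) ?_
  rintro s' f ⟨h₁, h₂, h₃⟩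
  have hl : ∀ v, v ∈ s'.lst live 0 ↔ v ∈ s.lst live 0 ∧ v ≠ s.reg d := by
    intro v
    rw [h₂]
    simp
  refine ⟨⟨h₁, (funext fun a => f.num a rfl).trans h.num_eq,
    fun v hv => h.live_subset v ((hl v).1 hv).1, fun v hv hvX hvX' he => ?_⟩, hl⟩
  have hvl := ((hl v).1 hv).1
  have hvl₀ := h.live_subset v hvl
  have hvk : v ≠ s.reg k := by rcases hkX with h | h <;> rw [h] <;> assumption
  rcases h₃ v hv hvk _ he with he | he
  · exact h.noEdge v hvl hvX hvX' he
  · rcases hkX with h | h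
    · exact hvX' (by rw [← h, ← he, h₀.bar_bar v hvl₀])
    · rw [h] at he
      exact hvX (by rw [← h₀.bar_bar v hvl₀, he, h₀.bar_bar X hX])

/-- Closes a series of identifications. The one place where partners may have become adjacent is
repaired; `hbar` keeps the matching, and a single lost vertex gives the strict decrease. -/
theorem wp_deleteEdge_identified (h₀ : Invariant N n s₀) (h : Identified N n X s₀ s)
    (hN : N ≤ L) (hx : s.reg x = X) (hxb : s.reg xb = s₀.num bar X) (hX : X ∈ s.lst live 0)
    (hXb : s₀.num bar X ∈ s.lst live 0)
    (hbar : ∀ v ∈ s.lst live 0, s₀.num bar v ∈ s.lst live 0)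
    (hlt : ∃ v ∈ s₀.lst live 0, v ∉ s.lst live 0) :
    wp L (deleteEdge x xb) (Progress N n s₀) s := by
  have hX₀ := h.live_subset _ hX
  refine wp_conseq (wp_deleteEdge h.toWellFormed hN (by decide) (by decide) ?_ ?_ ?_) ?_
  · rw [hx, hxb]
    exact (h₀.ne X hX₀).symm
  · rwa [hx]
  · rwa [hxb]
  · rintro s' f ⟨h₁, h₂, h₃, h₄⟩ -
    have hl : s'.lst live = s.lst live := f.lst live rfl
    have hnum : s'.num = s₀.num := (funext fun a => f.num a rfl).trans h.num_eq
    rw [hx, hxb] at h₃ h₄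
    refine ⟨⟨h₁, ⟨?_, ?_, ?_⟩, ?_⟩, ?_⟩
    · rwa [hl, hnum]
    · rw [hl, hnum]
      exact fun v hv => h₀.ne v (h.live_subset v hv)
    · rw [hl, hnum]
      exact fun v hv => h₀.bar_bar v (h.live_subset v hv)
    · unfold NoMatchedEdge
      rw [hl, hnum]
      intro v hv he
      by_cases hvX : v = X
      · exact h₃ (hvX ▸ he)
      · by_cases hvX' : v = s₀.num bar X
        · rw [hvX', h₀.bar_bar X hX₀] at he
          exact h₄ he
        · exact h.noEdge v hv hvX hvX' (h₂ v _ he)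
    · rw [hl]
      obtain ⟨v, hv, hv'⟩ := hlt
      -- The live vertices are still distinct, and all of them occur in the old list with `v`
      -- erased.
      have := (h.live_nodup.subperm (l₂ := (s₀.lst live 0).erase v) fun e he =>
        (List.mem_erase_of_ne (by rintro rfl; exact hv' he)).2 (h.live_subset e he)).length_le
      rw [List.length_erase_of_mem hv] at this
      have := List.length_pos_of_mem hv
      omega

/-- Because `z` lies outside the pair of `x`, both identifications merge distinct vertices, and the
whole pair of `z` disappears while that of `x` survives. -/
theorem wp_step8 (h : Invariant N n s) (hN : N ≤ L) (hn : n ≤ L)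
    (hnext : ∀ s' : Store, s'.lst = s.lst → s'.num = s.num → s'.reg zero = 0 →
      wp L next (Progress N n s) s') : wp L (step8 next) (Progress N n s) s := by
  refine wp_lookFor (fun _ => True) (fun e z => z ∈ s.lst live 0 ∧ z ≠ e ∧ z ≠ s.num bar e) h.zero
    (h.live_length.trans hN) rfl rfl rfl
    (fun a => by simp [writesLst, block, mem]) (fun a => by simp [writesNum, block, mem]) ?_
    (fun _ => hnext) ?_
  · intro e he s' hl hn hz hv
    have hlen := (h.neg_length he).trans hN
    have hlen' := (h.neg_length (h.mem e he)).trans hN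
    simp only [wp_block_cons, wp_const, wp_load, wp_block_singleton]
    -- That the partners of `x` and `z` are adjacent too is not recorded; only the position of `z`
    -- matters for termination.
    refine wp_forEach (s.lst negG e) (fun _ s' => s'.reg flag ≠ 0 → s'.reg z ∈ s.lst live 0 ∧
      s'.reg z ≠ e ∧ s'.reg z ≠ s.num bar e) (by simp [hl, hv]) hlen (by simp) ?_ ?_
    · intro w l s₁ f hsuf h₁
      have hl₁ : s₁.lst = s'.lst := funext fun a => (f.lst a (by simp [writesLst, block, mem]))
      have hv₁ : s₁.reg v = e := by simpa [hv] using f.reg v rfl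
      have hvb₁ : s₁.reg vb = s.num bar e := by simpa [hv, hn] using f.reg vb rfl
      simp only [wp_ifEq, wp_skip, wp_block_cons, wp_load]
      refine ⟨fun _ => h₁, fun h₂ => ⟨fun _ => h₁, fun h₃ => ?_⟩⟩
      refine wp_mem (by decide) (by decide) (by decide) (by decide)
        (by simpa [hl₁, hl, hvb₁] using hlen') fun k => ?_
      simp only [wp_block_singleton, wp_ifEq, wp_skip, wp_block_cons, wp_copy, wp_const]
      refine ⟨fun _ => by simpa using h₁, fun _ _ => ?_⟩
      have : w ∈ s.lst live 0 := h.neg_live e he w (hsuf.subset (by simp))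
      simp only [Store.reg_setReg] at h₂ h₃ ⊢
      simp at h₂ h₃ ⊢
      exact ⟨this, hv₁ ▸ h₂, hvb₁ ▸ h₃⟩
    · intro s₁ _ h₁
      by_cases hf : s₁.reg flag = 0
      · simp [hf]
      · exact Or.inr ⟨hf, h₁ hf⟩
  · intro s' hl hn' hz hx hR
    obtain ⟨hz₁, hz₂, hz₃⟩ := hR
    have hzb := h.mem _ hz₁
    have hxb := h.mem _ hx
    have hne : s.num bar (s'.reg z) ≠ s'.reg x := fun h' => hz₃ (by rw [← h', h.bar_bar _ hz₁])
    have hne' : s.num bar (s'.reg z) ≠ s.num bar (s'.reg x) := fun h' => hz₂ (by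
      rw [← h.bar_bar _ hz₁, h', h.bar_bar _ hx])
    simp only [wp_block_cons, wp_load]
    refine wp_conseq (wp_identify_identified (X := s'.reg x) h hx (h.identified ?_ ?_ ?_ _) hN hn
      (by decide) (by decide) ?_ ?_ ?_ ?_) ?_
    · simp [hl]
    · simp [hn']
    · simpa using hz
    · simp
    · simpa [hl] using hx
    · simpa [hl, hn'] using hzb
    · simpa [hn'] using hne.symm
    rintro s₁ f₁ ⟨h₁, l₁⟩
    have x₁ : s₁.reg x = s'.reg x := by simpa using f₁.reg x rfl
    have xb₁ : s₁.reg xb = s.num bar (s'.reg x) := by simpa [hn'] using f₁.reg xb rfl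
    have z₁ : s₁.reg z = s'.reg z := by simpa using f₁.reg z rfl
    simp only [Store.reg_setReg, Store.lst_setReg, Store.num_setReg, hl, hn'] at l₁
    simp at l₁
    clear f₁
    rw [wp_block_cons]
    refine wp_conseq (wp_identify_identified (X := s'.reg x) h hx h₁ hN hn
      (by decide) (by decide) (Or.inr xb₁) ?_ ?_ ?_) ?_
    · rw [xb₁, l₁]
      exact ⟨hxb, hne'.symm⟩
    · rw [z₁, l₁]
      exact ⟨hz₁, (h.ne _ hz₁).symm⟩
    · rw [xb₁, z₁]
      exact hz₃.symm
    rintro s₂ f₂ ⟨h₂, l₂⟩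
    have x₂ : s₂.reg x = s'.reg x := (f₂.reg x rfl).trans x₁
    have xb₂ : s₂.reg xb = s.num bar (s'.reg x) := (f₂.reg xb rfl).trans xb₁
    simp only [l₁, z₁, and_assoc] at l₂
    clear f₂
    rw [wp_block_singleton]
    refine wp_deleteEdge_identified h h₂ hN x₂ xb₂ ?_ ?_ ?_ ⟨_, hz₁, ?_⟩
    · rw [l₂]
      exact ⟨hx, hne.symm, hz₂.symm⟩
    · rw [l₂]
      exact ⟨hxb, hne'.symm, hz₃.symm⟩
    · intro v hv
      rw [l₂] at hv ⊢
      refine ⟨h.mem v hv.1, fun h' => hv.2.2 ?_, fun h' => hv.2.1 ?_⟩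
      · rw [← h.bar_bar v hv.1, h', h.bar_bar _ hz₁]
      · rw [← h', h.bar_bar v hv.1]
    · rw [l₂]
      simp

/-- The forcing graph: the out-neighbours of live vertices are other live vertices. -/
def IsForcing (s : Store) : Prop :=
  ∀ v ∈ s.lst live 0, s.lst forc v ≠ [] ∧ ∀ e ∈ s.lst forc v, e ∈ s.lst live 0 ∧ e ≠ v

/-- An arc from `v` to itself would come from a negative edge between `v` and its partner, which
`noMatchedEdge` excludes. Each neighbour contributes exactly one arc, so the new lists are as long
as the old ones and not empty. -/
theorem wp_step11 (h : Invariant N n s) (hN : N ≤ L)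
    (hne : ∀ e ∈ s.lst live 0, s.lst negG e ≠ []) :
    wp L step11 (fun s' => IsForcing s' ∧ ∀ v ∈ s.lst live 0, (s'.lst forc v).length ≤ L) s := by
  refine wp_forEach (s.lst live 0) (fun l s' => ∀ v ∈ s.lst live 0, v ∉ l →
    (s'.lst forc v ≠ [] ∧ ∀ e ∈ s'.lst forc v, e ∈ s.lst live 0 ∧ e ≠ v) ∧
      (s'.lst forc v).length ≤ L) (by rw [h.zero]) (h.live_length.trans hN) (by simp +contextual) ?_ ?_
  · intro a l s₁ f hsuf h₁
    have ha : a ∈ s.lst live 0 := hsuf.subset (by simp)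
    have gg : s₁.lst negG = s.lst negG := f.lst negG rfl
    have nn : s₁.num = s.num := funext fun i => f.num i rfl
    rw [wp_block_cons, wp_clear, wp_block_singleton]
    have hlen := (h.neg_length ha).trans hN
    refine wp_forEach (s.lst negG a) (fun l' s' =>
      (s'.lst forc a).length + l'.length = (s.lst negG a).length ∧
      (∀ e ∈ s'.lst forc a, ∃ b ∈ s.lst negG a, e = s.num bar b) ∧
      ∀ v, v ≠ a → s'.lst forc v = s₁.lst forc v) (by simp [gg]) hlen (by simp +contextual) ?_ ?_
    · rintro b l' s₂ f₂ hsuf' ⟨h₂, h₃, h₄⟩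
      have v₂ : s₂.reg v = a := by simpa using f₂.reg v rfl
      have n₂ : s₂.num = s.num := by simpa [nn] using funext fun i => f₂.num i rfl
      simp only [wp_block_cons, wp_load, wp_block_singleton, wp_push]
      simp [v₂, n₂]
      have hb : b ∈ s.lst negG a := hsuf'.subset (by simp)
      refine ⟨by simp only [List.length_cons] at h₂; omega, ⟨⟨b, hb, rfl⟩, h₃⟩, fun v hv => ?_⟩
      simp [hv, h₄]
    · rintro s₂ - ⟨h₂, h₃, h₄⟩ v hv hvl
      by_cases hva : v = a
      · subst hva
        simp only [List.length_nil, add_zero] at h₂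
        refine ⟨⟨fun h₅ => ?_, fun e he => ?_⟩, h₂ ▸ hlen⟩
        · rw [h₅] at h₂
          exact hne v hv (List.length_eq_zero_iff.1 h₂.symm)
        · obtain ⟨b, hb, rfl⟩ := h₃ e he
          have hbl := h.neg_live v hv b hb
          refine ⟨h.mem b hbl, fun h₅ => h.noMatchedEdge v hv ?_⟩
          have h₆ : s.num bar v = b := by rw [← h₅, h.bar_bar b hbl]
          rwa [h₆]
      · rw [h₄ v hva]
        exact h₁ v hv (by simp [hva, hvl])
  · intro s₁ f h₁
    have ll : s₁.lst live = s.lst live := f.lst live rfl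
    refine ⟨fun v hv => ?_, fun v hv => (h₁ v hv (by simp)).2⟩
    rw [ll] at hv ⊢
    exact (h₁ v hv (by simp)).1

end Steps


/-! ### Step 12 and the main loop. -/

section Steps

variable {L N n : ℕ} {s s₀ : Store}

/-- The cycle in the forcing graph and its image are stored. -/
structure IsCycle (s : Store) : Prop where
  nodup : (s.lst cyc 0).Nodup
  live : ∀ e ∈ s.lst cyc 0, e ∈ s.lst live 0
  cur : s.reg cur ∈ s.lst cyc 0
  exists_ne : ∃ p ∈ s.lst cyc 0, p ≠ s.reg MaxDef.cur
  bar_eq : s.lst cycBar 0 = (s.lst cyc 0).map (s.num bar)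

/-- The walk visits distinct live vertices, so it repeats one after at most `N` rounds. The last
vertex on the path has an arc to the repeated vertex `cur` and differs from it, as there are no
loops; this yields `exists_ne`. Nothing else about the cycle is needed, not even that its arcs are
consecutive. -/
theorem wp_findCycle (h : WellFormed N n s) (hN : N ≤ L) (hne : s.lst live 0 ≠ [])
    (hf : IsForcing s) (hL : ∀ v ∈ s.lst live 0, (s.lst forc v).length ≤ L) :
    wp L findCycle IsCycle s := by
  have hz := h.zero
  simp only [findCycle, wp_block_cons, wp_clear, wp_const]
  -- The alternative `l = s.lst live 0` covers the time before the first round; at the end it is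
  -- excluded because the graph is not empty. The loop that sets `nxt` is treated in the same way.
  refine wp_forEach (s.lst live 0) (fun l s' => (∀ v ∈ s.lst live 0, v ∉ l → s'.num mark v = 0) ∧
    (l = s.lst live 0 ∨ s'.reg cur ∈ s.lst live 0)) (by simp [hz]) (h.live_length.trans hN)
    (by simp +contextual) ?_ ?_
  · rintro a l s₁ f hsuf ⟨h₁, -⟩
    have ha : a ∈ s.lst live 0 := hsuf.subset (by simp)
    have z₁ : s₁.reg zero = 0 := by simpa [hz] using f.reg zero rfl
    simp only [wp_block_cons, wp_store, wp_block_singleton, wp_copy]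
    refine ⟨fun v hv hvl => ?_, Or.inr (by simpa using ha)⟩
    by_cases hva : v = a
    · simp [hva, z₁]
    · simpa [hva] using h₁ v hv (by simp [hva, hvl])
  rintro s₁ f ⟨m₁, c₁⟩
  replace c₁ := c₁.resolve_left hne.symm
  have z₁ : s₁.reg zero = 0 := by simpa [hz] using f.reg zero rfl
  have one₁ : s₁.reg one = 1 := by simpa using f.reg one rfl
  have l₁ : s₁.lst live = s.lst live := by simpa using f.lst live rfl
  have f₁ : s₁.lst forc = s.lst forc := by simpa using f.lst forc rfl
  have p₁ : s₁.lst path 0 = [] := by simpa [hz] using congrFun (f.lst path rfl) 0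
  have y₁ : s₁.lst cyc 0 = [] := by simpa [hz] using congrFun (f.lst cyc rfl) 0
  have yb₁ : s₁.lst cycBar 0 = [] := by simpa [hz] using congrFun (f.lst cycBar rfl) 0
  have b₁ : s₁.num bar = s.num bar := by simpa using f.num bar rfl
  clear f
  simp only [wp_block_cons, wp_const]
  -- While the walk goes on, `cur` is new and rounds left plus path length is at least `N`. With no
  -- rounds left, the path together with `cur` would be more than `N` distinct names. When it stops,
  -- the head `p` of the path is the predecessor of `cur`.
  refine wp_whileNe (fun m s' => (s'.lst path 0).Nodup ∧ (∀ v ∈ s'.lst path 0, v ∈ s.lst live 0) ∧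
    s'.reg cur ∈ s.lst live 0 ∧
    (∀ v ∈ s.lst live 0, s'.num mark v ≠ 0 ↔ v ∈ s'.lst path 0) ∧
    (s'.reg more ≠ 0 → s'.reg cur ∉ s'.lst path 0 ∧ N ≤ m + (s'.lst path 0).length) ∧
    (s'.reg more = 0 → s'.reg cur ∈ s'.lst path 0 ∧
      ∃ p l, s'.lst path 0 = p :: l ∧ p ≠ s'.reg cur)) ?_ ?_ ?_ ?_
  · simpa [p₁, c₁, hN] using m₁
  · rintro s' ⟨h₁, h₂, h₃, h₄, h₅, h₆⟩
    by_contra hm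
    obtain ⟨h₇, h₈⟩ := h₅ hm
    have := length_le_of_nodup_of_lt (l := s'.reg cur :: s'.lst path 0)
      (List.nodup_cons.2 ⟨h₇, h₁⟩) (N := N) fun v hv => by
        rcases List.mem_cons.1 hv with rfl | hv
        · exact h.live_lt _ h₃
        · exact h.live_lt _ (h₂ v hv)
    simp only [List.length_cons] at this
    omega
  · rintro m s' f hm ⟨h₁, h₂, h₃, h₄, h₅, -⟩
    obtain ⟨h₅, h₆⟩ := h₅ hm
    have z' : s'.reg zero = 0 := by simpa [z₁] using f.reg zero rfl
    have one' : s'.reg one = 1 := by simpa [one₁] using f.reg one rfl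
    have f' : s'.lst forc = s.lst forc := by simpa [f₁] using f.lst forc rfl
    clear f
    obtain ⟨hf₁, hf₂⟩ := hf _ h₃
    simp only [wp_block_cons, wp_store, wp_push, wp_copy]
    refine wp_forEach (s.lst forc (s'.reg cur)) (fun l s₂ =>
      l = s.lst forc (s'.reg cur) ∨ s₂.reg nxt ∈ s.lst forc (s'.reg cur)) (by simp [f'])
      (hL _ h₃) (Or.inl rfl) ?_ ?_
    · intro a l s₂ f hsuf _
      rw [wp_copy]
      exact Or.inr (by simpa using hsuf.subset (by simp : a ∈ a :: l))
    · intro s₂ f h₂'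
      replace h₂' := h₂'.resolve_left hf₁.symm
      obtain ⟨h₇, h₈⟩ := hf₂ _ h₂'
      have z₂ : s₂.reg zero = 0 := by simpa [z'] using f.reg zero rfl
      have p₂ : s₂.lst path 0 = s'.reg cur :: s'.lst path 0 := by
        simpa [z'] using congrFun (f.lst path rfl) 0
      have m₂ : s₂.num mark = Function.update (s'.num mark) (s'.reg cur) 1 := by
        simpa [one'] using f.num mark rfl
      have more₂ : s₂.reg more ≠ 0 := by
        rw [f.reg more rfl]
        simpa using hm
      clear f
      simp only [wp_block_cons, wp_block_singleton, wp_copy, wp_load, wp_ifEq, wp_skip, wp_const]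
      have key : ∀ v ∈ s.lst live 0, s₂.num mark v ≠ 0 ↔ v ∈ s'.reg cur :: s'.lst path 0 := by
        intro v hv
        rw [m₂]
        by_cases hvc : v = s'.reg cur
        · simp [hvc]
        · simpa [hvc] using h₄ v hv
      have hnd : (s'.reg cur :: s'.lst path 0).Nodup := List.nodup_cons.2 ⟨h₅, h₁⟩
      have hll : ∀ v ∈ s'.reg cur :: s'.lst path 0, v ∈ s.lst live 0 := by
        intro v hv
        rcases List.mem_cons.1 hv with rfl | hv
        · exact h₃
        · exact h₂ v hv
      constructor
      · intro hh
        have hh' : s₂.num mark (s₂.reg nxt) = 0 := by simpa [z₂] using hh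
        have hnp : s₂.reg nxt ∉ s'.reg cur :: s'.lst path 0 :=
          fun h' => (key _ h₇).2 h' hh'
        simp only [Store.reg_setReg, Store.lst_setReg, Store.num_setReg, p₂]
        refine ⟨hnd, hll, by simpa using h₇, key, fun _ => ⟨by simpa using hnp, ?_⟩,
          fun h' => absurd h' (by simpa using more₂)⟩
        simp only [List.length_cons]
        omega
      · intro hh
        have hh' : s₂.num mark (s₂.reg nxt) ≠ 0 := by simpa [z₂] using hh
        simp only [Store.reg_setReg, Store.lst_setReg, Store.num_setReg, p₂]
        refine ⟨hnd, hll, by simpa using h₇, key, fun h' => absurd h' (by simp),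
          fun _ => ⟨by simpa using (key _ h₇).1 hh', _, _, rfl, by simpa using h₈.symm⟩⟩
  rintro m s₂ f hm ⟨h₁, h₂, h₃, -, -, h₆⟩
  obtain ⟨h₆, p, l, hp, hpc⟩ := h₆ hm
  have z₂ : s₂.reg zero = 0 := by simpa [z₁] using f.reg zero rfl
  have l₂ : s₂.lst live = s.lst live := by simpa [l₁] using f.lst live rfl
  have y₂ : s₂.lst cyc 0 = [] := by simpa [y₁] using congrFun (f.lst cyc rfl) 0
  have yb₂ : s₂.lst cycBar 0 = [] := by simpa [yb₁] using congrFun (f.lst cycBar rfl) 0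
  have b₂ : s₂.num bar = s.num bar := by simpa [b₁] using f.num bar rfl
  clear f
  have hplen : (s₂.lst path 0).length ≤ L :=
    (length_le_of_nodup_of_lt h₁ fun v hv => h.live_lt _ (h₂ v hv)).trans hN
  simp only [wp_block_cons, wp_const, wp_block_singleton]
  -- The path has its latest vertex in front, so the cycle is an initial segment of it ending at
  -- `cur`, stored in reverse. The alternative with `flag = 0` cannot survive the loop, since `cur`
  -- would be in the empty rest.
  refine wp_forEach (s₂.lst path 0) (fun l s' => s'.lst cycBar 0 = (s'.lst cyc 0).map (s.num bar) ∧
    ((s'.reg flag = 0 ∧ s₂.reg cur ∈ l ∧ (s'.lst cyc 0).reverse ++ l = s₂.lst path 0) ∨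
      (s'.reg flag ≠ 0 ∧ s₂.reg cur ∈ s'.lst cyc 0 ∧
        (s'.lst cyc 0).reverse <+: s₂.lst path 0))) (by simp [z₂]) hplen ?_ ?_ ?_
  · simp [y₂, yb₂, h₆]
  · rintro a l' s₃ f hsuf ⟨hb, h₇⟩
    have z₃ : s₃.reg zero = 0 := by simpa [z₂] using f.reg zero rfl
    have b₃ : s₃.num bar = s.num bar := by simpa [b₂] using f.num bar rfl
    have c₃ : s₃.reg cur = s₂.reg cur := by simpa using f.reg cur rfl
    clear f
    simp only [wp_block_cons, wp_block_singleton, wp_push, wp_load, wp_ifEq, wp_skip, wp_const]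
    constructor
    · intro hfl
      obtain ⟨-, hc, hpre⟩ := h₇.resolve_right (by
        have : s₃.reg flag = 0 := by simpa [z₃] using hfl
        simp [this])
      have hfl' : s₃.reg flag = 0 := by simpa [z₃] using hfl
      constructor
      · intro hac
        have hac' : a = s₂.reg cur := by simpa [c₃] using hac
        simp only [Store.reg_setReg, Store.lst_setReg, Store.num_setReg, Store.reg_setLst,
          Store.lst_setLst, Store.num_setLst]
        simp [z₃, b₃, hb, ← hac']
        exact ⟨l', by rw [← hpre]; simp⟩
      · intro hac
        have hac' : a ≠ s₂.reg cur := by simpa [c₃] using hac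
        simp only [Store.reg_setReg, Store.lst_setReg, Store.num_setReg, Store.reg_setLst,
          Store.lst_setLst, Store.num_setLst]
        simp [z₃, b₃, hb, hfl', hpre]
        exact (List.mem_cons.1 hc).resolve_left hac'.symm
    · intro hfl
      have hfl' : s₃.reg flag ≠ 0 := by simpa [z₃] using hfl
      simp [hb]
      exact Or.inr ⟨hfl', (h₇.resolve_left (by simp [hfl'])).2⟩
  · rintro s₃ f ⟨hb, h₇⟩
    obtain ⟨-, hc, hpre⟩ := h₇.resolve_left (by simp)
    have l₃ : s₃.lst live = s.lst live := by simpa [l₂] using f.lst live rfl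
    have b₃ : s₃.num bar = s.num bar := by simpa [b₂] using f.num bar rfl
    have c₃ : s₃.reg cur = s₂.reg cur := by simpa using f.reg cur rfl
    refine ⟨?_, ?_, ?_, ⟨p, ?_, ?_⟩, ?_⟩
    · exact List.nodup_reverse.1 (h₁.sublist hpre.sublist)
    · rw [l₃]
      exact fun e he => h₂ e (hpre.subset (by simpa using he))
    · rwa [c₃]
    · obtain ⟨t, ht⟩ := hpre
      rw [hp] at ht
      rcases hr : (s₃.lst cyc 0).reverse with _ | ⟨q, r⟩
      · simp at hr
        simp [hr] at hc
      · rw [hr] at ht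
        have : q = p := by simpa using congrArg List.head? ht
        rw [← List.mem_reverse, hr, this]
        simp
    · rwa [c₃]
    · rw [hb, b₃]

theorem wp_step12 (h : Invariant N n s) (hN : N ≤ L) (hn : n ≤ L) (hne : s.lst live 0 ≠ [])
    (hf : IsForcing s) (hL : ∀ v ∈ s.lst live 0, (s.lst forc v).length ≤ L) :
    wp L step12 (Progress N n s) s := by
  rw [step12, wp_block_cons]
  refine wp_conseq (wp_findCycle h.toWellFormed hN hne hf hL) fun s₁ f h₁ => ?_
  have l₁ : s₁.lst live = s.lst live := f.lst live rfl
  have n₁ : s₁.num bar = s.num bar := f.num bar rfl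
  have i₁ : Invariant N n s₁ :=
    { toWellFormed := h.toWellFormed.congr ((f.reg zero rfl).trans h.zero) l₁ (f.lst negG rfl)
        (f.lst recov rfl) (f.lst setB rfl) (f.lst setS rfl)
      toMatched := h.toMatched.congr (by rw [l₁]) n₁
      noMatchedEdge := by
        have := h.noMatchedEdge
        unfold NoMatchedEdge at this ⊢
        rwa [l₁, n₁, f.lst negG rfl] }
  -- `Progress` depends on its initial state only through the number of live vertices, which the
  -- search for the cycle does not change.
  have hprog : Progress N n s = Progress N n s₁ := by
    unfold Progress
    rw [l₁]
  rw [hprog]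
  clear h hf hL l₁ n₁ f hprog hne
  have hz := i₁.zero
  have hcl : (s₁.lst cyc 0).length ≤ L :=
    (length_le_of_nodup_of_lt h₁.nodup fun v hv => i₁.live_lt _ (h₁.live v hv)).trans hN
  have hcl' : (s₁.lst cycBar 0).length ≤ L := by rwa [h₁.bar_eq, List.length_map]
  simp only [wp_block_cons, wp_const]
  refine wp_forEach (s₁.lst cyc 0) (fun l s' => s'.reg found = 0 →
    ∀ v ∈ s₁.lst cyc 0, v ∉ l → v ∉ s₁.lst cycBar 0) (by simp [hz]) hcl (by simp +contextual) ?_ ?_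
  · intro a l s₂ f hsuf h₂
    have z₂ : s₂.reg zero = 0 := by simpa [hz] using f.reg zero rfl
    have y₂ : s₂.lst cycBar = s₁.lst cycBar := by simpa using f.lst cycBar rfl
    rw [wp_block_cons]
    refine wp_mem (by decide) (by decide) (by decide) (by decide) (by simpa [z₂, y₂]) fun k => ?_
    simp only [wp_block_singleton, wp_ifEq, wp_skip, wp_const]
    constructor
    · intro hfl hfo v hv hvl
      by_cases hva : v = a
      · intro hm
        simp [z₂, y₂, ← hva, hm] at hfl
      · exact h₂ (by simpa using hfo) v hv (by simp [hva, hvl])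
    · intro _ hfo
      simp at hfo
  intro s₂ f h₂
  have z₂ : s₂.reg zero = 0 := by simpa [hz] using f.reg zero rfl
  have c₂ : s₂.reg cur = s₁.reg cur := by simpa using f.reg cur rfl
  have l₂ : s₂.lst = s₁.lst := funext fun a => by
    simpa using f.lst a (by simp [writesLst, block, mem])
  have n₂ : s₂.num = s₁.num := funext fun a => by
    simpa using f.num a (by simp [writesNum, block, mem])
  clear f
  simp only [wp_block_cons, wp_block_singleton, wp_ifEq, finish, wp_const, wp_copy, wp_load]
  refine ⟨fun hfo => ?_, fun _ => by simp [Progress]⟩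
  have hdisj := h₂ (by simpa [z₂] using hfo)
  simp only [List.not_mem_nil, not_false_eq_true, forall_const] at hdisj
  clear h₂ hfo
  set X := s₁.reg cur with hX
  have hXc : X ∈ s₁.lst cyc 0 := h₁.cur
  have hXl := h₁.live _ hXc
  have hmb : ∀ v ∈ s₁.lst live 0, (s₁.num bar v ∈ s₁.lst cycBar 0 ↔ v ∈ s₁.lst cyc 0) := by
    intro v hv
    rw [h₁.bar_eq, List.mem_map]
    constructor
    · rintro ⟨e, he, he'⟩
      rw [← i₁.bar_bar v hv, ← he', i₁.bar_bar e (h₁.live e he)]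
      exact he
    · exact fun h => ⟨v, h, rfl⟩
  have hcbl : ∀ v ∈ s₁.lst cycBar 0, v ∈ s₁.lst live 0 := by
    intro v hv
    rw [h₁.bar_eq, List.mem_map] at hv
    obtain ⟨e, he, rfl⟩ := hv
    exact i₁.mem e (h₁.live e he)
  have hcbn : (s₁.lst cycBar 0).Nodup := by
    rw [h₁.bar_eq]
    refine List.Nodup.map_on ?_ h₁.nodup
    intro a ha b hb hab
    rw [← i₁.bar_bar a (h₁.live a ha), hab, i₁.bar_bar b (h₁.live b hb)]
  have hXb : s₁.num bar X ∈ s₁.lst cycBar 0 := (hmb X hXl).2 hXc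
  -- the cycle is identified to one vertex
  refine wp_forEach (s₁.lst cyc 0) (fun l s' => Identified N n X s₁ s' ∧
    ∀ v, v ∈ s'.lst live 0 ↔ v ∈ s₁.lst live 0 ∧ (v ∈ s₁.lst cyc 0 → v = X ∨ v ∈ l))
    (by simp [l₂, z₂]) hcl ?_ ?_ ?_
  · refine ⟨i₁.identified (by simp [l₂]) (by simp [n₂]) (by simpa using z₂) X, fun v => ?_⟩
    simp +contextual [l₂]
  · rintro a l s₃ f hsuf ⟨h₃, l₃⟩
    have ha : a ∈ s₁.lst cyc 0 := hsuf.subset (by simp)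
    have hal : a ∉ l := (List.nodup_cons.1 (h₁.nodup.sublist hsuf.sublist)).1
    have x₃ : s₃.reg x = X := by simpa [c₂] using f.reg x rfl
    rw [wp_ifEq, wp_skip]
    constructor
    · intro hax
      have hax' : a = X := by simpa [x₃] using hax
      refine ⟨⟨h₃.toWellFormed.congr (by simpa using h₃.zero) rfl rfl rfl rfl rfl, h₃.num_eq,
        h₃.live_subset, h₃.noEdge⟩, fun v => ?_⟩
      rw [Store.lst_setReg, l₃]
      simp only [List.mem_cons, hax']
      tauto
    · intro hax
      have hax' : a ≠ X := by simpa [x₃] using hax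
      refine wp_conseq (wp_identify_identified (X := X) i₁ hXl
        ⟨h₃.toWellFormed.congr (by simpa using h₃.zero) rfl rfl rfl rfl rfl, h₃.num_eq,
        h₃.live_subset, h₃.noEdge⟩ hN hn (by decide) (by decide) (Or.inl (by simpa using x₃))
        ?_ ?_ ?_) ?_
      · simp [x₃, l₃, hXl]
      · simp [l₃, h₁.live a ha]
      · simpa [x₃] using hax'.symm
      · rintro s₄ - ⟨h₄, l₄⟩
        refine ⟨h₄, fun v => ?_⟩
        rw [l₄]
        simp only [Store.lst_setReg, Store.reg_setReg, if_true, l₃, List.mem_cons]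
        constructor
        · rintro ⟨⟨h₅, h₆⟩, h₇⟩
          exact ⟨h₅, fun h => by have := h₆ h; tauto⟩
        · rintro ⟨h₅, h₆⟩
          refine ⟨⟨h₅, fun h => by have := h₆ h; tauto⟩, ?_⟩
          rintro rfl
          exact (h₆ ha).elim hax' hal
  rintro s₃ f ⟨h₃, l₃⟩
  have x₃ : s₃.reg x = X := by simpa [c₂] using f.reg x rfl
  have xb₃ : s₃.reg xb = s₁.num bar X := by simpa [c₂, n₂] using f.reg xb rfl
  have y₃ : s₃.lst cycBar = s₁.lst cycBar := by simpa [l₂] using f.lst cycBar rfl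
  clear f
  simp only [List.not_mem_nil, or_false] at l₃
  rw [wp_block_cons]
  -- the image of the cycle is identified to one vertex
  refine wp_forEach (s₁.lst cycBar 0) (fun l s' => Identified N n X s₁ s' ∧
    ∀ v, v ∈ s'.lst live 0 ↔ v ∈ s₁.lst live 0 ∧ (v ∈ s₁.lst cyc 0 → v = X) ∧
      (v ∈ s₁.lst cycBar 0 → v = s₁.num bar X ∨ v ∈ l))
    (by rw [h₃.zero, y₃]) hcl' ?_ ?_ ?_
  · refine ⟨h₃, fun v => ?_⟩
    rw [l₃]
    tauto
  · rintro a l s₄ f hsuf ⟨h₄, l₄⟩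
    have ha : a ∈ s₁.lst cycBar 0 := hsuf.subset (by simp)
    have hal : a ∉ l := (List.nodup_cons.1 (hcbn.sublist hsuf.sublist)).1
    have hac : a ∉ s₁.lst cyc 0 := fun h => hdisj a h ha
    have xb₄ : s₄.reg xb = s₁.num bar X := (f.reg xb rfl).trans xb₃
    rw [wp_ifEq, wp_skip]
    constructor
    · intro hax
      have hax' : a = s₁.num bar X := by simpa [xb₄] using hax
      refine ⟨⟨h₄.toWellFormed.congr (by simpa using h₄.zero) rfl rfl rfl rfl rfl, h₄.num_eq,
        h₄.live_subset, h₄.noEdge⟩, fun v => ?_⟩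
      rw [Store.lst_setReg, l₄]
      simp only [List.mem_cons, hax']
      tauto
    · intro hax
      have hax' : a ≠ s₁.num bar X := by simpa [xb₄] using hax
      refine wp_conseq (wp_identify_identified (X := X) i₁ hXl
        ⟨h₄.toWellFormed.congr (by simpa using h₄.zero) rfl rfl rfl rfl rfl, h₄.num_eq,
        h₄.live_subset, h₄.noEdge⟩ hN hn (by decide) (by decide) (Or.inr (by simpa using xb₄))
        ?_ ?_ ?_) ?_
      · simp only [Store.reg_setReg, Store.lst_setReg]
        simp only [show (xb = v) = False by simp, if_false, xb₄, l₄]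
        exact ⟨hcbl _ hXb, fun h => absurd hXb (hdisj _ h), fun _ => Or.inl trivial⟩
      · simp only [Store.reg_setReg, Store.lst_setReg, if_true, l₄]
        exact ⟨hcbl _ ha, fun h => absurd h hac, fun _ => Or.inr (by simp)⟩
      · simpa [xb₄] using hax'.symm
      · rintro s₅ - ⟨h₅, l₅⟩
        refine ⟨h₅, fun v => ?_⟩
        rw [l₅]
        simp only [Store.lst_setReg, Store.reg_setReg, if_true, l₄, List.mem_cons]
        constructor
        · rintro ⟨⟨h₆, h₇, h₈⟩, h₉⟩
          exact ⟨h₆, h₇, fun h => by have := h₈ h; tauto⟩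
        · rintro ⟨h₆, h₇, h₈⟩
          refine ⟨⟨h₆, h₇, fun h => by have := h₈ h; tauto⟩, ?_⟩
          rintro rfl
          exact (h₈ ha).elim hax' hal
  rintro s₄ f ⟨h₄, l₄⟩
  have x₄ : s₄.reg x = X := (f.reg x rfl).trans x₃
  have xb₄ : s₄.reg xb = s₁.num bar X := (f.reg xb rfl).trans xb₃
  clear f
  simp only [List.not_mem_nil, or_false] at l₄
  rw [wp_block_singleton]
  -- The vertex `p` has been merged into `X` and witnesses that the graph has shrunk.
  obtain ⟨p, hp, hpX⟩ := h₁.exists_ne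
  refine wp_deleteEdge_identified i₁ h₄ hN x₄ xb₄ ?_ ?_ ?_ ⟨p, h₁.live p hp, ?_⟩
  · rw [l₄]
    exact ⟨hXl, fun _ => rfl, fun h => absurd h (hdisj X hXc)⟩
  · rw [l₄]
    exact ⟨hcbl _ hXb, fun h => absurd hXb (hdisj _ h), fun _ => rfl⟩
  · intro v hv
    rw [l₄] at hv ⊢
    obtain ⟨h₅, h₆, h₇⟩ := hv
    -- A survivor whose partner lies on the cycle lies on the image, hence is the partner of `X`;
    -- one whose partner lies on the image lies on the cycle, hence is `X`.
    refine ⟨i₁.mem v h₅, fun h => ?_, fun h => ?_⟩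
    · have := (hmb _ (i₁.mem v h₅)).2 h
      rw [i₁.bar_bar v h₅] at this
      rw [h₇ this, i₁.bar_bar X hXl]
    · rw [h₆ ((hmb v h₅).1 h)]
  · rw [l₄]
    exact fun h => hpX (h.2.1 hp)

theorem Progress.congr (h : s₀.lst live = s.lst live) : Progress N n s = Progress N n s₀ := by
  unfold Progress
  rw [h]

/-- Failed tests change registers only, so the invariant and the reference point of `Progress` are
handed on from step to step. The one fact carried along is `hne` from Step 9. -/
theorem wp_pass (h : Invariant N n s) (hN : N ≤ L) (hn : n ≤ L) :
    wp L pass (Progress N n s) s := by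
  refine wp_step3 h hN fun s₁ l₁ n₁ z₁ => ?_
  replace h := h.congr l₁ n₁ z₁
  rw [Progress.congr (congrFun l₁ live)]
  refine wp_step4 h hN fun s₂ l₂ n₂ z₂ => ?_
  replace h := h.congr l₂ n₂ z₂
  rw [Progress.congr (congrFun l₂ live)]
  refine wp_step5 h hN fun s₃ l₃ n₃ z₃ => ?_
  replace h := h.congr l₃ n₃ z₃
  rw [Progress.congr (congrFun l₃ live)]
  refine wp_step6 h hN fun s₄ l₄ n₄ z₄ => ?_
  replace h := h.congr l₄ n₄ z₄
  rw [Progress.congr (congrFun l₄ live)]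
  refine wp_step7 h hN fun s₅ l₅ n₅ z₅ => ?_
  replace h := h.congr l₅ n₅ z₅
  rw [Progress.congr (congrFun l₅ live)]
  refine wp_step8 h hN hn fun s₆ l₆ n₆ z₆ => ?_
  replace h := h.congr l₆ n₆ z₆
  rw [Progress.congr (congrFun l₆ live)]
  refine wp_step9 h hN fun hne s₇ l₇ n₇ z₇ => ?_
  replace h := h.congr l₇ n₇ z₇
  rw [Progress.congr (congrFun l₇ live)]
  rw [← l₇] at hne
  refine wp_step10 h hN hn fun hlive => ?_
  rw [wp_seq]
  refine wp_conseq (wp_step11 h hN hne) ?_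
  rintro s₈ f ⟨h₁, h₂⟩
  have l₈ : s₈.lst live = s₇.lst live := f.lst live rfl
  have n₈ : s₈.num = s₇.num := funext fun a => f.num a rfl
  rw [Progress.congr l₈]
  rw [← l₈] at hlive h₂
  refine wp_step12 ⟨h.toWellFormed.congr ((f.reg zero rfl).trans h.zero) l₈ (f.lst negG rfl)
    (f.lst recov rfl) (f.lst setB rfl) (f.lst setS rfl), h.toMatched.congr (by rw [l₈])
    (by rw [n₈]), ?_⟩ hN hn hlive h₁ h₂
  have := h.noMatchedEdge
  unfold NoMatchedEdge at this ⊢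
  rwa [l₈, n₈, f.lst negG rfl]

/-- The main loop of MaxDef ends. -/
theorem wp_mainLoop (h : Invariant N n s) (hN : N + 1 ≤ L) (hn : n ≤ L) :
    wp L (whileNe active pass) (fun _ => True) s := by
  -- The inequality is strict because a further pass may be needed when no vertex is left: that pass
  -- detects the empty graph. This is why `N + 1 ≤ L` is assumed.
  refine wp_whileNe (fun m s' => s'.reg active ≠ 0 → Invariant N n s' ∧
    (s'.lst live 0).length < m) ?_ ?_ ?_ (fun _ _ _ _ _ => trivial)
  · exact fun _ => ⟨h, h.live_length.trans_lt hN⟩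
  · intro s' h'
    by_contra hne
    exact absurd (h' hne).2 (Nat.not_lt_zero _)
  · intro m s' _ hact h'
    obtain ⟨h₁, h₂⟩ := h' hact
    refine wp_mono (wp_pass h₁ ((Nat.le_succ _).trans hN) hn) fun s₁ h₃ hact' => ?_
    obtain ⟨h₄, h₅⟩ := h₃ hact'
    exact ⟨h₄, by omega⟩

end Steps


/-- The initial states of MaxDef: a vertex list and adjacency lists (possibly with repetitions) of
length at most `M` for a graph on `{0, …, n - 1}`. -/
structure IsStart (n M : ℕ) (s : Store) : Prop where
  zero : s.reg zero = 0
  num : ∀ a v, s.num a v = 0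
  input_length : (s.lst input 0).length ≤ n
  mem_input : ∀ v, v ∈ s.lst input 0 ↔ v < n
  pos_length : ∀ v, (s.lst posA v).length ≤ M
  pos_lt : ∀ v, ∀ w ∈ s.lst posA v, w < n
  neg_length : ∀ v, (s.lst negA v).length ≤ M
  neg_lt : ∀ v, ∀ w ∈ s.lst negA v, w < n
  neg_nil : ∀ v, n ≤ v → s.lst negA v = []
  vPlus_nil : s.lst vPlus 0 = []
  stack_nil : s.lst stack 0 = []
  live_nil : s.lst live 0 = []
  negG_nil : ∀ v, s.lst negG v = []
  setS_nil : s.lst setS 0 = []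
  setB_nil : s.lst setB 0 = []
  recov_nil : ∀ v, s.lst recov v = []

/-! ### Step 1 and the depth-first search of Step 2. -/

section Preparation

variable {L M n : ℕ} {s : Store}

/-- What Step 1 achieves. -/
structure IsReduced (n M : ℕ) (s : Store) : Prop where
  length : (s.lst vPlus 0).length ≤ n
  lt : ∀ v ∈ s.lst vPlus 0, v < n
  neg_length : ∀ v, (s.lst negA v).length ≤ M
  neg_mem : ∀ v, ∀ w ∈ s.lst negA v, w ∈ s.lst vPlus 0

/-- Every vertex treated so far is either kept in `vPlus` or absent from all negative lists. In the
end all remaining negative neighbours are kept vertices, which the search will provide with names.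
-/
theorem wp_step1 (h : IsStart n M s) (hM : M ≤ L) (hn : n ≤ L) :
    wp L step1 (IsReduced n M) s := by
  refine wp_forEach (s.lst input 0) (fun l s' => (s'.lst vPlus 0).length + l.length ≤ n ∧
    (∀ v ∈ s'.lst vPlus 0, v < n) ∧ (∀ v, (s'.lst negA v).Sublist (s.lst negA v)) ∧
    ∀ v, v < n → v ∉ l → v ∈ s'.lst vPlus 0 ∨ ∀ u, v ∉ s'.lst negA u) (by rw [h.zero])
    (h.input_length.trans hn) ?_ ?_ ?_
  · exact ⟨by simpa [h.vPlus_nil] using h.input_length, by simp [h.vPlus_nil],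
      fun v => List.Sublist.refl _, fun v hv hv' => absurd ((h.mem_input v).2 hv) hv'⟩
  · rintro a l s₁ f hsuf ⟨h₁, h₂, h₃, h₄⟩
    have ha : a < n := (h.mem_input a).1 (hsuf.subset (by simp))
    have z₁ : s₁.reg zero = 0 := (f.reg zero rfl).trans h.zero
    have i₁ : s₁.lst input = s.lst input := f.lst input rfl
    simp only [List.length_cons] at h₁
    rw [wp_ifNil, wp_push, wp_block_cons, wp_clear, wp_block_singleton]
    constructor
    · intro _
      refine wp_forEach (s.lst input 0) (fun l' s' =>
        (∀ v, (s'.lst negA v).Sublist (s₁.lst negA v)) ∧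
        ∀ u, u < n → u ∉ l' → a ∉ s'.lst negA u) (by simp [z₁, i₁]) (h.input_length.trans hn)
        ?_ ?_ ?_
      · refine ⟨fun v => ?_, fun u hu hu' => absurd ((h.mem_input u).2 hu) hu'⟩
        by_cases hva : v = a
        · simp [hva]
        · simp [hva]
      · rintro b l' s₂ f₂ - ⟨h₅, h₆⟩
        have z₂ : s₂.reg zero = 0 := by simpa [z₁] using f₂.reg zero rfl
        have v₂ : s₂.reg v = a := by simpa using f₂.reg v rfl
        refine wp_delete (by decide) (by decide) (by decide) (by simp [z₂]) ?_ fun k j => ?_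
        · simpa using ((((h₅ b).trans (h₃ b)).length_le.trans (h.neg_length b)).trans hM)
        · have hg : ∀ v, v ≠ b → Function.update (s₂.lst negA) b
              ((s₂.lst negA b).filter (· ≠ a)) v = s₂.lst negA v := fun v hv => by simp [hv]
          simp only [Store.lst_setLst, Store.lst_setReg, Store.reg_setReg]
          simp only [show (v = u) = False by simp, show (negA = buf) = False by simp, if_true,
            if_false, v₂]
          refine ⟨fun v => ?_, fun u hu hul => ?_⟩
          · by_cases hvb : v = b
            · subst hvb
              rw [Function.update_self]
              exact List.filter_sublist.trans (h₅ v)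
            · rw [hg v hvb]
              exact h₅ v
          · by_cases hub : u = b
            · subst hub
              simp
            · rw [hg u hub]
              exact h₆ u hu (by simp [hub, hul])
      · rintro s₂ f₂ ⟨h₅, h₆⟩
        have p₂ : s₂.lst vPlus = s₁.lst vPlus := by simpa using f₂.lst vPlus rfl
        refine ⟨by rw [p₂]; omega, by rwa [p₂], fun v => (h₅ v).trans (h₃ v), fun v hv hvl => ?_⟩
        by_cases hva : v = a
        · subst hva
          refine Or.inr fun u hu => ?_
          by_cases hun : u < n
          · exact h₆ u hun (by simp) hu
          -- The loop clears only the lists of vertices; outside of them `neg_nil` says that there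
          -- was nothing to clear.
          · have := ((h₅ u).trans (h₃ u)).subset hu
            simp [h.neg_nil u (by omega)] at this
        · rw [p₂]
          exact (h₄ v hv (by simp [hva, hvl])).imp_right fun h' u hu => h' u ((h₅ u).subset hu)
    · intro _
      simp [z₁]
      refine ⟨by omega, ⟨ha, h₂⟩, h₃, fun v hv hvl => ?_⟩
      by_cases hva : v = a
      · exact Or.inl (Or.inl hva)
      · exact (h₄ v hv (by simp [hva, hvl])).imp_left Or.inr
  · rintro s₁ f ⟨h₁, h₂, h₃, h₄⟩
    refine ⟨by simpa using h₁, h₂, fun v => (h₃ v).length_le.trans (h.neg_length v),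
      fun v w hw => ?_⟩
    exact (h₄ w (h.neg_lt v w ((h₃ v).subset hw)) (by simp)).resolve_right fun h' => h' v hw

/-- The number of vertices that the depth-first search has not yet seen. -/
def unseen (n : ℕ) (s : Store) : ℕ :=
  ((Finset.range n).filter fun v => s.num seen v = 0).card

/-- The invariant of the depth-first search: `k` components and `m` visits may follow. -/
structure SearchInvariant (n k m : ℕ) (s : Store) : Prop extends Matched s where
  zero : s.reg zero = 0
  one : s.reg one = 1
  live_nodup : (s.lst live 0).Nodup
  live_lt : ∀ v ∈ s.lst live 0, v < s.reg fresh
  fresh_le : s.reg fresh + 2 * k ≤ 2 * n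
  name_live : ∀ v, s.num seen v ≠ 0 → s.num name v ∈ s.lst live 0
  recov_sum : ∑ i ∈ Finset.range (2 * n), (s.lst recov i).length + unseen n s ≤ n
  stack_seen : ∀ v ∈ s.lst stack 0, s.num seen v ≠ 0
  stack_card : (s.lst stack 0).length + unseen n s ≤ m

theorem SearchInvariant.congr {k m : ℕ} {s' : Store} (h : SearchInvariant n k m s)
    (h₀ : s'.reg MaxDef.zero = s.reg MaxDef.zero) (h₁ : s'.reg MaxDef.one = s.reg MaxDef.one)
    (h₂ : s'.reg fresh = s.reg fresh) (hl : s'.lst = s.lst) (hn : s'.num = s.num) :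
    SearchInvariant n k m s' :=
  { toMatched := h.toMatched.congr (by rw [hl]) (by rw [hn])
    zero := h₀ ▸ h.zero
    one := h₁ ▸ h.one
    live_nodup := hl ▸ h.live_nodup
    live_lt := hl ▸ h₂ ▸ h.live_lt
    fresh_le := h₂ ▸ h.fresh_le
    name_live := hl ▸ hn ▸ h.name_live
    recov_sum := by unfold unseen; rw [hl, hn]; exact h.recov_sum
    stack_seen := hl ▸ hn ▸ h.stack_seen
    stack_card := by unfold unseen; rw [hl, hn]; exact h.stack_card }

/-- A vertex `w` is visited and gets the name `o`. -/
theorem SearchInvariant.visit {k m w o : ℕ} (h : SearchInvariant n k m s) (hw : w < n)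
    (hs : s.num seen w = 0) (ho : o ∈ s.lst live 0) :
    SearchInvariant n k m ((((s.setNum seen w 1).setNum name w o).setLst recov o
      (w :: s.lst recov o)).setLst stack 0 (w :: s.lst stack 0)) := by
  generalize hs' : Store.setLst _ _ _ _ = s'
  have r : s'.reg = s.reg := by subst hs'; rfl
  have b : s'.num bar = s.num bar := by subst hs'; simp
  have e : s'.num seen = Function.update (s.num seen) w 1 := by subst hs'; simp
  have nm : s'.num name = Function.update (s.num name) w o := by subst hs'; simp
  have l : s'.lst live = s.lst live := by subst hs'; simp
  have rc : s'.lst recov = Function.update (s.lst recov) o (w :: s.lst recov o) := by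
    subst hs'; simp
  have st : s'.lst stack 0 = w :: s.lst stack 0 := by subst hs'; simp
  clear hs'
  have hun : unseen n s' + 1 = unseen n s := by
    have hmem : w ∈ (Finset.range n).filter fun v => s.num seen v = 0 := by simp [hw, hs]
    unfold unseen
    rw [← Finset.card_erase_add_one hmem]
    congr 2
    ext v
    by_cases hvw : v = w <;> simp [e, hvw]
  have ho' : o ∈ Finset.range (2 * n) := by
    have := h.live_lt o ho
    have := h.fresh_le
    simp
    omega
  refine ⟨h.toMatched.congr (by rw [l]) b, r ▸ h.zero, r ▸ h.one, l ▸ h.live_nodup,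
    l ▸ r ▸ h.live_lt, r ▸ h.fresh_le, fun v hv => ?_, ?_, fun v hv => ?_, ?_⟩
  · rw [l, nm]
    rw [e] at hv
    by_cases hvw : v = w
    · simpa [hvw] using ho
    · simp only [hvw, ne_eq, not_false_eq_true, Function.update_of_ne] at hv ⊢
      exact h.name_live v hv
  · have hsum : ∑ i ∈ Finset.range (2 * n), (s'.lst recov i).length =
        ∑ i ∈ Finset.range (2 * n), (s.lst recov i).length + 1 := by
      rw [← Finset.add_sum_erase _ _ ho', ← Finset.add_sum_erase _ _ ho']
      have : ∑ i ∈ (Finset.range (2 * n)).erase o, (s'.lst recov i).length =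
          ∑ i ∈ (Finset.range (2 * n)).erase o, (s.lst recov i).length := by
        refine Finset.sum_congr rfl fun i hi => ?_
        rw [rc, Function.update_of_ne (Finset.ne_of_mem_erase hi)]
      rw [this, rc]
      simp
      omega
    have := h.recov_sum
    omega
  · rw [st] at hv
    rw [e]
    by_cases hvw : v = w
    · simp [hvw]
    · simpa [hvw] using h.stack_seen v ((List.mem_cons.1 hv).resolve_left hvw)
  · have := h.stack_card
    rw [st, List.length_cons]
    omega

/-- A new component gets the names `a` and `a + 1`. -/
theorem SearchInvariant.newPair {k m : ℕ} {s' : Store} (h : SearchInvariant n (k + 1) m s)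
    (h₀ : s'.reg MaxDef.zero = 0) (h₁ : s'.reg MaxDef.one = 1)
    (h₂ : s'.reg fresh = s.reg fresh + 2)
    (hb : s'.num bar = Function.update (Function.update (s.num bar) (s.reg fresh)
      (s.reg fresh + 1)) (s.reg fresh + 1) (s.reg fresh))
    (hl : s'.lst live 0 = (s.reg fresh + 1) :: s.reg fresh :: s.lst live 0)
    (hs : s'.num MaxDef.seen = s.num MaxDef.seen) (hn : s'.num name = s.num name)
    (hr : s'.lst recov = s.lst recov) (hst : s'.lst stack = s.lst stack) :
    SearchInvariant n k m s' := by
  have hlt := h.live_lt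
  have hb₁ : s'.num bar (s.reg fresh) = s.reg fresh + 1 := by simp [hb]
  have hb₂ : s'.num bar (s.reg fresh + 1) = s.reg fresh := by simp [hb]
  have hb₃ : ∀ v ∈ s.lst live 0, s'.num bar v = s.num bar v := by
    intro v hv
    have := hlt v hv
    rw [hb, Function.update_of_ne (by omega), Function.update_of_ne (by omega)]
  have hu : unseen n s' = unseen n s := by
    unfold unseen
    rw [hs]
  have hm : ∀ v, v ∈ s'.lst live 0 ↔ v = s.reg fresh + 1 ∨ v = s.reg fresh ∨ v ∈ s.lst live 0 := by
    simp [hl]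
  have hfl := h.fresh_le
  refine ⟨⟨?_, ?_, ?_⟩, h₀, h₁, ?_, ?_, ?_, ?_, ?_, ?_, ?_⟩
  · intro v hv
    rw [hm] at hv ⊢
    rcases hv with rfl | rfl | hv
    · simp [hb₂]
    · simp [hb₁]
    · rw [hb₃ v hv]
      exact Or.inr (Or.inr (h.mem v hv))
  · intro v hv
    rcases (hm v).1 hv with rfl | rfl | hv
    · simp [hb₂]
    · simp [hb₁]
    · rw [hb₃ v hv]
      exact h.ne v hv
  · intro v hv
    rcases (hm v).1 hv with rfl | rfl | hv
    · rw [hb₂, hb₁]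
    · rw [hb₁, hb₂]
    · rw [hb₃ v hv, hb₃ _ (h.mem v hv)]
      exact h.bar_bar v hv
  · rw [hl]
    refine List.nodup_cons.2 ⟨fun hv => ?_, List.nodup_cons.2 ⟨fun hv => ?_, h.live_nodup⟩⟩
    · rcases List.mem_cons.1 hv with hv | hv
      · omega
      · have := hlt _ hv
        omega
    · exact lt_irrefl _ (hlt _ hv)
  · intro v hv
    rw [h₂]
    rcases (hm v).1 hv with rfl | rfl | hv
    · omega
    · omega
    · have := hlt v hv
      omega
  · rw [h₂]
    omega
  · rw [hs, hn]
    exact fun v hv => (hm _).2 (Or.inr (Or.inr (h.name_live v hv)))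
  · rw [hr, hu]
    exact h.recov_sum
  · rw [hst, hs]
    exact h.stack_seen
  · rw [hst, hu]
    exact h.stack_card

/-- A visit moves a vertex from the unseen ones to the stack and to one recovery list, so both sums
in `SearchInvariant` are preserved by it. Popping lowers the first sum, which bounds the rounds of
the inner loop. The value of `bad` is not tracked. -/
theorem wp_step2Search (hz : s.reg zero = 0) (hseen : ∀ v, s.num seen v = 0)
    (hpos : ∀ v, (s.lst posA v).length ≤ M ∧ ∀ w ∈ s.lst posA v, w < n)
    (hstack : s.lst stack 0 = []) (hlive : s.lst live 0 = []) (hrecov : ∀ v, s.lst recov v = [])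
    (hr : IsReduced n M s) (hM : M ≤ L) (hn : n ≤ L) :
    wp L step2Search (fun s' => (∃ m, SearchInvariant n 0 m s') ∧
      ∀ v ∈ s.lst vPlus 0, s'.num seen v ≠ 0) s := by
  have hu : ∀ s', unseen n s' ≤ n := fun s' =>
    (Finset.card_filter_le _ _).trans (by simp)
  simp only [step2Search, wp_block_cons, wp_block_singleton, wp_const]
  -- Each vertex still to be treated may open one more component, which uses two names; therefore
  -- all names stay below `2 * n`.
  refine wp_forEach (s.lst vPlus 0) (fun l s' => SearchInvariant n l.length n s' ∧
    s'.lst stack 0 = [] ∧ ∀ v ∈ s.lst vPlus 0, v ∉ l → s'.num seen v ≠ 0) (by simp [hz])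
    (hr.length.trans hn) ?_ ?_ ?_
  · have hlen := hr.length
    refine ⟨⟨⟨?_, ?_, ?_⟩, ?_, ?_, ?_, ?_, ?_, ?_, ?_, ?_, ?_⟩, ?_, ?_⟩ <;>
      simp +contextual [hlive, hz, hseen, hrecov, hstack, hu]
    · omega
  · rintro a l s₁ f hsuf ⟨h₁, h₂, h₃⟩
    have ha : a ∈ s.lst vPlus 0 := hsuf.subset (by simp)
    have p₁ : s₁.lst posA = s.lst posA := by simpa using f.lst posA rfl
    have z₁ := h₁.zero
    have o₁ := h₁.one
    simp only [wp_block_cons, wp_block_singleton, wp_load, wp_ifEq, wp_skip]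
    constructor
    · intro hs
      have hs' : s₁.num seen a = 0 := by simpa [z₁] using hs
      simp only [wp_block_cons, wp_block_singleton, wp_copy, wp_succ, wp_store, wp_push, wp_const]
      have hvisit : ∀ s₂, s₂.lst posA = s.lst posA → SearchInvariant n l.length n s₂ →
          s₂.num seen a ≠ 0 → (∀ v ∈ s.lst vPlus 0, v ∉ a :: l → s₂.num seen v ≠ 0) →
          s₂.reg more ≠ 0 → s₂.lst stack 0 ≠ [] → wp L (whileNe more
              (block [pop cur stack zero,
                load x name cur, load opp bar x,
                forEach w posA cur
                  (block [load hit seen w,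
                    ifEq hit zero
                      (block [store seen w one, store name w opp, push recov opp w,
                        push stack zero w])
                      (block [load y name w, ifEq y x (const bad 1) skip])]),
                ifNil stack zero (const more 0) skip]))
            (fun s' => SearchInvariant n l.length n s' ∧
              s'.lst stack 0 = [] ∧ ∀ v ∈ s.lst vPlus 0, v ∉ l → s'.num seen v ≠ 0) s₂ := by
        intro s₂ p₂ i₂ a₂ v₂ m₂ st₂
        refine wp_whileNe (fun m s' => SearchInvariant n l.length m s' ∧
          (∀ v ∈ s.lst vPlus 0, v ∉ l → s'.num seen v ≠ 0) ∧
          (s'.reg more ≠ 0 → s'.lst stack 0 ≠ []) ∧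
          (s'.reg more = 0 → s'.lst stack 0 = [])) ?_ ?_ ?_ ?_
        · refine ⟨{ i₂ with stack_card := i₂.stack_card.trans hn }, fun v hv hvl => ?_,
            fun _ => st₂, fun h => absurd h m₂⟩
          by_cases hva : v = a
          · rwa [hva]
          · exact v₂ v hv (by simp [hva, hvl])
        · rintro s' ⟨i', -, h', -⟩
          by_contra hm
          have := i'.stack_card
          exact h' hm (List.length_eq_zero_iff.1 (by omega))
        · rintro m s₃ f₃ hm ⟨i₃, v₃, h', -⟩
          have p₃ : s₃.lst posA = s.lst posA := (f₃.lst posA rfl).trans p₂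
          have z₃ := i₃.zero
          rw [wp_block_cons, wp_pop, z₃]
          refine ⟨fun h => absurd h (h' hm), fun c t hc => ?_⟩
          simp only [wp_block_cons, wp_load]
          have cs : s₃.num seen c ≠ 0 := i₃.stack_seen c (by simp [hc])
          have xl : s₃.num name c ∈ s₃.lst live 0 := i₃.name_live c cs
          have ol : s₃.num bar (s₃.num name c) ∈ s₃.lst live 0 := i₃.mem _ xl
          have hcard := i₃.stack_card
          refine wp_forEach (s.lst posA c) (fun _ s' => SearchInvariant n l.length m s' ∧
            (∀ v, s₃.num seen v ≠ 0 → s'.num seen v ≠ 0)) (by simp [p₃])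
            (((hpos c).1).trans hM) ?_ ?_ ?_
          · refine ⟨⟨⟨?_, ?_, ?_⟩, ?_, ?_, ?_, ?_, ?_, ?_, ?_, ?_, ?_⟩, ?_⟩
            · simpa using i₃.mem
            · simpa using i₃.ne
            · simpa using i₃.bar_bar
            · simpa using z₃
            · simpa using i₃.one
            · simpa using i₃.live_nodup
            · simpa using i₃.live_lt
            · simpa using i₃.fresh_le
            · simpa using i₃.name_live
            · exact i₃.recov_sum
            · simpa using fun v hv => i₃.stack_seen v (by simp [hc, hv])
            · rw [hc, List.length_cons] at hcard
              simp
              change t.length + unseen n s₃ ≤ m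
              omega
            · simp
          · rintro b l' s₄ f₄ hsuf' ⟨i₄, v₄⟩
            have hb : b < n := (hpos c).2 b (hsuf'.subset (by simp))
            have opp₄ : s₄.reg opp = s₃.num bar (s₃.num name c) := by
              simpa using f₄.reg opp rfl
            have l₄ : s₄.lst live = s₃.lst live := by simpa using f₄.lst live rfl
            have z₄ := i₄.zero
            have o₄ := i₄.one
            simp only [wp_block_cons, wp_block_singleton, wp_load, wp_ifEq, wp_skip, wp_store,
              wp_push, wp_const]
            constructor
            · intro hs₄
              have hs₄' : s₄.num seen b = 0 := by simpa [z₄] using hs₄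
              have := i₄.visit hb hs₄' (o := s₄.reg opp) (by rw [opp₄, l₄]; exact ol)
              refine ⟨this.congr ?_ ?_ ?_ ?_ ?_, fun v hv => ?_⟩
              · simp
              · simp
              · simp
              · simp [Store.setLst, Store.setReg, Store.setNum, z₄]
              · simp [Store.setLst, Store.setReg, Store.setNum, o₄]
              · by_cases hvb : v = b
                · simp [hvb, o₄]
                · simpa [hvb] using v₄ v hv
            · intro _
              refine ⟨fun _ => ⟨i₄.congr ?_ ?_ ?_ ?_ ?_, v₄⟩,
                fun _ => ⟨i₄.congr ?_ ?_ ?_ ?_ ?_, v₄⟩⟩ <;> simp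
          · rintro s₄ f₄ ⟨i₄, v₄⟩
            have z₄ := i₄.zero
            have m₄ : s₄.reg more ≠ 0 := by
              rw [f₄.reg more rfl]
              simpa using hm
            simp only [wp_block_singleton, wp_ifNil, wp_const, wp_skip, z₄]
            refine ⟨fun hst => ⟨i₄.congr ?_ ?_ ?_ ?_ ?_, fun v hv hvl => v₄ v (v₃ v hv hvl), ?_, ?_⟩,
              fun hst => ⟨i₄, fun v hv hvl => v₄ v (v₃ v hv hvl), fun _ => hst,
                fun h => absurd h m₄⟩⟩ <;> simp [hst]
        · rintro m s₃ f₃ hm ⟨i₃, v₃, -, h'⟩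
          -- With an empty stack the budget of visits can be reset to `n` for the next component.
          exact ⟨{ i₃ with stack_card := by rw [h' hm]; simpa using hu s₃ }, h' hm, v₃⟩
      have hnp : ∀ s₂ : Store, s₂.reg zero = 0 → s₂.reg one = 1 →
          s₂.reg fresh = s₁.reg fresh + 2 →
          s₂.num bar = Function.update (Function.update (s₁.num bar) (s₁.reg fresh)
            (s₁.reg fresh + 1)) (s₁.reg fresh + 1) (s₁.reg fresh) →
          s₂.lst live 0 = (s₁.reg fresh + 1) :: s₁.reg fresh :: s₁.lst live 0 →
          s₂.num seen = s₁.num seen → s₂.num name = s₁.num name →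
          s₂.lst recov = s₁.lst recov → s₂.lst stack = s₁.lst stack →
          SearchInvariant n l.length n ((((s₂.setNum seen a 1).setNum name a
            (s₁.reg fresh)).setLst recov (s₁.reg fresh)
            (a :: s₂.lst recov (s₁.reg fresh))).setLst stack 0 (a :: s₂.lst stack 0)) :=
        fun s₂ e₀ e₁ e₂ e₃ e₄ e₅ e₆ e₇ e₈ =>
          (h₁.newPair e₀ e₁ e₂ e₃ e₄ e₅ e₆ e₇ e₈).visit (hr.lt a ha) (by rwa [e₅])
            (by simp [e₄])
      refine hvisit _ (by simp [p₁]) ?_ (by simp [o₁]) ?_ (by simp) (by simp [z₁])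
      -- The displayed state has the new pair of names but no visit of `a` yet. After the visit it
      -- agrees with the actual state in all lists, arrays and registers that the invariant
      -- mentions.
      · refine (hnp ((((((((((((s₁.setReg v a).setReg hit 0).setReg aName (s₁.reg fresh)).setReg
          fresh (s₁.reg fresh + 1)).setReg bName (s₁.reg fresh + 1)).setReg fresh
          (s₁.reg fresh + 2)).setNum bar (s₁.reg fresh) (s₁.reg fresh + 1)).setNum bar
          (s₁.reg fresh + 1) (s₁.reg fresh)).setLst live 0
          (s₁.reg fresh :: s₁.lst live 0)).setLst live 0
          ((s₁.reg fresh + 1) :: s₁.reg fresh :: s₁.lst live 0)).setReg hit 0).setReg hit 0)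
          ?_ ?_ ?_ ?_ ?_ ?_ ?_ ?_ ?_).congr ?_ ?_ ?_ ?_ ?_
        · simp [z₁]
        · simp [o₁]
        · simp
        · simp
        · simp
        · simp
        · simp
        · simp
        · simp
        · simp
        · simp
        · simp
        · simp [Store.setLst, Store.setReg, Store.setNum, z₁]
        · simp [Store.setLst, Store.setReg, Store.setNum, o₁]
      · intro v hv hvl
        have hva : v ≠ a := by rintro rfl; simp at hvl
        simpa [hva] using h₃ v hv hvl
    · intro hs
      have hs' : s₁.num seen a ≠ 0 := by simpa [z₁] using hs
      have hf := h₁.fresh_le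
      have h₁' : SearchInvariant n l.length n s₁ :=
        { h₁ with fresh_le := by simp only [List.length_cons] at hf; omega }
      refine ⟨h₁'.congr (by simp) (by simp) (by simp) rfl rfl, h₂, fun v hv hvl => ?_⟩
      by_cases hva : v = a
      · rw [hva]
        exact hs'
      · exact h₃ v hv (by simp [hva, hvl])
  · rintro s₁ - ⟨h₁, -, h₃⟩
    exact ⟨⟨n, h₁⟩, fun v hv => h₃ v hv (by simp)⟩

end Preparation


/-! ### Collapsing the components, and the time bound for MaxDef. -/

section Preparation

variable {L M n m : ℕ} {s : Store}

/-- All entries are names of seen vertices, hence live, and the test against `xb` keeps out edges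
between the two sides of a component. So the loop invariant holds with `N = 2 * n`. -/
theorem wp_step2Collapse (hr : IsReduced n M s) (hs : SearchInvariant n 0 m s)
    (hseen : ∀ v ∈ s.lst vPlus 0, s.num seen v ≠ 0) (hG : ∀ v, s.lst negG v = [])
    (hS : s.lst setS 0 = []) (hB : s.lst setB 0 = []) (hM : M ≤ L) (hn : 2 * n ≤ L) :
    wp L step2Collapse (Invariant (2 * n) n) s := by
  have hlt : ∀ v ∈ s.lst live 0, v < 2 * n := fun v hv => by
    have := hs.live_lt v hv
    have := hs.fresh_le
    omega
  refine wp_forEach (s.lst vPlus 0) (fun _ s' => ∀ x ∈ s.lst live 0, (s'.lst negG x).Nodup ∧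
    ∀ e ∈ s'.lst negG x, e ∈ s.lst live 0 ∧ e ≠ s.num bar x) (by rw [hs.zero])
    (by have := hr.length; omega) (by simp [hG]) ?_ ?_
  · intro a l s₁ f hsuf h₁
    have ha : a ∈ s.lst vPlus 0 := hsuf.subset (by simp)
    have hx := hs.name_live a (hseen a ha)
    have z₁ : s₁.reg zero = 0 := (f.reg zero rfl).trans hs.zero
    have n₁ : s₁.num = s.num := funext fun i => f.num i rfl
    have a₁ : s₁.lst negA = s.lst negA := f.lst negA rfl
    simp only [wp_block_cons, wp_block_singleton, wp_load]
    refine wp_forEach (s.lst negA a) (fun _ s' => ∀ x ∈ s.lst live 0, (s'.lst negG x).Nodup ∧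
      ∀ e ∈ s'.lst negG x, e ∈ s.lst live 0 ∧ e ≠ s.num bar x) (by simp [a₁])
      ((hr.neg_length a).trans hM) h₁ ?_ fun _ _ h => h
    intro b l' s₂ f₂ hsuf' h₂
    have hb : b ∈ s.lst vPlus 0 := hr.neg_mem a b (hsuf'.subset (by simp))
    have hy := hs.name_live b (hseen b hb)
    have x₂ : s₂.reg x = s.num name a := by simpa [n₁] using f₂.reg x rfl
    have xb₂ : s₂.reg xb = s.num bar (s.num name a) := by simpa [n₁] using f₂.reg xb rfl
    have z₂ : s₂.reg zero = 0 := by simpa [z₁] using f₂.reg zero rfl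
    have n₂ : s₂.num = s.num := by simpa [n₁] using funext fun i => f₂.num i rfl
    simp only [wp_block_cons, wp_block_singleton, wp_load, wp_ifEq, wp_skip]
    refine ⟨fun _ => h₂, fun hne => ?_⟩
    have hne' : s.num name b ≠ s.num bar (s.num name a) := by simpa [n₂, xb₂] using hne
    refine wp_add (by decide) (by decide) (by decide) (by decide) (by simp [z₂]) ?_ fun k h => ?_
    · simpa [x₂] using (length_le_of_nodup_of_lt (h₂ _ hx).1 fun e he =>
        hlt e ((h₂ _ hx).2 e he).1).trans hn
    · intro c hc
      by_cases hcx : c = s.num name a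
      · subst hcx
        simp [x₂, n₂]
        refine ⟨(h₂ _ hc).1.insert, ⟨hy, hne'⟩, (h₂ _ hc).2⟩
      · simpa [x₂, hcx] using h₂ c hc
  · intro s₁ f h₁
    have l₁ : s₁.lst live = s.lst live := f.lst live rfl
    have n₁ : s₁.num = s.num := funext fun i => f.num i rfl
    refine ⟨⟨(f.reg zero rfl).trans hs.zero, l₁ ▸ hs.live_nodup, l₁ ▸ hlt,
      fun v hv => (h₁ v (l₁ ▸ hv)).1, fun v hv e he => ?_, ?_, ?_, ?_, ?_, ?_⟩,
      hs.toMatched.congr (by rw [l₁]) (by rw [n₁]), fun v hv he => ?_⟩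
    · rw [l₁] at hv ⊢
      exact ((h₁ v hv).2 e he).1
    · rw [f.lst recov rfl]
      exact (Nat.le_add_right _ _).trans hs.recov_sum
    · simp [f.lst setB rfl, hB]
    · simp [f.lst setB rfl, hB]
    · rw [f.lst setS rfl, hS, l₁]
      simpa using length_le_of_nodup_of_lt hs.live_nodup hlt
    · simp [f.lst setS rfl, hS]
    · rw [n₁] at he
      exact ((h₁ v (l₁ ▸ hv)).2 _ he).2 rfl

theorem wp_maxDef (h : IsStart n M s) (hM : M ≤ L) (hn : 2 * n + 1 ≤ L) :
    wp L maxDef (fun _ => True) s := by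
  rw [maxDef, wp_block_cons]
  refine wp_conseq (wp_step1 h hM (by omega)) fun s₁ f₁ h₁ => ?_
  have z₁ : s₁.reg zero = 0 := (f₁.reg zero rfl).trans h.zero
  have p₁ : s₁.lst posA = s.lst posA := f₁.lst posA rfl
  rw [wp_block_cons]
  refine wp_conseq (wp_step2Search (M := M) (n := n) z₁ (by rw [f₁.num seen rfl]; exact h.num _)
    (by rw [p₁]; exact fun v => ⟨h.pos_length v, h.pos_lt v⟩)
    (by rw [f₁.lst stack rfl, h.stack_nil]) (by rw [f₁.lst live rfl, h.live_nil])
    (by rw [f₁.lst recov rfl]; exact h.recov_nil) h₁ hM (by omega)) ?_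
  rintro s₂ f₂ ⟨⟨m, h₂⟩, h₃⟩
  have v₂ : s₂.lst vPlus = s₁.lst vPlus := f₂.lst vPlus rfl
  have a₂ : s₂.lst negA = s₁.lst negA := f₂.lst negA rfl
  simp only [wp_block_cons, wp_block_singleton, wp_ifEq, wp_const, implies_true, and_true]
  intro _
  refine wp_conseq (wp_step2Collapse (M := M) (n := n) (m := m) ⟨v₂ ▸ h₁.length, v₂ ▸ h₁.lt,
    a₂ ▸ h₁.neg_length, a₂ ▸ v₂ ▸ h₁.neg_mem⟩ h₂ (v₂ ▸ h₃) ?_ ?_ ?_ hM (by omega))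
    fun s₃ f₃ h₄ => ?_
  · rw [f₂.lst negG rfl, f₁.lst negG rfl]
    exact h.negG_nil
  · rw [f₂.lst setS rfl, f₁.lst setS rfl]
    exact h.setS_nil
  · rw [f₂.lst setB rfl, f₁.lst setB rfl]
    exact h.setB_nil
  simp only [wp_block_cons, wp_block_singleton, wp_const]
  exact wp_mainLoop (N := 2 * n) (n := n) (h₄.congr rfl rfl (by simpa using h₄.zero)) (by omega)
    (by omega)

/-- The running time of MaxDef. -/
theorem exists_exec_maxDef_le : ∃ C : ℕ, ∀ (n M : ℕ) (s : Store), IsStart n M s →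
    ∃ s' t, Exec maxDef s s' t ∧ t ≤ C * (2 * n + M + 2) ^ 5 := by
  obtain ⟨C, hC⟩ := Cmd.exists_bound_le maxDef
  refine ⟨C, fun n M s h => ?_⟩
  -- Given adjacency lists have length at most `M`, and the main loop asks for `2 * n + 1`; the sum
  -- serves for all loops at once.
  obtain ⟨s', t, he, ht, -⟩ := Cmd.exec_of_wp
    (wp_maxDef (L := 2 * n + M + 1) h (by omega) (by omega))
  -- The exponent: `decide` computes that the loops of `maxDef` are nested at most five deep.
  exact ⟨s', t, he, ht.trans ((hC _).trans (Nat.mul_le_mul_left _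
    (Nat.pow_le_pow_right (by omega) (by decide))))⟩

end Preparation

end MaxDef

/-! ### Reading the two kinds of input. -/

theorem SignedGraph.IsEdgeList.adj_iff {V E : Type} {G : SignedGraph V E} {ε : ℤˣ}
    {l : List (V × V)} (h : G.IsEdgeList ε l) (a b : V) :
    G.Adj ε a b ↔ (a, b) ∈ l ∨ (b, a) ∈ l := by
  obtain ⟨es, -, hes, hl⟩ := h
  have : G.Adj ε a b ↔ s(a, b) ∈ es.map G.ends := by
    simp only [SignedGraph.Adj, List.mem_map, hes]
    exact exists_congr fun e => and_comm
  rw [this, ← hl, List.mem_map]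
  constructor
  · rintro ⟨⟨c, d⟩, hp, he⟩
    rcases Sym2.eq_iff.1 he with ⟨rfl, rfl⟩ | ⟨rfl, rfl⟩
    exacts [Or.inl hp, Or.inr hp]
  · rintro (h | h)
    exacts [⟨_, h, rfl⟩, ⟨_, h, Sym2.eq_swap⟩]

theorem SignedGraph.IsEdgeList.length_le {V E : Type} [Fintype E] {G : SignedGraph V E} {ε : ℤˣ}
    {l : List (V × V)} (h : G.IsEdgeList ε l) : l.length ≤ Fintype.card E := by
  obtain ⟨es, hnd, -, hl⟩ := h
  have : l.length = es.length := by simpa using congrArg List.length hl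
  exact this ▸ hnd.length_le_card

theorem IsVertexList.length_eq {n : ℕ} {vs : List (Fin n)} (h : IsVertexList vs) :
    vs.length = n := by
  refine le_antisymm (by simpa using h.1.length_le_card) ?_
  have := ((List.nodup_finRange n).subperm (l₂ := vs) fun v _ => h.2 v).length_le
  simpa using this

namespace MaxDef

open Cmd

/-- The adjacency lists have no repetitions, so `M = n`; this makes the bound in (a) independent of
the number of edges. -/
theorem isStart_adjacencyInput {n : ℕ} {E : Type} {G : SignedGraph (Fin n) E} {vs : List (Fin n)}
    {pos neg : Fin n → List (Fin n)} (hvs : IsVertexList vs) (hpos : G.IsAdjacencyArray 1 pos)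
    (hneg : G.IsAdjacencyArray (-1) neg) : IsStart n n (adjacencyInput vs pos neg) := by
  refine ⟨rfl, fun _ _ => rfl, ?_, fun v => ?_, fun v => ?_, fun v w hw => ?_, fun v => ?_,
    fun v w hw => ?_, fun v hv => ?_, ?_, ?_, ?_, fun v => ?_, ?_, ?_, fun v => ?_⟩ <;>
  try simp only [adjacencyInput]
  · simp [hvs.length_eq]
  · simp only [if_true, List.mem_map]
    exact ⟨fun ⟨a, _, ha⟩ => ha ▸ a.2, fun hv => ⟨⟨v, hv⟩, hvs.2 _, rfl⟩⟩
  · by_cases hv : v < n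
    · simpa [hv] using (hpos ⟨v, hv⟩).1.length_le_card
    · simp [hv]
  · by_cases hv : v < n
    · simp [adjacencyInput, hv] at hw
      obtain ⟨a, -, rfl⟩ := hw
      exact a.2
    · simp [adjacencyInput, hv] at hw
  · by_cases hv : v < n
    · simpa [hv] using (hneg ⟨v, hv⟩).1.length_le_card
    · simp [hv]
  · by_cases hv : v < n
    · simp [adjacencyInput, hv] at hw
      obtain ⟨a, -, rfl⟩ := hw
      exact a.2
    · simp [adjacencyInput, hv] at hw
  · simp [hv]
  all_goals simp [input, posA, negA, vPlus, stack, live, negG, setS, setB, recov]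

/-- The entries of a list of pairs, one after the other. -/
def flatten (l : List (ℕ × ℕ)) : List ℕ :=
  l.flatMap fun p => [p.1, p.2]

/-- An edge is entered in the lists of both its ends, a loop only once, so no list gets more than
one entry per edge. Parallel edges may cause repetitions; hence only lengths and membership are
recorded. -/
theorem wp_readEdges {L a j : ℕ} {s : Store} {l : List (ℕ × ℕ)} (ha : a ≠ input)
    (hj : s.reg idx = j) (hl : s.lst input j = flatten l) (h₀ : ∀ v, s.lst a v = [])
    (hL : l.length + 1 ≤ L) :
    wp L (readEdges a) (fun s' => (∀ v, (s'.lst a v).length ≤ l.length ∧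
      ∀ w, w ∈ s'.lst a v ↔ (v, w) ∈ l ∨ (w, v) ∈ l) ∧
      ∀ i, i ≠ j → s'.lst input i = s.lst input i) s := by
  rw [readEdges, wp_block_cons, wp_const, wp_block_singleton]
  -- Here `r` holds the edges not yet read. The extra 1 is the round that finds the list empty and
  -- resets `more`.
  refine wp_whileNe (fun m s' => ∃ r, s'.lst input j = flatten r ∧
    (s'.reg more = 0 → r = []) ∧ (s'.reg more ≠ 0 → r.length + 1 ≤ m) ∧
    (∀ v, (s'.lst a v).length + r.length ≤ l.length ∧
      ∀ w, (w ∈ s'.lst a v ∨ (v, w) ∈ r ∨ (w, v) ∈ r) ↔ (v, w) ∈ l ∨ (w, v) ∈ l) ∧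
    ∀ i, i ≠ j → s'.lst input i = s.lst input i) ?_ ?_ ?_ ?_
  · exact ⟨l, hl, by simp, fun _ => hL, by simp [h₀], fun _ _ => rfl⟩
  · rintro s' ⟨r, -, -, h, -⟩
    by_contra hm
    have := h hm
    omega
  · rintro m s' f hm ⟨r, hr, -, h₁, h₂, h₃⟩
    replace h₁ := h₁ hm
    have j' : s'.reg idx = j := by simpa [hj] using f.reg idx rfl
    simp only [wp_ifNil, wp_const, wp_block_cons, wp_pop, j']
    rcases r with _ | ⟨⟨p, q⟩, r⟩
    · refine ⟨fun _ => ⟨[], by simpa using hr, by simp, by simp, h₂, h₃⟩, fun h => absurd hr h⟩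
    · have hr' : s'.lst input j = p :: q :: flatten r := hr
      refine ⟨fun h => by simp [hr'] at h, fun _ => ⟨fun h => by simp [hr'] at h, ?_⟩⟩
      intro n₁ l₁ hl₁
      rw [hr'] at hl₁
      obtain ⟨rfl, rfl⟩ := List.cons.inj hl₁
      constructor
      · intro h
        simp [j'] at h
      intro n₂ l₂ hl₂
      have hl₂' : q :: flatten r = n₂ :: l₂ := by simpa [j'] using hl₂
      obtain ⟨rfl, rfl⟩ := List.cons.inj hl₂'
      have hmore : ∀ s'' : Store, s''.reg more = s'.reg more → s''.reg more ≠ 0 :=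
        fun s'' h => h ▸ hm
      simp only [List.length_cons] at h₁ h₂
      simp only [wp_block_singleton, wp_ifEq, wp_push, wp_skip]
      constructor
      · intro hpq
        have hpq' : p = q := by simpa using hpq
        subst hpq'
        refine ⟨r, by simp [j', ha.symm], fun h => absurd h (by simpa using hm),
          fun _ => by omega, fun v => ?_, fun i hi => by simp [j', ha.symm, hi, h₃]⟩
        have h₂v := h₂ v
        by_cases hv : v = p
        · subst hv
          simp [j', ha]
          refine ⟨by omega, fun w => ?_⟩
          rw [← h₂v.2 w]
          simp only [List.mem_cons, Prod.mk.injEq, true_and, and_true]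
          tauto
        · simp [j', ha, hv]
          refine ⟨by omega, fun w => ?_⟩
          rw [← h₂v.2 w]
          simp only [List.mem_cons, Prod.mk.injEq, hv, false_and, and_false, false_or]
      · intro hpq
        have hpq' : p ≠ q := by simpa using hpq
        refine ⟨r, by simp [j', ha.symm], fun h => absurd h (by simpa using hm),
          fun _ => by omega, fun v => ?_, fun i hi => by simp [j', ha.symm, hi, h₃]⟩
        have h₂v := h₂ v
        by_cases hv : v = p
        · subst hv
          simp [j', ha, hpq']
          refine ⟨by omega, fun w => ?_⟩
          rw [← h₂v.2 w]
          simp only [List.mem_cons, Prod.mk.injEq, true_and, hpq', and_false, false_or]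
          tauto
        · by_cases hv' : v = q
          · subst hv'
            simp [j', ha, hpq'.symm]
            refine ⟨by omega, fun w => ?_⟩
            rw [← h₂v.2 w]
            simp only [List.mem_cons, Prod.mk.injEq, and_true, hpq'.symm, false_and, false_or]
            tauto
          · simp [j', ha, hv, hv']
            refine ⟨by omega, fun w => ?_⟩
            rw [← h₂v.2 w]
            simp only [List.mem_cons, Prod.mk.injEq, hv, hv', false_and, and_false, false_or]
  · rintro m s' - hm ⟨r, -, h₁, -, h₂, h₃⟩
    obtain rfl := h₁ hm
    exact ⟨by simpa using h₂, h₃⟩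

/-- The adjacency arrays of `G` are stored. -/
structure IsLoaded {n : ℕ} {E : Type} (G : SignedGraph (Fin n) E) (s : Store) : Prop where
  pos : ∀ v w, w ∈ s.lst posA v ↔ ∃ a b : Fin n, a.val = v ∧ b.val = w ∧ G.Adj 1 a b
  neg : ∀ v w, w ∈ s.lst negA v ↔ ∃ a b : Fin n, a.val = v ∧ b.val = w ∧ G.Adj (-1) a b

/-- Stated for an arbitrary continuation `c`, because both MaxDef and the decision procedure start
by reading edge lists. -/
theorem wp_load_graph {L n : ℕ} {E : Type} {G : SignedGraph (Fin n) E} {vs : List (Fin n)}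
    {pos neg : List (Fin n × Fin n)} (hvs : IsVertexList vs) (hpos : G.IsEdgeList 1 pos)
    (hneg : G.IsEdgeList (-1) neg) {c : Cmd} {Q : Store → Prop}
    (hL : pos.length + neg.length + 1 ≤ L)
    (hc : ∀ s, IsStart n (pos.length + neg.length) s → IsLoaded G s → wp L c Q s) :
    wp L (block [const idx 1, readEdges posA, const idx 2, readEdges negA, c]) Q
      (Store.ofInput (graphInput vs pos neg)) := by
  have hflat : ∀ l : List (Fin n × Fin n), (l.flatMap fun p => [p.1.val, p.2.val]) =
      flatten (l.map fun p => (p.1.val, p.2.val)) := fun l => by simp [flatten, List.flatMap_map]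
  have hadj : ∀ {ε : ℤˣ} {l : List (Fin n × Fin n)}, G.IsEdgeList ε l → ∀ v w,
      ((v, w) ∈ l.map (fun p => (p.1.val, p.2.val)) ∨
        (w, v) ∈ l.map (fun p => (p.1.val, p.2.val))) ↔
      ∃ a b : Fin n, a.val = v ∧ b.val = w ∧ G.Adj ε a b := by
    intro ε l hl v w
    simp only [hl.adj_iff, List.mem_map, Prod.mk.injEq, Prod.exists]
    constructor
    · rintro (⟨a, b, h, ha, hb⟩ | ⟨a, b, h, ha, hb⟩)
      exacts [⟨a, b, ha, hb, Or.inl h⟩, ⟨b, a, hb, ha, Or.inr h⟩]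
    · rintro ⟨a, b, ha, hb, h | h⟩
      exacts [Or.inl ⟨a, b, h, ha, hb⟩, Or.inr ⟨b, a, h, hb, ha⟩]
  generalize hs : Store.ofInput (graphInput vs pos neg) = s
  have i₀ : s.lst input 0 = vs.map Fin.val := by subst hs; rfl
  have i₁ : s.lst input 1 = flatten (pos.map fun p => (p.1.val, p.2.val)) := by
    subst hs; exact hflat pos
  have i₂ : s.lst input 2 = flatten (neg.map fun p => (p.1.val, p.2.val)) := by
    subst hs; exact hflat neg
  have l₀ : ∀ a, a ≠ input → ∀ v, s.lst a v = [] := by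
    intro a ha v
    subst hs
    simp [Store.ofInput, ha]
  have r₀ : ∀ r, s.reg r = 0 := by subst hs; exact fun _ => rfl
  have n₀ : ∀ a v, s.num a v = 0 := by subst hs; exact fun _ _ => rfl
  clear hs hflat
  rw [wp_block_cons, wp_const, wp_block_cons]
  refine wp_conseq (wp_readEdges (j := 1) (by decide) (by simp) i₁ (l₀ posA (by decide))
    (by simp; omega)) ?_
  rintro s₁ f₁ ⟨h₁, h₁'⟩
  rw [wp_block_cons, wp_const, wp_block_cons]
  refine wp_conseq (wp_readEdges (j := 2) (l := neg.map fun p => (p.1.val, p.2.val)) (by decide)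
    (by simp) (by simpa [h₁'] using i₂) ?_ (by simp; omega)) ?_
  · simpa [f₁.lst negA rfl] using l₀ negA (by decide)
  rintro s₂ f₂ ⟨h₂, h₂'⟩
  rw [wp_block_singleton]
  have p₂ : s₂.lst posA = s₁.lst posA := f₂.lst posA rfl
  have i₂ : s₂.lst input 0 = vs.map Fin.val := by
    rw [h₂' 0 (by decide), Store.lst_setReg, h₁' 0 (by decide), Store.lst_setReg, i₀]
  have e₂ : ∀ a, (a == negA) = false → (a == posA) = false → a ≠ input → ∀ v, s₂.lst a v = [] := by
    intro a ha ha' hi v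
    rw [f₂.lst a, Store.lst_setReg, f₁.lst a, Store.lst_setReg, l₀ a hi]
    · simpa [readEdges, block, writesLst, hi] using ha'
    · simpa [readEdges, block, writesLst, hi] using ha
  have hP : ∀ v w, w ∈ s₂.lst posA v ↔ ∃ a b : Fin n, a.val = v ∧ b.val = w ∧ G.Adj 1 a b := by
    intro v w
    rw [p₂, (h₁ v).2, hadj hpos]
  have hN : ∀ v w, w ∈ s₂.lst negA v ↔ ∃ a b : Fin n, a.val = v ∧ b.val = w ∧ G.Adj (-1) a b := by
    intro v w
    rw [(h₂ v).2, hadj hneg]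
  refine hc s₂ ⟨?_, fun a v => ?_, ?_, fun v => ?_, fun v => ?_, fun v w hw => ?_, fun v => ?_,
    fun v w hw => ?_, fun v hv => ?_, ?_, ?_, ?_, fun v => ?_, ?_, ?_, fun v => ?_⟩ ⟨hP, hN⟩
  · rw [f₂.reg zero rfl]
    simp [f₁.reg zero rfl, r₀]
  · rw [f₂.num a rfl, Store.num_setReg, f₁.num a rfl, Store.num_setReg, n₀]
  · rw [i₂, List.length_map, hvs.length_eq]
  · rw [i₂, List.mem_map]
    exact ⟨fun ⟨a, _, ha⟩ => ha ▸ a.2, fun hv => ⟨⟨v, hv⟩, hvs.2 _, rfl⟩⟩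
  · have := (h₁ v).1
    rw [List.length_map] at this
    rw [p₂]
    omega
  · obtain ⟨a, b, -, rfl, -⟩ := (hP v w).1 hw
    exact b.2
  · have := (h₂ v).1
    rw [List.length_map] at this
    omega
  · obtain ⟨a, b, -, rfl, -⟩ := (hN v w).1 hw
    exact b.2
  · refine List.eq_nil_iff_forall_not_mem.2 fun w hw => ?_
    obtain ⟨a, b, rfl, -, -⟩ := (hN v w).1 hw
    exact absurd a.2 (by omega)
  all_goals exact e₂ _ rfl rfl (by decide) _

end MaxDef

/-! ### The time bounds for MaxDef. -/

/-- Without vertices the empty color set suffices. Positivity of `n` is what lets additive constants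
be absorbed into `n ^ 5`. -/
theorem SignedGraph.pos_of_chromaticNumber {n : ℕ} {E : Type} {G : SignedGraph (Fin n) E}
    (h : G.chromaticNumber ≠ 0) : 0 < n := by
  by_contra hn
  obtain rfl : n = 0 := by omega
  refine h (Nat.sInf_eq_zero.2 (Or.inl ⟨fun _ => 0, fun e a => a.elim0, fun v => v.elim0⟩))

theorem exists_maxDef_le : ∃ C : ℕ, ∀ (n : ℕ) (E : Type) (G : SignedGraph (Fin n) E),
    G.NoMultipleSameSign → G.chromaticNumber = 3 →
    ∀ (vs : List (Fin n)) (pos neg : Fin n → List (Fin n)),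
      IsVertexList vs → G.IsAdjacencyArray 1 pos → G.IsAdjacencyArray (-1) neg →
      ∃ s t, Exec MaxDef.maxDef (MaxDef.adjacencyInput vs pos neg) s t ∧ t ≤ C * n ^ 5 := by
  obtain ⟨C, hC⟩ := MaxDef.exists_exec_maxDef_le
  -- With `M = n` the base is `3 * n + 2`, at most `5 * n` for positive `n`.
  refine ⟨C * 5 ^ 5, fun n E G _ hG vs pos neg hvs hpos hneg => ?_⟩
  have hn : 0 < n := G.pos_of_chromaticNumber (by omega)
  obtain ⟨s, t, h, ht⟩ := hC n n _ (MaxDef.isStart_adjacencyInput hvs hpos hneg)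
  refine ⟨s, t, h, ht.trans ?_⟩
  rw [mul_assoc, ← mul_pow]
  exact Nat.mul_le_mul_left _ (Nat.pow_le_pow_left (by omega) _)

theorem exists_maxDefOfLists_le : ∃ p : Polynomial ℕ, ∀ (n : ℕ) (E : Type) [Fintype E]
    (G : SignedGraph (Fin n) E), G.NoMultipleSameSign → G.chromaticNumber = 3 →
      ∀ w : List (List ℕ), Encodes w G →
        ∃ s t, Exec MaxDef.maxDefOfLists (Store.ofInput w) s t ∧
          t ≤ p.eval (n + Fintype.card E) := by
  obtain ⟨C, hC⟩ := Cmd.exists_bound_le MaxDef.maxDefOfLists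
  -- `2 * X + 2` is `L + 1` for `L = 2 * (n + |E|) + 1`; each of the two edge lists has at most
  -- `|E|` entries.
  refine ⟨.C C * (2 * .X + 2) ^ MaxDef.maxDefOfLists.depth, fun n E _ G _ _ w hw => ?_⟩
  obtain ⟨vs, pos, neg, hvs, hpos, hneg, rfl⟩ := hw
  have h₁ := hpos.length_le
  have h₂ := hneg.length_le
  obtain ⟨s, t, he, ht, -⟩ := Cmd.exec_of_wp (MaxDef.wp_load_graph
    (L := 2 * (n + Fintype.card E) + 1) (c := MaxDef.maxDef) (Q := fun _ => True) hvs hpos hneg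
    (by omega) fun s h _ => MaxDef.wp_maxDef h (by omega) (by omega))
  refine ⟨s, t, he, ht.trans ((hC _).trans (le_of_eq ?_))⟩
  simp [add_assoc]

/-! ## Deciding whether the maximum deficiency is one -/

/-! ### Satisfiability of implications between literals. -/

section TwoSat

/-- The negation of a literal; the literals of a variable `v` are `(true, v)` and `(false, v)`. -/
def Literal.not {V : Type*} (p : Bool × V) : Bool × V := (!p.1, p.2)

open Relation in
/-- A system of implications between literals that contains all contrapositives has a solution
unless some literal and its negation imply each other. -/
theorem exists_closed_of_forall_not_reflTransGen {r : Bool × ℕ → Bool × ℕ → Prop}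
    (hr : ∀ p q, r p q → r (Literal.not q) (Literal.not p)) (n : ℕ)
    (h : ∀ v < n, ¬(ReflTransGen r (true, v) (false, v) ∧ ReflTransGen r (false, v) (true, v))) :
    ∃ T : Set (Bool × ℕ), (∀ p ∈ T, ∀ q, r p q → q ∈ T) ∧ (∀ p ∈ T, Literal.not p ∉ T) ∧
      ∀ v < n, (true, v) ∈ T ∨ (false, v) ∈ T := by
  have nn : ∀ p : Bool × ℕ, Literal.not (Literal.not p) = p := fun p => by simp [Literal.not]
  have contra : ∀ p q, ReflTransGen r p q → ReflTransGen r (Literal.not q) (Literal.not p) := by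
    intro p q hpq
    induction hpq with
    | refl => exact .refl
    | tail _ hbc ih => exact ih.head (hr _ _ hbc)
  induction n with
  | zero => exact ⟨∅, by simp⟩
  | succ n ih =>
    obtain ⟨T, hT₁, hT₂, hT₃⟩ := ih fun v hv => h v (by omega)
    have hT₁' : ∀ p ∈ T, ∀ q, ReflTransGen r p q → q ∈ T := by
      intro p hp q hpq
      induction hpq with
      | refl => exact hp
      | tail _ hbc ih => exact hT₁ _ ih _ hbc
    by_cases hn : (true, n) ∈ T ∨ (false, n) ∈ T
    · refine ⟨T, hT₁, hT₂, fun v hv => ?_⟩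
      rcases Nat.lt_succ_iff_lt_or_eq.1 hv with hv | rfl
      exacts [hT₃ v hv, hn]
    -- The variable `n` is undecided, and one of its literals does not imply its negation; that
    -- literal and all its consequences are added to `T`.
    · obtain ⟨b, hb⟩ : ∃ b, ¬ReflTransGen r (b, n) (!b, n) := by
        by_contra! hb
        exact h n (Nat.lt_succ_self n) ⟨hb true, hb false⟩
      have hbn : Literal.not (b, n) ∉ T := by
        push Not at hn
        cases b
        exacts [hn.1, hn.2]
      -- Consistency by contraposition: if the negation of a literal of `T` follows from `(b, n)`,
      -- then the negation of `(b, n)` lies in `T`; if a literal and its negation both follow from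
      -- `(b, n)`, then `(b, n)` implies its own negation.
      refine ⟨T ∪ {q | ReflTransGen r (b, n) q}, ?_, ?_, ?_⟩
      · rintro p (hp | hp) q hpq
        exacts [Or.inl (hT₁ p hp q hpq), Or.inr (hp.tail hpq)]
      · rintro p (hp | hp) (hp' | hp')
        · exact hT₂ p hp hp'
        · have := contra _ _ hp'
          rw [nn] at this
          exact hbn (hT₁' p hp _ this)
        · have := contra _ _ hp
          exact hbn (hT₁' _ hp' _ this)
        · have := contra _ _ hp'
          rw [nn] at this
          exact hb (hp.trans this)
      · intro v hv
        rcases Nat.lt_succ_iff_lt_or_eq.1 hv with hv | rfl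
        · exact (hT₃ v hv).imp Or.inl Or.inl
        · cases b
          exacts [Or.inr (Or.inr .refl), Or.inl (Or.inr .refl)]

end TwoSat

/-! ### Computing the consequences of a literal. -/

namespace MaxDefDecision

open Cmd MaxDef

/-- The vertices known to be in the cover `S`. -/
abbrev inS : ℕ := 4
/-- The vertices known to be outside the cover `S`. -/
abbrev outS : ℕ := 5

/-- Draw the consequences from what is known about the vertex `u`. -/
def propagate : Cmd :=
  block [load x inS u, load y outS u,
    forEach w posA u (block [ifEq x zero skip (store outS w one),
      ifEq y zero skip (store inS w one)]),
    forEach w negA u (ifEq x zero skip (store outS w one))]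

/-- Draw the consequences from what is known about all vertices. -/
def round : Cmd :=
  forEach u input zero propagate

/-- Draw all consequences. -/
def saturate : Cmd :=
  forEach z input zero (block [round, round])

/-- Put the vertex `v` into the first set, and let `r` be nonzero if this puts it into the second
set. -/
def test (a b r : ℕ) : Cmd :=
  block [forEach u input zero (block [store inS u zero, store outS u zero]),
    store a v one, saturate, load r b v]

/-- The answer is `yes` if no vertex is contradictory, otherwise `no`. -/
def decision (yes no : ℕ) : Cmd :=
  block [const one 1, const ans yes,
    forEach v input zero
      (block [test inS outS flag, test outS inS hit,
        ifEq flag zero skip (ifEq hit zero skip (const ans no))])]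

/-- The literal `p` is known to hold. -/
def Marked (s : Store) (p : Bool × ℕ) : Prop :=
  s.num (bif p.1 then inS else outS) p.2 ≠ 0

theorem marked_setNum_outS {s : Store} {p : Bool × ℕ} (a : ℕ) :
    Marked (s.setNum outS a 1) p ↔ p = (false, a) ∨ Marked s p := by
  rcases p with ⟨_ | _, b⟩
  · by_cases h : b = a <;> simp [Marked, h]
  · simp [Marked]

theorem marked_setNum_inS {s : Store} {p : Bool × ℕ} (a : ℕ) :
    Marked (s.setNum inS a 1) p ↔ p = (true, a) ∨ Marked s p := by
  rcases p with ⟨_ | _, b⟩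
  · simp [Marked]
  · by_cases h : b = a <;> simp [Marked, h]

/-- The implications between literals that come from the edges: the ends of a positive edge are on
different sides of `S`, and those of a negative edge are not both in `S`. -/
def Implies (s : Store) (p q : Bool × ℕ) : Prop :=
  (q.2 ∈ s.lst posA p.2 ∧ q.1 = !p.1) ∨ (q.2 ∈ s.lst negA p.2 ∧ p.1 = true ∧ q.1 = false)

/-- The literals in `R` have no consequences outside of `R`. -/
def Closed (s : Store) (R : Set (Bool × ℕ)) : Prop :=
  ∀ p ∈ R, ∀ q, Implies s p q → q ∈ R

/-- A vertex list and adjacency lists of a graph on `{0, …, n - 1}`. -/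
structure IsInstance (n L : ℕ) (s : Store) : Prop where
  input_length : (s.lst input 0).length ≤ L
  input_length_eq : (s.lst input 0).length = n
  mem_input : ∀ v, v ∈ s.lst input 0 ↔ v < n
  pos_length : ∀ v, (s.lst posA v).length ≤ L
  neg_length : ∀ v, (s.lst negA v).length ≤ L
  pos_lt : ∀ v, ∀ w ∈ s.lst posA v, v < n ∧ w < n
  neg_lt : ∀ v, ∀ w ∈ s.lst negA v, v < n ∧ w < n

/-- The state `s'` is reached from `s` by drawing conclusions. -/
structure Extends (s₀ s s' : Store) : Prop where
  mono : ∀ p, Marked s p → Marked s' p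
  sound : ∀ R, Closed s₀ R → (∀ p, Marked s p → p ∈ R) → ∀ p, Marked s' p → p ∈ R

theorem Extends.trans {s₀ s₁ s₂ s₃ : Store} (h : Extends s₀ s₁ s₂) (h' : Extends s₀ s₂ s₃) :
    Extends s₀ s₁ s₃ :=
  ⟨fun p hp => h'.mono p (h.mono p hp), fun R hR hs => h'.sound R hR (h.sound R hR hs)⟩

theorem Extends.refl (s₀ s : Store) : Extends s₀ s s :=
  ⟨fun _ hp => hp, fun _ _ hs => hs⟩

theorem Extends.congr {s₀ s s₁ s₂ : Store} (h : Extends s₀ s s₁) (hn : s₂.num = s₁.num) :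
    Extends s₀ s s₂ := by
  have : ∀ p, Marked s₂ p ↔ Marked s₁ p := fun p => by unfold Marked; rw [hn]
  exact ⟨fun p hp => (this p).2 (h.mono p hp),
    fun R hR hs p hp => h.sound R hR hs p ((this p).1 hp)⟩

theorem Extends.mark {s₀ s s₁ s₂ : Store} {p q : Bool × ℕ} (h : Extends s₀ s s₁)
    (h₂ : ∀ e, Marked s₂ e ↔ e = q ∨ Marked s₁ e) (hp : Marked s p) (hpq : Implies s₀ p q) :
    Extends s₀ s s₂ := by
  refine ⟨fun e he => (h₂ e).2 (Or.inr (h.mono e he)), fun R hR hs e he => ?_⟩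
  rcases (h₂ e).1 he with rfl | he
  exacts [hR p (hs p hp) _ hpq, h.sound R hR hs e he]

variable {n L a : ℕ} {s₀ s : Store}

/-- The marks of `a` are read once, before the loops. So the conclusions are those from the marks in
the initial state `s`, even if `a` has a loop and its own marks change on the way. -/
theorem wp_propagate (h₀ : IsInstance n L s₀) (hz : s.reg zero = 0) (ho : s.reg one = 1)
    (hl : s.lst = s₀.lst) (hu : s.reg u = a) :
    wp L propagate (fun s' => Extends s₀ s s' ∧
      ∀ p q, p.2 = a → Marked s p → Implies s₀ p q → Marked s' q) s := by
  simp only [propagate, wp_block_cons, wp_load]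
  refine wp_forEach (s₀.lst posA a) (fun l s' => Extends s₀ s s' ∧ ∀ b ∈ s₀.lst posA a, b ∉ l →
    ∀ c, Marked s (c, a) → Marked s' (!c, b)) (by simp [hl, hu]) (h₀.pos_length a)
    ⟨⟨fun _ h => h, fun _ _ h => h⟩, fun b hb hbl => absurd hb hbl⟩ ?_ ?_
  · rintro b l s₁ f hsuf ⟨h₁, h₂⟩
    have hb : b ∈ s₀.lst posA a := hsuf.subset (by simp)
    have z₁ : s₁.reg zero = 0 := by simpa [hz] using f.reg zero rfl
    have o₁ : s₁.reg one = 1 := by simpa [ho] using f.reg one rfl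
    have x₁ : s₁.reg x = s.num inS a := by simpa [hu] using f.reg x rfl
    have y₁ : s₁.reg y = s.num outS a := by simpa [hu] using f.reg y rfl
    have key : ∀ s₂ : Store, Extends s₀ s s₂ → (∀ p, Marked s₁ p → Marked s₂ p) →
        (∀ c, Marked s (c, a) → Marked s₂ (!c, b)) →
        Extends s₀ s s₂ ∧
          ∀ b ∈ s₀.lst posA a, b ∉ l → ∀ c, Marked s (c, a) → Marked s₂ (!c, b) := by
      refine fun s₂ h₃ h₄ h₅ => ⟨h₃, fun d hd hdl c hc => ?_⟩
      by_cases hdb : d = b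
      · rw [hdb]
        exact h₅ c hc
      · exact h₄ _ (h₂ d hd (by simp [hdb, hdl]) c hc)
    have i₁ : Implies s₀ (true, a) (false, b) := Or.inl ⟨hb, rfl⟩
    have i₂ : Implies s₀ (false, a) (true, b) := Or.inl ⟨hb, rfl⟩
    simp only [wp_block_cons, wp_block_singleton, wp_ifEq, wp_skip, wp_store]
    have h₁' : Extends s₀ s (s₁.setReg w b) := h₁.congr rfl
    constructor <;> intro hx <;> simp [x₁, z₁] at hx <;> constructor <;> intro hy <;>
      simp [y₁, z₁] at hy
    · refine key _ h₁' (fun p hp => hp) fun c hc => ?_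
      cases c <;> simp [Marked, hx, hy] at hc
    · have : ∀ e, Marked (((s₁.setReg w b).setNum inS b 1)) e ↔ e = (true, b) ∨ Marked s₁ e :=
        fun e => marked_setNum_inS b
      rw [show (s₁.setReg w b).reg w = b by simp, show (s₁.setReg w b).reg one = 1 by simp [o₁]]
      refine key _ (h₁.mark (p := (false, a)) this hy i₂)
        (fun p hp => (this p).2 (Or.inr hp)) fun c hc => ?_
      cases c
      · exact (this _).2 (Or.inl rfl)
      · simp [Marked, hx] at hc
    · have : ∀ e, Marked (((s₁.setReg w b).setNum outS b 1)) e ↔ e = (false, b) ∨ Marked s₁ e :=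
        fun e => marked_setNum_outS b
      rw [show (s₁.setReg w b).reg w = b by simp, show (s₁.setReg w b).reg one = 1 by simp [o₁]]
      refine key _ (h₁.mark (p := (true, a)) this hx i₁)
        (fun p hp => (this p).2 (Or.inr hp)) fun c hc => ?_
      cases c
      · simp [Marked, hy] at hc
      · exact (this _).2 (Or.inl rfl)
    · have h₃ : ∀ e, Marked (((s₁.setReg w b).setNum outS b 1)) e ↔ e = (false, b) ∨ Marked s₁ e :=
        fun e => marked_setNum_outS b
      have h₄ : ∀ e, Marked (((s₁.setReg w b).setNum outS b 1).setNum inS b 1) e ↔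
          e = (true, b) ∨ Marked ((s₁.setReg w b).setNum outS b 1) e := fun e => marked_setNum_inS b
      simp only [Store.reg_setNum]
      rw [show (s₁.setReg w b).reg w = b by simp, show (s₁.setReg w b).reg one = 1 by simp [o₁]]
      refine key _ ((h₁.mark (p := (true, a)) h₃ hx i₁).mark (p := (false, a)) h₄ hy i₂)
        (fun p hp => (h₄ p).2 (Or.inr ((h₃ p).2 (Or.inr hp)))) fun c hc => ?_
      cases c
      · exact (h₄ _).2 (Or.inl rfl)
      · exact (h₄ _).2 (Or.inr ((h₃ _).2 (Or.inl rfl)))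
  rintro s₁ f₁ ⟨h₁, h₂⟩
  have u₁ : s₁.reg u = a := by simpa [hu] using f₁.reg u rfl
  have l₁ : s₁.lst = s₀.lst := by simpa [hl] using funext fun i => f₁.lst i rfl
  have z₁ : s₁.reg zero = 0 := by simpa [hz] using f₁.reg zero rfl
  have o₁ : s₁.reg one = 1 := by simpa [ho] using f₁.reg one rfl
  have x₁ : s₁.reg x = s.num inS a := by simpa [hu] using f₁.reg x rfl
  rw [wp_block_singleton]
  refine wp_forEach (s₀.lst negA a) (fun l s' => Extends s₀ s s' ∧ (∀ p, Marked s₁ p → Marked s' p) ∧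
    ∀ b ∈ s₀.lst negA a, b ∉ l → Marked s (true, a) → Marked s' (false, b)) (by rw [l₁, u₁])
    (h₀.neg_length a) ⟨h₁, fun p hp => hp, fun b hb hbl => absurd hb hbl⟩ ?_ ?_
  · rintro b l s₂ f hsuf ⟨h₃, h₄, h₅⟩
    have hb : b ∈ s₀.lst negA a := hsuf.subset (by simp)
    have z₂ : s₂.reg zero = 0 := by simpa [z₁] using f.reg zero rfl
    have o₂ : s₂.reg one = 1 := by simpa [o₁] using f.reg one rfl
    have x₂ : s₂.reg x = s.num inS a := by simpa [x₁] using f.reg x rfl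
    simp only [wp_ifEq, wp_skip, wp_store]
    constructor <;> intro hx <;> simp [x₂, z₂] at hx
    · exact ⟨h₃.congr rfl, h₄, fun d hd hdl hm => absurd hx hm⟩
    · have : ∀ e, Marked (((s₂.setReg w b).setNum outS b 1)) e ↔ e = (false, b) ∨ Marked s₂ e :=
        fun e => marked_setNum_outS b
      rw [show (s₂.setReg w b).reg w = b by simp, show (s₂.setReg w b).reg one = 1 by simp [o₂]]
      refine ⟨h₃.mark (p := (true, a)) this hx (Or.inr ⟨hb, rfl, rfl⟩),
        fun p hp => (this p).2 (Or.inr (h₄ p hp)),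
        fun d hd hdl hm => ?_⟩
      by_cases hdb : d = b
      · exact (this _).2 (Or.inl (by rw [hdb]))
      · exact (this _).2 (Or.inr (h₅ d hd (by simp [hdb, hdl]) hm))
  · rintro s₂ - ⟨h₃, h₄, h₅⟩
    refine ⟨h₃, ?_⟩
    rintro ⟨c, p⟩ ⟨d, q⟩ rfl hm (⟨hq, hd⟩ | ⟨hq, hc, hd⟩)
    · obtain rfl : d = !c := hd
      exact h₄ _ (h₂ q hq (by simp) c hm)
    · obtain rfl : c = true := hc
      obtain rfl : d = false := hd
      exact h₅ q hq (by simp) hm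

/-- Marks are never erased, so what is concluded at one vertex survives the rest of the round.
Numbers outside the vertex list have no neighbours and imply nothing. -/
theorem wp_round (h₀ : IsInstance n L s₀) (hz : s.reg zero = 0) (ho : s.reg one = 1)
    (hl : s.lst = s₀.lst) :
    wp L round (fun s' => Extends s₀ s s' ∧
      ∀ p q, Marked s p → Implies s₀ p q → Marked s' q) s := by
  refine wp_forEach (s₀.lst input 0) (fun l s' => Extends s₀ s s' ∧
    ∀ p q, p.2 ∉ l → Marked s p → Implies s₀ p q → Marked s' q) (by rw [hl, hz])
    h₀.input_length ⟨.refl _ _, ?_⟩ ?_ ?_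
  · rintro p q hp - (⟨hq, -⟩ | ⟨hq, -⟩)
    · exact absurd ((h₀.mem_input _).2 (h₀.pos_lt _ _ hq).1) hp
    · exact absurd ((h₀.mem_input _).2 (h₀.neg_lt _ _ hq).1) hp
  · rintro b l s₁ f hsuf ⟨h₁, h₂⟩
    refine wp_mono (wp_propagate (a := b) h₀ ?_ ?_ ?_ (by simp)) ?_
    · simpa [hz] using f.reg zero rfl
    · simpa [ho] using f.reg one rfl
    · simpa [hl] using funext fun i => f.lst i rfl
    · rintro s₂ ⟨h₃, h₄⟩
      have h₃' : Extends s₀ s₁ s₂ := ⟨h₃.mono, h₃.sound⟩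
      refine ⟨h₁.trans h₃', fun p q hp hm hpq => ?_⟩
      by_cases hpb : p.2 = b
      · exact h₄ p q hpb (h₁.mono p hm) hpq
      · exact h₃.mono q (h₂ p q (by simp [hpb, hp]) hm hpq)
  · rintro s₁ - ⟨h₁, h₂⟩
    exact ⟨h₁, fun p q => h₂ p q (by simp)⟩

instance (s : Store) : DecidablePred (Marked s) := fun p =>
  inferInstanceAs (Decidable (s.num (bif p.1 then inS else outS) p.2 ≠ 0))

/-- The number of literals that are known to hold. -/
def markCount (n : ℕ) (s : Store) : ℕ :=
  ((Finset.univ ×ˢ Finset.range n).filter (Marked s)).card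

theorem markCount_le (n : ℕ) (s : Store) : markCount n s ≤ 2 * n :=
  (Finset.card_filter_le _ _).trans (by simp)

/-- One round either draws a new conclusion, or there are none left. -/
theorem wp_round_progress (h₀ : IsInstance n L s₀) (hz : s.reg zero = 0) (ho : s.reg one = 1)
    (hl : s.lst = s₀.lst) :
    wp L round (fun s' => Extends s₀ s s' ∧
      (Closed s₀ {p | Marked s' p} ∨ ¬Closed s₀ {p | Marked s p} ∧
        markCount n s + 1 ≤ markCount n s')) s := by
  refine wp_mono (wp_round h₀ hz ho hl) ?_
  rintro s' ⟨h₁, h₂⟩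
  refine ⟨h₁, or_iff_not_imp_left.2 fun hc => ⟨fun hs => hc ?_, ?_⟩⟩
  -- If the old marks were closed, soundness would show that no mark is new, and the new marks would
  -- be closed as well.
  · intro p hp q hpq
    exact h₂ p q (h₁.sound _ hs (fun _ h => h) p hp) hpq
  · have hsub : (Finset.univ ×ˢ Finset.range n).filter (Marked s) ⊆
        (Finset.univ ×ˢ Finset.range n).filter (Marked s') :=
      Finset.monotone_filter_right _ fun p _ hp => h₁.mono p hp
    -- If no mark on a vertex is new, then all consequences of the present marks were drawn in this
    -- very round, so the marks are closed.
    refine Finset.card_lt_card (hsub.ssubset_of_ne fun heq => hc fun p hp q hpq => ?_)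
    have hpn : p.2 < n := by
      rcases hpq with ⟨hq, -⟩ | ⟨hq, -⟩
      exacts [(h₀.pos_lt _ _ hq).1, (h₀.neg_lt _ _ hq).1]
    have : p ∈ (Finset.univ ×ˢ Finset.range n).filter (Marked s') := by
      simpa [hpn] using hp
    rw [← heq, Finset.mem_filter] at this
    exact h₂ p q this.2 hpq

/-- There are `2 * n` literals, one is marked initially, and each round adds another until the marks
are closed; two rounds per vertex are therefore enough. The failure of closure would give `2 * n +
1` marks in the end. -/
theorem wp_saturate (h₀ : IsInstance n L s₀) (hz : s.reg zero = 0) (ho : s.reg one = 1)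
    (hl : s.lst = s₀.lst) (hm : ∃ p, p.2 < n ∧ Marked s p) :
    wp L saturate (fun s' => Extends s₀ s s' ∧ Closed s₀ {p | Marked s' p}) s := by
  refine wp_forEach (s₀.lst input 0) (fun l s' => Extends s₀ s s' ∧
    (Closed s₀ {p | Marked s' p} ∨ 2 * n + 1 ≤ markCount n s' + 2 * l.length)) (by rw [hl, hz])
    h₀.input_length ⟨.refl _ _, Or.inr ?_⟩ ?_ ?_
  · obtain ⟨p, hp, hm⟩ := hm
    have : 0 < markCount n s := Finset.card_pos.2 ⟨p, by simp [hp, hm]⟩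
    rw [h₀.input_length_eq]
    omega
  · rintro b l s₁ f hsuf ⟨h₁, h₂⟩
    have z₁ : s₁.reg zero = 0 := by simpa [hz] using f.reg zero rfl
    have o₁ : s₁.reg one = 1 := by simpa [ho] using f.reg one rfl
    have l₁ : s₁.lst = s₀.lst := by simpa [hl] using funext fun i => f.lst i rfl
    rw [wp_block_cons]
    refine wp_conseq (wp_round_progress (n := n) h₀ (by simpa using z₁) (by simpa using o₁)
      (by simpa using l₁)) ?_
    rintro s₂ f₂ ⟨h₃, h₄⟩
    rw [wp_block_singleton]
    refine wp_conseq (wp_round_progress (n := n) h₀ ?_ ?_ ?_) ?_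
    · simpa [z₁] using f₂.reg zero rfl
    · simpa [o₁] using f₂.reg one rfl
    · simpa [l₁] using funext fun i => f₂.lst i rfl
    rintro s₃ - ⟨h₅, h₆⟩
    have h₃' : Extends s₀ s₁ s₂ := ⟨h₃.mono, h₃.sound⟩
    refine ⟨(h₁.trans h₃').trans h₅, h₆.imp_right fun ⟨h₇, h₈⟩ => ?_⟩
    -- If the second round does not end closed, neither the state before it nor the one before the
    -- first round was closed, so both rounds added a mark.
    obtain ⟨h₉, h₁₀⟩ := h₄.resolve_left h₇
    have := h₂.resolve_left h₉
    have hc : markCount n (s₁.setReg z b) = markCount n s₁ := rfl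
    simp only [List.length_cons] at this
    omega
  · rintro s₁ - ⟨h₁, h₂⟩
    refine ⟨h₁, h₂.resolve_right fun h => ?_⟩
    have := markCount_le n s₁
    simp only [List.length_nil] at h
    omega

-- Soundness applied to the closed set of reachable literals gives one inclusion, closure of the
-- final marks the other. The first conclusion lets the next test erase all marks by running through
-- the vertex list.
open Relation in
theorem wp_test (h₀ : IsInstance n L s₀) (hz : s.reg zero = 0) (ho : s.reg one = 1)
    (hl : s.lst = s₀.lst) (ha : a < n) (hv : s.reg v = a) (hm : ∀ p, Marked s p → p.2 < n)
    (c d : Bool) (r : ℕ) :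
    wp L (test (bif c then inS else outS) (bif d then inS else outS) r) (fun s' =>
      (∀ p, Marked s' p → p.2 < n) ∧
      (s'.reg r ≠ 0 ↔ ReflTransGen (Implies s₀) (c, a) (d, a))) s := by
  rw [test, wp_block_cons]
  refine wp_forEach (s₀.lst input 0) (fun l s' => ∀ p, Marked s' p → p.2 ∈ l)
    (by rw [hl, hz]) h₀.input_length (fun p hp => (h₀.mem_input _).2 (hm p hp)) ?_ ?_
  · rintro b l s₁ f hsuf h₁
    have z₁ : s₁.reg zero = 0 := by simpa [hz] using f.reg zero rfl
    simp only [wp_block_cons, wp_block_singleton, wp_store]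
    rintro ⟨e, p⟩ hp
    by_cases hpb : p = b
    · cases e <;> simp [Marked, hpb, z₁] at hp
    · refine (List.mem_cons.1 (h₁ (e, p) ?_)).resolve_left hpb
      cases e <;> simpa [Marked, hpb] using hp
  intro s₁ f₁ h₁
  have z₁ : s₁.reg zero = 0 := by simpa [hz] using f₁.reg zero rfl
  have o₁ : s₁.reg one = 1 := by simpa [ho] using f₁.reg one rfl
  have l₁ : s₁.lst = s₀.lst := by simpa [hl] using funext fun i => f₁.lst i rfl
  have v₁ : s₁.reg v = a := by simpa [hv] using f₁.reg v rfl
  rw [wp_block_cons, wp_store, o₁, v₁]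
  have h₂ : ∀ p, Marked (s₁.setNum (bif c then inS else outS) a 1) p ↔ p = (c, a) := by
    intro p
    have : ¬Marked s₁ p := fun hp => by simpa using h₁ p hp
    cases c
    · simpa [this] using marked_setNum_outS (s := s₁) (p := p) a
    · simpa [this] using marked_setNum_inS (s := s₁) (p := p) a
  rw [wp_block_cons]
  refine wp_conseq (wp_saturate (n := n) h₀ (by simpa using z₁) (by simpa using o₁)
    (by simpa using l₁) ⟨(c, a), ha, (h₂ _).2 rfl⟩) ?_
  rintro s₂ f₂ ⟨h₃, h₄⟩
  have v₂ : s₂.reg v = a := by simpa [v₁] using f₂.reg v rfl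
  have h₅ : ∀ p, Marked s₂ p ↔ ReflTransGen (Implies s₀) (c, a) p := by
    intro p
    constructor
    · refine h₃.sound {p | ReflTransGen (Implies s₀) (c, a) p} (fun p hp q hpq => hp.tail hpq) ?_ p
      intro p hp
      rw [(h₂ p).1 hp]
      exact .refl
    · intro hp
      induction hp with
      | refl => exact h₃.mono _ ((h₂ _).2 rfl)
      | tail _ hbc ih => exact h₄ _ ih _ hbc
  rw [wp_block_singleton, wp_load]
  refine ⟨fun p hp => ?_, ?_⟩
  · rcases ((h₅ p).1 hp).cases_tail with rfl | ⟨q, -, ⟨hq, -⟩ | ⟨hq, -⟩⟩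
    exacts [ha, (h₀.pos_lt _ _ hq).2, (h₀.neg_lt _ _ hq).2]
  · rw [← h₅]
    simp [Marked, v₂]

open Relation in
/-- The vertex `a` can be neither in `S` nor outside. -/
def Contradictory (s₀ : Store) (a : ℕ) : Prop :=
  ReflTransGen (Implies s₀) (true, a) (false, a) ∧ ReflTransGen (Implies s₀) (false, a) (true, a)

/-- Once `ans` is set to `no` it is never reset, so the vertices already treated are either all free
of contradiction or one contradictory vertex has been found. -/
theorem wp_decision (h₀ : IsInstance n L s) (hz : s.reg zero = 0)
    (hm : ∀ p, ¬Marked s p) (yes no : ℕ) :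
    wp L (decision yes no) (fun s' =>
      (s'.reg ans = yes ∧ ∀ a < n, ¬Contradictory s a) ∨
      (s'.reg ans = no ∧ ∃ a < n, Contradictory s a)) s := by
  simp only [decision, wp_block_cons, wp_block_singleton, wp_const]
  refine wp_forEach (s.lst input 0) (fun l s' => (∀ p, Marked s' p → p.2 < n) ∧
      ((s'.reg ans = yes ∧ ∀ a < n, a ∉ l → ¬Contradictory s a) ∨
      (s'.reg ans = no ∧ ∃ a < n, Contradictory s a))) (by simp [hz])
    h₀.input_length ⟨fun p hp => absurd hp (hm p), Or.inl ⟨by simp, fun a ha hal =>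
      absurd ((h₀.mem_input a).2 ha) hal⟩⟩ ?_ ?_
  · rintro a l s₁ f hsuf ⟨h₁, h₂⟩
    have ha : a < n := (h₀.mem_input a).1 (hsuf.subset (by simp))
    have z₁ : s₁.reg zero = 0 := by simpa [hz] using f.reg zero rfl
    have o₁ : s₁.reg one = 1 := by simpa using f.reg one rfl
    have l₁ : s₁.lst = s.lst := by simpa using funext fun i => f.lst i rfl
    rw [wp_block_cons]
    refine wp_conseq (wp_test (s := s₁.setReg v a) (a := a) h₀ (by simpa using z₁) (by simpa using o₁) l₁
      ha (by simp) h₁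
      true false flag) ?_
    rintro s₂ f₂ ⟨h₃, h₄⟩
    have z₂ : s₂.reg zero = 0 := by simpa [z₁] using f₂.reg zero rfl
    have o₂ : s₂.reg one = 1 := by simpa [o₁] using f₂.reg one rfl
    have l₂ : s₂.lst = s.lst := by simpa [l₁] using funext fun i => f₂.lst i rfl
    have v₂ : s₂.reg v = a := by simpa using f₂.reg v rfl
    have a₂ : s₂.reg ans = s₁.reg ans := by simpa using f₂.reg ans rfl
    rw [wp_block_cons]
    refine wp_conseq (wp_test (a := a) h₀ z₂ o₂ l₂ ha v₂ h₃ false true hit) ?_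
    rintro s₃ f₃ ⟨h₅, h₆⟩
    have z₃ : s₃.reg zero = 0 := (f₃.reg zero rfl).trans z₂
    have a₃ : s₃.reg ans = s₁.reg ans := (f₃.reg ans rfl).trans a₂
    rw [← f₃.reg flag rfl] at h₄
    have key : ¬Contradictory s a → (∀ p, Marked s₃ p → p.2 < n) ∧
        ((s₃.reg ans = yes ∧ ∀ a < n, a ∉ l → ¬Contradictory s a) ∨
          (s₃.reg ans = no ∧ ∃ a < n, Contradictory s a)) := by
      rw [a₃]
      refine fun hc => ⟨h₅, h₂.imp_left fun ⟨h₇, h₈⟩ => ⟨h₇, fun b hb hbl => ?_⟩⟩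
      by_cases hba : b = a
      · rwa [hba]
      · exact h₈ b hb (by simp [hba, hbl])
    simp only [wp_block_singleton, wp_ifEq, wp_skip, wp_const, z₃]
    refine ⟨fun hf => key fun hc => h₄.2 hc.1 hf, fun hf => ⟨fun hh => key fun hc => h₆.2 hc.2 hh,
      fun hh => ⟨h₅, Or.inr ⟨by simp, a, ha, h₄.1 hf, h₆.1 hh⟩⟩⟩⟩
  · rintro s₁ - ⟨-, h⟩
    simpa using h

end MaxDefDecision

/-! ### Stable covers and the maximum deficiency. -/

namespace SignedGraph

variable {V E : Type} {G : SignedGraph V E}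

theorem Adj.symm {ε : ℤˣ} {a b : V} (h : G.Adj ε a b) : G.Adj ε b a := by
  obtain ⟨e, he, hε⟩ := h
  exact ⟨e, he.trans Sym2.eq_swap, hε⟩

/-- `S` contains exactly one end of every positive edge and at most one end of every negative
edge. -/
def IsStableCover (G : SignedGraph V E) (S : Set V) : Prop :=
  (∀ a b, G.Adj 1 a b → (a ∈ S ↔ b ∉ S)) ∧ ∀ a b, G.Adj (-1) a b → ¬(a ∈ S ∧ b ∈ S)

theorem isProper_iff {κ : V → ℤ} : G.IsProper κ ↔
    (∀ a b, G.Adj 1 a b → κ a ≠ κ b) ∧ ∀ a b, G.Adj (-1) a b → κ a ≠ -κ b := by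
  constructor
  · intro h
    constructor <;> rintro a b ⟨e, he, hs⟩
    · simpa [hs] using h e a b he
    · simpa [hs] using h e a b he
  · rintro ⟨h₁, h₂⟩ e a b he
    rcases Int.units_eq_one_or (G.sign e) with hs | hs
    · simpa [hs] using h₁ a b ⟨e, he, hs⟩
    · simpa [hs] using h₂ a b ⟨e, he, hs⟩

theorem mem_colorSet_three {c : ℤ} : c ∈ colorSet 3 ↔ c = -1 ∨ c = 0 ∨ c = 1 := by
  simp [colorSet, Nat.even_iff]
  omega

theorem mem_colorSet_two {c : ℤ} : c ∈ colorSet 2 ↔ c = -1 ∨ c = 1 := by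
  simp [colorSet]
  omega

theorem mem_colorSet_one {c : ℤ} : c ∈ colorSet 1 ↔ c = 0 := by
  simp [colorSet]

theorem not_isProper_of_lt {m : ℕ} (hm : m < G.chromaticNumber) {κ : V → ℤ} (h : G.IsProper κ) :
    ∃ v, κ v ∉ colorSet m := by
  by_contra! hκ
  exact absurd (Nat.sInf_le (show m ∈ {m | ∃ κ : V → ℤ, G.IsProper κ ∧ ∀ v, κ v ∈ colorSet m} from
    ⟨κ, h, hκ⟩)) (not_le.2 hm)

/-- A minimal coloration with an unused color of a 3-chromatic signed graph gives a stable cover. -/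
theorem IsMinimal.exists_isStableCover (hG : G.chromaticNumber = 3) {κ : V → ℤ}
    (h : G.IsMinimal κ) (hd : G.deficiency κ ≠ 0) : ∃ S, G.IsStableCover S := by
  obtain ⟨hp, hc⟩ := h
  obtain ⟨c, hc'⟩ := Finset.card_ne_zero.1 hd
  rw [hG] at hc hc'
  simp only [Finset.mem_filter, mem_colorSet_three] at hc' hc
  obtain ⟨hc₁, hc₂⟩ := hc'
  -- If 0 were the unused color, the coloration would use only the two colors of the color set of
  -- size 2.
  have hc₀ : c ≠ 0 := by
    rintro rfl
    obtain ⟨v, hv⟩ := not_isProper_of_lt (m := 2) (by omega) hp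
    rw [mem_colorSet_two] at hv
    have := hc v
    have := hc₂ v
    omega
  rw [isProper_iff] at hp
  -- The unused color is 1 or -1, so besides 0 only one color occurs: a positive edge has exactly
  -- one end colored 0. A negative edge cannot have two, since 0 equals its negative.
  refine ⟨{v | κ v = 0}, fun a b hab => ?_, fun a b hab => ?_⟩
  · have := hp.1 a b hab
    have := hc a
    have := hc b
    have := hc₂ a
    have := hc₂ b
    simp only [Set.mem_ofPred_eq]
    omega
  · have := hp.2 a b hab
    simp only [Set.mem_ofPred_eq]
    omega

-- Color `S` with 0 and the rest with 1. Positive edges get both colors, negative edges never get 0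
-- twice, and 1 differs from -1; the color -1 is unused.
open Classical in
theorem IsStableCover.exists_isMinimal (hG : G.chromaticNumber = 3) {S : Set V}
    (h : G.IsStableCover S) : ∃ κ, G.IsMinimal κ ∧ G.deficiency κ ≠ 0 := by
  have hκ : ∀ v, (if v ∈ S then (0 : ℤ) else 1) = 0 ∧ v ∈ S ∨
      (if v ∈ S then (0 : ℤ) else 1) = 1 ∧ v ∉ S := fun v => by
    by_cases hv : v ∈ S <;> simp [hv]
  generalize hκ' : (fun v => if v ∈ S then (0 : ℤ) else 1) = κ
  have hκ : ∀ v, κ v = 0 ∧ v ∈ S ∨ κ v = 1 ∧ v ∉ S := fun v => hκ' ▸ hκ v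
  refine ⟨κ, ⟨isProper_iff.2 ⟨fun a b hab => ?_, fun a b hab => ?_⟩, fun v => ?_⟩, ?_⟩
  · have := h.1 a b hab
    rcases hκ a with ⟨h₁, h₂⟩ | ⟨h₁, h₂⟩ <;> rcases hκ b with ⟨h₃, h₄⟩ | ⟨h₃, h₄⟩ <;>
      simp_all
  · have := h.2 a b hab
    rcases hκ a with ⟨h₁, h₂⟩ | ⟨h₁, h₂⟩ <;> rcases hκ b with ⟨h₃, h₄⟩ | ⟨h₃, h₄⟩ <;>
      simp_all
  · rw [hG, mem_colorSet_three]
    have := hκ v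
    omega
  · refine Finset.card_ne_zero.2 ⟨-1, ?_⟩
    rw [hG, Finset.mem_filter, mem_colorSet_three]
    refine ⟨Or.inl rfl, fun v => ?_⟩
    have := hκ v
    omega

-- Some vertex has the color 0, as two colors do not suffice, and some vertex has a nonzero color,
-- as the color 0 alone does not suffice.
open Classical in
theorem IsMinimal.deficiency_le_one (hG : G.chromaticNumber = 3) {κ : V → ℤ}
    (h : G.IsMinimal κ) : G.deficiency κ ≤ 1 := by
  obtain ⟨hp, hc⟩ := h
  rw [hG] at hc
  simp only [mem_colorSet_three] at hc
  obtain ⟨v, hv⟩ := not_isProper_of_lt (m := 1) (by omega) hp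
  obtain ⟨v', hv'⟩ := not_isProper_of_lt (m := 2) (by omega) hp
  rw [mem_colorSet_one] at hv
  rw [mem_colorSet_two] at hv'
  refine Finset.card_le_one.2 fun c hc' d hd => ?_
  rw [hG] at hc' hd
  simp only [Finset.mem_filter, mem_colorSet_three] at hc' hd
  have := hc v
  have := hc v'
  have := hc'.2 v
  have := hc'.2 v'
  have := hd.2 v
  have := hd.2 v'
  omega

theorem maxDeficiency_eq (hG : G.chromaticNumber = 3) :
    ((∃ S, G.IsStableCover S) ∧ G.maxDeficiency = 1) ∨
      ((¬∃ S, G.IsStableCover S) ∧ G.maxDeficiency = 0) := by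
  have hle : G.maxDeficiency ≤ 1 := by
    refine csSup_le' ?_
    rintro d ⟨κ, hκ, rfl⟩
    exact hκ.deficiency_le_one hG
  by_cases h : ∃ S, G.IsStableCover S
  · refine Or.inl ⟨h, le_antisymm hle ?_⟩
    obtain ⟨S, hS⟩ := h
    obtain ⟨κ, hκ, hd⟩ := hS.exists_isMinimal hG
    refine (Nat.one_le_iff_ne_zero.2 hd).trans (le_csSup ⟨1, ?_⟩ ⟨κ, hκ, rfl⟩)
    rintro d ⟨κ, hκ, rfl⟩
    exact hκ.deficiency_le_one hG
  · refine Or.inr ⟨h, Nat.le_zero.1 (csSup_le' ?_)⟩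
    rintro d ⟨κ, hκ, rfl⟩
    by_contra hd
    exact h (hκ.exists_isStableCover hG fun h₀ => hd (by omega))

end SignedGraph

/-! ### The decision problems are in P. -/

namespace MaxDefDecision

open MaxDef

/-- A cover is a truth assignment, and truth propagates along implications, so no vertex is
contradictory. Conversely, the consistent closed set of literals from the 2-satisfiability lemma
defines `S`; contrapositives are available because adjacency is symmetric. -/
theorem exists_isStableCover_iff {n : ℕ} {E : Type} {G : SignedGraph (Fin n) E} {s : Store}
    (h : IsLoaded G s) :
    (∃ S, G.IsStableCover S) ↔ ∀ a < n, ¬Contradictory s a := by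
  constructor
  · rintro ⟨S, hS₁, hS₂⟩ a ha ⟨h₁, h₂⟩
    have key : ∀ p q : Bool × ℕ, Relation.ReflTransGen (Implies s) p q →
        (∀ hp : p.2 < n, (⟨p.2, hp⟩ ∈ S ↔ p.1 = true)) →
        ∀ hq : q.2 < n, (⟨q.2, hq⟩ ∈ S ↔ q.1 = true) := by
      intro p q hpq hp
      induction hpq with
      | refl => exact hp
      | tail _ hbc ih =>
        rename_i b c _
        intro hc
        rcases hbc with ⟨h₃, h₄⟩ | ⟨h₃, h₄, h₅⟩
        · obtain ⟨x, y, hx, hy, hxy⟩ := (h.pos _ _).1 h₃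
          have hb := ih (hx ▸ x.2)
          have hx' : x = ⟨b.2, hx ▸ x.2⟩ := Fin.ext hx
          have hy' : y = ⟨c.2, hc⟩ := Fin.ext hy
          have := hS₁ x y hxy
          rw [hx', hy', hb] at this
          rw [h₄, Bool.not_eq_true', ← Bool.not_eq_true, this, not_not]
        · obtain ⟨x, y, hx, hy, hxy⟩ := (h.neg _ _).1 h₃
          have hb := ih (hx ▸ x.2)
          have hx' : x = ⟨b.2, hx ▸ x.2⟩ := Fin.ext hx
          have hy' : y = ⟨c.2, hc⟩ := Fin.ext hy
          have := hS₂ x y hxy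
          rw [hx', hy', hb] at this
          simp_all
    by_cases haS : (⟨a, ha⟩ : Fin n) ∈ S
    · have := key _ _ h₁ (fun _ => by simpa using haS) ha
      simp [haS] at this
    · have := key _ _ h₂ (fun _ => by simpa using haS) ha
      simp [haS] at this
  · intro hc
    obtain ⟨T, hT₁, hT₂, hT₃⟩ := exists_closed_of_forall_not_reflTransGen (r := Implies s) (by
      rintro ⟨b, p⟩ ⟨c, q⟩ (⟨h₁, h₂⟩ | ⟨h₁, h₂, h₃⟩)
      · obtain ⟨x, y, hx, hy, hxy⟩ := (h.pos _ _).1 h₁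
        refine Or.inl ⟨(h.pos _ _).2 ⟨y, x, hy, hx, hxy.symm⟩, ?_⟩
        simp only [Literal.not] at h₂ ⊢
        rw [h₂]
        simp
      · obtain ⟨x, y, hx, hy, hxy⟩ := (h.neg _ _).1 h₁
        refine Or.inr ⟨(h.neg _ _).2 ⟨y, x, hy, hx, hxy.symm⟩, ?_⟩
        simp only [Literal.not] at h₂ h₃ ⊢
        simp [h₂, h₃]) n hc
    refine ⟨{a | (true, a.val) ∈ T}, fun a b hab => ?_, fun a b hab => ?_⟩
    · have hab' := (h.pos a b).2 ⟨a, b, rfl, rfl, hab⟩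
      constructor
      · intro ha hb
        exact hT₂ _ hb (hT₁ _ ha (false, b.val) (Or.inl ⟨hab', rfl⟩))
      · intro hb
        by_contra ha
        exact hb (hT₁ _ ((hT₃ a a.2).resolve_left ha) (true, b.val) (Or.inl ⟨hab', rfl⟩))
    · rintro ⟨ha, hb⟩
      have hab' := (h.neg a b).2 ⟨a, b, rfl, rfl, hab⟩
      exact hT₂ _ hb (hT₁ _ ha (false, b.val) (Or.inr ⟨hab', rfl, rfl⟩))

theorem exists_decision (yes no : ℕ) : ∃ (c : Cmd) (p : Polynomial ℕ),
    ∀ (n : ℕ) (E : Type) (G : SignedGraph (Fin n) E) (w : List (List ℕ)), Encodes w G →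
      G.chromaticNumber = 3 → ∃ s t, Exec c (Store.ofInput w) s t ∧ t ≤ p.eval (inputSize w) ∧
        ((s.reg answerReg = yes ∧ G.maxDeficiency = 1) ∨
          (s.reg answerReg = no ∧ G.maxDeficiency = 0)) := by
  set c : Cmd := Cmd.block [.const idx 1, readEdges posA, .const idx 2, readEdges negA,
    decision yes no] with hc
  obtain ⟨C, hC⟩ := c.exists_bound_le
  refine ⟨c, .C C * (.X + 1) ^ c.depth, fun n E G w hw hG => ?_⟩
  obtain ⟨vs, pos, neg, hvs, hpos, hneg, rfl⟩ := hw
  have hlen : ∀ l : List ℕ, l.length ≤ (l.map fun n => 1 + Nat.size n).sum := by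
    intro l
    induction l with
    | nil => simp
    | cons a l ih =>
      simp only [List.length_cons, List.map_cons, List.sum_cons]
      omega
  have hflat : ∀ l : List (Fin n × Fin n),
      (l.flatMap fun p => [p.1.val, p.2.val]).length = 2 * l.length := fun l => by
    simp [List.length_flatMap, mul_comm]
  -- Every entry and every list contributes at least its separator to the input size, so `inputSize`
  -- itself can serve as the bound `L` for the loops.
  have hsize : n + 2 * pos.length + 2 * neg.length + 3 ≤ inputSize (graphInput vs pos neg) := by
    have h₁ := hlen (vs.map Fin.val)
    have h₂ := hlen (pos.flatMap fun p => [p.1.val, p.2.val])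
    have h₃ := hlen (neg.flatMap fun p => [p.1.val, p.2.val])
    rw [List.length_map, hvs.length_eq] at h₁
    rw [hflat] at h₂ h₃
    simp only [inputSize, graphInput, List.map_cons, List.map_nil, List.sum_cons, List.sum_nil]
    omega
  have hwp := wp_load_graph (L := inputSize (graphInput vs pos neg)) (c := decision yes no)
    (Q := fun s => (s.reg ans = yes ∧ G.maxDeficiency = 1) ∨ (s.reg ans = no ∧ G.maxDeficiency = 0))
    hvs hpos hneg (by omega) fun s h hl => by
      refine Cmd.wp_mono (wp_decision (n := n) ⟨?_, ?_, h.mem_input, fun v => ?_, fun v => ?_,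
        fun v w hw => ?_, fun v w hw => ?_⟩ h.zero ?_ yes no) ?_
      · have := h.input_length
        omega
      · refine le_antisymm h.input_length ?_
        have := (List.nodup_range.subperm (l₁ := List.range n) (l₂ := s.lst input 0) fun v hv =>
          (h.mem_input v).2 (by simpa using hv)).length_le
        simpa using this
      · have := h.pos_length v
        omega
      · have := h.neg_length v
        omega
      · obtain ⟨a, b, rfl, rfl, -⟩ := (hl.pos v w).1 hw
        exact ⟨a.2, b.2⟩
      · obtain ⟨a, b, rfl, rfl, -⟩ := (hl.neg v w).1 hw
        exact ⟨a.2, b.2⟩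
      · intro p
        simp [Marked, h.num]
      · intro s' hs'
        have hiff := exists_isStableCover_iff hl
        rcases SignedGraph.maxDeficiency_eq hG with ⟨h₁, h₂⟩ | ⟨h₁, h₂⟩
        · refine Or.inl ⟨(hs'.resolve_right ?_).1, h₂⟩
          rintro ⟨-, a, ha, hca⟩
          exact hiff.1 h₁ a ha hca
        · refine Or.inr ⟨(hs'.resolve_left ?_).1, h₂⟩
          rintro ⟨-, ha⟩
          exact h₁ (hiff.2 ha)
  obtain ⟨s, t, he, ht, h⟩ := Cmd.exec_of_wp hwp
  refine ⟨s, t, he, ht.trans ((hC _).trans (le_of_eq ?_)), h⟩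
  simp

/-- `yes` and `no` are the outputs for `M = 1` and `M = 0`, so both problems are covered. An input
may encode several signed graphs; as the program is deterministic, its single answer is right for
all of them. -/
theorem inP_threeChromaticInputs {yes no : ℕ} {Q : ℕ → Prop}
    (h₁ : Q 1 ∧ yes = 1 ∨ ¬Q 1 ∧ yes = 0) (h₀ : Q 0 ∧ no = 1 ∨ ¬Q 0 ∧ no = 0) :
    InP (threeChromaticInputs Q) (threeChromaticInputs fun m => ¬Q m) := by
  obtain ⟨c, p, h⟩ := exists_decision yes no
  refine ⟨c, p, fun w hw => ?_⟩
  have hex : ∃ (n : ℕ) (E : Type) (G : SignedGraph (Fin n) E),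
      Encodes w G ∧ G.chromaticNumber = 3 := by
    rcases hw with ⟨n, E, G, hG, hχ, -⟩ | ⟨n, E, G, hG, hχ, -⟩ <;> exact ⟨n, E, G, hG, hχ⟩
  obtain ⟨n, E, G, hG, hχ⟩ := hex
  obtain ⟨s, t, he, ht, -⟩ := h n E G w hG hχ
  have key : ∀ (n : ℕ) (E : Type) (G : SignedGraph (Fin n) E), Encodes w G →
      G.chromaticNumber = 3 → (s.reg answerReg = yes ∧ G.maxDeficiency = 1) ∨
        (s.reg answerReg = no ∧ G.maxDeficiency = 0) := by
    intro n E G hG hχ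
    obtain ⟨s', t', he', -, h'⟩ := h n E G w hG hχ
    rwa [(he.deterministic he').1]
  refine ⟨s, t, he, ht, ?_, ?_⟩
  · rintro ⟨n, E, G, hG, hχ, hQ⟩
    rcases key n E G hG hχ with ⟨h₂, h₃⟩ | ⟨h₂, h₃⟩
    · rw [h₃] at hQ
      rw [h₂]
      tauto
    · rw [h₃] at hQ
      rw [h₂]
      tauto
  · rintro ⟨n, E, G, hG, hχ, hQ⟩
    rcases key n E G hG hχ with ⟨h₂, h₃⟩ | ⟨h₂, h₃⟩
    · rw [h₃] at hQ
      rw [h₂]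
      tauto
    · rw [h₃] at hQ
      rw [h₂]
      tauto

end MaxDefDecision

theorem mainTheorem2 :
    -- MaxDef runs in time `O(V⁵)`
    (∃ C : ℕ, ∀ (n : ℕ) (E : Type) (G : SignedGraph (Fin n) E),
      G.NoMultipleSameSign → G.chromaticNumber = 3 →
      ∀ (vs : List (Fin n)) (pos neg : Fin n → List (Fin n)),
        IsVertexList vs → G.IsAdjacencyArray 1 pos → G.IsAdjacencyArray (-1) neg →
        ∃ s t, Exec MaxDef.maxDef (MaxDef.adjacencyInput vs pos neg) s t ∧ t ≤ C * n ^ 5) ∧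
    -- MaxDef is polynomial in the size of a vertex list and two edge lists
    (∃ p : Polynomial ℕ, ∀ (n : ℕ) (E : Type) [Fintype E] (G : SignedGraph (Fin n) E),
      G.NoMultipleSameSign → G.chromaticNumber = 3 →
      ∀ w : List (List ℕ), Encodes w G →
        ∃ s t, Exec MaxDef.maxDefOfLists (Store.ofInput w) s t ∧
          t ≤ p.eval (n + Fintype.card E)) ∧
    -- for 3-chromatic signed graphs, `M = 1?` and `M = 0?` are in P
    InP (threeChromaticInputs (· = 1)) (threeChromaticInputs (· ≠ 1)) ∧
    InP (threeChromaticInputs (· = 0)) (threeChromaticInputs (· ≠ 0)) :=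
  ⟨exists_maxDef_le, exists_maxDefOfLists_le,
    MaxDefDecision.inP_threeChromaticInputs (yes := 1) (no := 0) (Or.inl ⟨rfl, rfl⟩)
      (Or.inr ⟨zero_ne_one, rfl⟩),
    MaxDefDecision.inP_threeChromaticInputs (yes := 0) (no := 1) (Or.inr ⟨one_ne_zero, rfl⟩)
      (Or.inl ⟨rfl, rfl⟩)⟩
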